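/- Let $(G,K)$ be a compact symmetric pair: $G$ is a compact connected Lie group whose Lie algebra $\mathfrak g$ has negative definite Killing form $B$, $\sigma$ is an involutive automorphism of $G$, and $K$ is a closed subgroup of $G$ with $(G^\sigma)_0\subseteq K\subseteq G^\sigma$. Let $\theta=d\sigma_e$, and let $\mathfrak g=\mathfrak k\oplus\mathfrak p$ be the Cartan decomposition, i.e. the decomposition into the $(+1)$- and $(-1)$-eigenspaces of $\theta$; $\mathfrak k$ is the Lie algebra of $K$, and $\mathfrak p$ carries the inner product $-B|_{\mathfrak p\times\mathfrak p}$. Assume that $(G,K)$ satisfies the maximality property: $K$ is connected and contains no nontrivial normal subgroup of $G$, and $\mathrm{Ad}(K)|_{\mathfrak p}$ is maximal among the connected subgroups of $\mathrm O(\mathfrak p)$ that have the same orbits on $\mathfrak p$ as $\mathrm{Ad}(K)|_{\mathfrak p}$. Let $\mathcal F_{G/K}$ be the foliation of the unit sphere of $\mathfrak p$ by the orbits of $\mathrm{Ad}(K)$. A complex structure on $\mathfrak p$ is an orthogonal, skew-symmetric linear map $J\colon\mathfrak p\to\mathfrak p$; it preserves $\mathcal F_{G/K}$ if for every leaf $L$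 and every $v\in L$ the Hopf circle $\{\cos(t)v+\sin(t)Jv : t\in\mathbb R\}$ is contained in $L$. Let $\mathfrak t$ be a maximal abelian subalgebra of $\mathfrak k$. Then there exists a complex structure on $\mathfrak p$ preserving $\mathcal F_{G/K}$ if and only if $G/K$ is inner, that is, $\theta$ is an inner automorphism of $\mathfrak g$ ($\theta=\mathrm{Ad}(g)$ for some $g\in G$). In this situation, let $T\in\mathfrak t$. Call $\alpha\in(\mathfrak t^{\mathbb C})^*$, $\alpha\ne0$, a root of $\mathfrak g$ if $\mathfrak g_\alpha=\{X\in\mathfrak g^{\mathbb C} : [H,X]=i\,\alpha(H)X \text{ for all } H\in\mathfrak t\}$ is nonzero, and call it noncompact if $\mathfrak g_\alpha\subseteq\mathfrak p^{\mathbb C}$. Then $\mathrm{ad}(T)|_{\mathfrak p}$ is a complex structure on $\mathfrak p$ preserving $\mathcal F_{G/K}$ if and only if $\alpha(T)\in\{1,-1\}$ for all noncompact roots $\alpha$ of $\mathfrak g$; equivalently, for any fixed choice of positive roots, if and only if $\alpha(T)\in\{1,-1\}$ for all positive noncompact roots $\alpha$. -/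

import Mathlib

open scoped Manifold ContDiff TensorProduct
open VectorField

noncomputable section

/-! ### The Lie algebra and the adjoint representation of a Lie group -/

instance leInfty_minSmoothness_three : ENat.LEInfty (minSmoothness ℝ 3) :=
  ⟨by
    rw [minSmoothness_of_isRCLikeNormedField]
    exact ENat.LEInfty.out⟩

section LieGroups

variable {n : ℕ} {G : Type*} [TopologicalSpace G] [ChartedSpace (EuclideanSpace ℝ (Fin n)) G]
  [Group G]

/-- The Lie algebra `𝔤 = T_e G` of an `n`-dimensional Lie group. -/
abbrev LieAlg (n : ℕ) (G : Type*) [TopologicalSpace G]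
    [ChartedSpace (EuclideanSpace ℝ (Fin n)) G] [Group G] : Type :=
  GroupLieAlgebra (𝓡 n) G

/-- The differential at the identity of a group homomorphism `G → G`. The source of the coercion
is `T_{σ(e)} G = T_e G`. -/
def lieDifferential (n : ℕ) {G : Type*} [TopologicalSpace G]
    [ChartedSpace (EuclideanSpace ℝ (Fin n)) G] [Group G] (σ : G →* G) :
    LieAlg n G →L[ℝ] LieAlg n G :=
  mfderiv (𝓡 n) (𝓡 n) σ (1 : G)

/-- The adjoint representation: `Ad g` is the differential at `e` of `x ↦ g x g⁻¹`. -/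
def lieAd (n : ℕ) {G : Type*} [TopologicalSpace G]
    [ChartedSpace (EuclideanSpace ℝ (Fin n)) G] [Group G] (g : G) :
    LieAlg n G →L[ℝ] LieAlg n G :=
  lieDifferential n (MulAut.conj g).toMonoidHom

theorem lieDifferential_comp {σ τ : G →* G}
    (hσ : MDifferentiable (𝓡 n) (𝓡 n) σ) (hτ : MDifferentiable (𝓡 n) (𝓡 n) τ) :
    lieDifferential n (σ.comp τ) = (lieDifferential n σ).comp (lieDifferential n τ) := by
  have h := mfderiv_comp (I := 𝓡 n) (I' := 𝓡 n) (I'' := 𝓡 n) (1 : G) (hσ (τ 1)) (hτ 1)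
  have e : ∀ a : G, a = 1 →
      (mfderiv (𝓡 n) (𝓡 n) σ a : EuclideanSpace ℝ (Fin n) →L[ℝ] EuclideanSpace ℝ (Fin n))
        = mfderiv (𝓡 n) (𝓡 n) σ (1 : G) := by rintro a rfl; rfl
  have h2 := e (τ 1) (map_one τ)
  ext1 x
  have h3 := congrArg (fun f : EuclideanSpace ℝ (Fin n) →L[ℝ] EuclideanSpace ℝ (Fin n) => f x) h
  refine h3.trans ?_
  exact congrArg (fun f : EuclideanSpace ℝ (Fin n) →L[ℝ] EuclideanSpace ℝ (Fin n) =>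
    f (mfderiv (𝓡 n) (𝓡 n) τ (1 : G) x)) h2

theorem lieDifferential_id :
    lieDifferential n (MonoidHom.id G) = ContinuousLinearMap.id ℝ (LieAlg n G) :=
  mfderiv_id

theorem lieAd_one : lieAd n (1 : G) = 1 := by
  have : (MulAut.conj (1 : G)).toMonoidHom = MonoidHom.id G := by ext; simp
  rw [lieAd, this, lieDifferential_id]; rfl

variable [LieGroup (𝓡 n) ∞ G]

theorem mdifferentiable_conj (g : G) :
    MDifferentiable (𝓡 n) (𝓡 n) (MulAut.conj g).toMonoidHom := by
  have h : ContMDiff (𝓡 n) (𝓡 n) ∞ (fun x : G => g * x * g⁻¹) :=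
    (contMDiff_mul_right (a := g⁻¹)).comp (contMDiff_mul_left (a := g))
  exact h.mdifferentiable (by simp)

theorem lieAd_mul (g h : G) : lieAd n (g * h) = lieAd n g * lieAd n h := by
  have : (MulAut.conj (g * h)).toMonoidHom
      = (MulAut.conj g).toMonoidHom.comp (MulAut.conj h).toMonoidHom := by
    ext; simp
  rw [lieAd, this, lieDifferential_comp (mdifferentiable_conj g) (mdifferentiable_conj h)]; rfl

/-- The differential of a smooth involutive automorphism is a Lie algebra homomorphism. -/
theorem lieDifferential_lie {σ : G →* G} (hσ : ContMDiff (𝓡 n) (𝓡 n) ∞ σ)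
    (hinv : ∀ g, σ (σ g) = g) (X Y : LieAlg n G) :
    lieDifferential n σ ⁅X, Y⁆ = ⁅lieDifferential n σ X, lieDifferential n σ Y⁆ := by
  have hd : MDifferentiable (𝓡 n) (𝓡 n) σ := hσ.mdifferentiable (by simp)
  have hss : (σ ∘ σ : G → G) = id := funext hinv
  have hcomp : ∀ g : G, (mfderiv (𝓡 n) (𝓡 n) σ (σ g)).comp (mfderiv (𝓡 n) (𝓡 n) σ g)
      = ContinuousLinearMap.id ℝ (EuclideanSpace ℝ (Fin n)) := by
    intro g
    have h := mfderiv_comp (I := 𝓡 n) (I' := 𝓡 n) (I'' := 𝓡 n) g (hd (σ g)) (hd g)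
    rw [hss, mfderiv_id] at h
    exact h.symm
  have hcomp' : ∀ g : G, ContinuousLinearMap.comp
      (mfderiv (𝓡 n) (𝓡 n) σ g : EuclideanSpace ℝ (Fin n) →L[ℝ] EuclideanSpace ℝ (Fin n))
      (mfderiv (𝓡 n) (𝓡 n) σ (σ g) : EuclideanSpace ℝ (Fin n) →L[ℝ] EuclideanSpace ℝ (Fin n))
      = ContinuousLinearMap.id ℝ (EuclideanSpace ℝ (Fin n)) := by
    intro g
    have e : ∀ a : G, a = g →
        (mfderiv (𝓡 n) (𝓡 n) σ a : EuclideanSpace ℝ (Fin n) →L[ℝ] EuclideanSpace ℝ (Fin n))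
          = mfderiv (𝓡 n) (𝓡 n) σ g := by rintro a rfl; rfl
    rw [← e _ (hinv g)]
    exact hcomp (σ g)
  have hinverse : ∀ g : G, (mfderiv (𝓡 n) (𝓡 n) σ g).inverse = mfderiv (𝓡 n) (𝓡 n) σ (σ g) :=
    fun g => ContinuousLinearMap.inverse_eq (hcomp' g) (hcomp g)
  have hfield : ∀ Z : LieAlg n G,
      mpullback (𝓡 n) (𝓡 n) σ (mulInvariantVectorField (lieDifferential n σ Z))
        = mulInvariantVectorField Z := by
    intro Z
    ext1 g
    have hL : ∀ a : G, MDifferentiable (𝓡 n) (𝓡 n) (fun x : G => a * x) := fun a =>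
      (contMDiff_mul_left (I := 𝓡 n) (n := ∞) (a := a)).mdifferentiable (by simp)
    have h1 := mfderiv_comp (I := 𝓡 n) (I' := 𝓡 n) (I'' := 𝓡 n) (1 : G)
      (hL (σ g) (σ 1)) (hd 1)
    have h2 := mfderiv_comp (I := 𝓡 n) (I' := 𝓡 n) (I'' := 𝓡 n) (1 : G)
      (hd (g * 1)) (hL g 1)
    have h3 : (fun x : G => σ g * x) ∘ σ = σ ∘ (fun x : G => g * x) := by
      funext x; simp
    have e1 : ∀ a : G, a = 1 →
        (mfderiv (𝓡 n) (𝓡 n) (fun x : G => σ g * x) a :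
          EuclideanSpace ℝ (Fin n) →L[ℝ] EuclideanSpace ℝ (Fin n))
          = mfderiv (𝓡 n) (𝓡 n) (fun x : G => σ g * x) (1 : G) := by rintro a rfl; rfl
    have e2 : ∀ a : G, a = g →
        (mfderiv (𝓡 n) (𝓡 n) σ a : EuclideanSpace ℝ (Fin n) →L[ℝ] EuclideanSpace ℝ (Fin n))
          = mfderiv (𝓡 n) (𝓡 n) σ g := by rintro a rfl; rfl
    have key : ContinuousLinearMap.comp
        (mfderiv (𝓡 n) (𝓡 n) (fun x : G => σ g * x) (1 : G) :
          EuclideanSpace ℝ (Fin n) →L[ℝ] EuclideanSpace ℝ (Fin n))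
        (mfderiv (𝓡 n) (𝓡 n) σ (1 : G) :
          EuclideanSpace ℝ (Fin n) →L[ℝ] EuclideanSpace ℝ (Fin n))
        = ContinuousLinearMap.comp
        (mfderiv (𝓡 n) (𝓡 n) σ g :
          EuclideanSpace ℝ (Fin n) →L[ℝ] EuclideanSpace ℝ (Fin n))
        (mfderiv (𝓡 n) (𝓡 n) (fun x : G => g * x) (1 : G) :
          EuclideanSpace ℝ (Fin n) →L[ℝ] EuclideanSpace ℝ (Fin n)) := by
      rw [← e1 _ (map_one σ), ← e2 _ (mul_one g)]
      rw [h3] at h1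
      exact h1.symm.trans h2
    have hk := congrArg
      (fun f : EuclideanSpace ℝ (Fin n) →L[ℝ] EuclideanSpace ℝ (Fin n) => f Z) key
    have hc := congrArg
      (fun f : EuclideanSpace ℝ (Fin n) →L[ℝ] EuclideanSpace ℝ (Fin n) =>
        f (mfderiv (𝓡 n) (𝓡 n) (fun x : G => g * x) (1 : G) Z)) (hcomp g)
    rw [mpullback_apply, hinverse]
    refine Eq.trans ?_ hc
    exact congrArg (fun v : EuclideanSpace ℝ (Fin n) =>
      (mfderiv (𝓡 n) (𝓡 n) σ (σ g) :
        EuclideanSpace ℝ (Fin n) →L[ℝ] EuclideanSpace ℝ (Fin n)) v) hk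
  have hb := mpullback_mlieBracket (I := 𝓡 n) (I' := 𝓡 n) (n := ∞) (f := σ) (x₀ := (1 : G))
    (V := mulInvariantVectorField (lieDifferential n σ X))
    (W := mulInvariantVectorField (lieDifferential n σ Y))
    (mdifferentiableAt_mulInvariantVectorField _) (mdifferentiableAt_mulInvariantVectorField _)
    hσ.contMDiffAt (by rw [minSmoothness_of_isRCLikeNormedField]; exact ENat.LEInfty.out)
  rw [hfield, hfield, mpullback_apply] at hb
  have e3 : ∀ a : G, a = 1 →
      (mlieBracket (𝓡 n) (mulInvariantVectorField (lieDifferential n σ X))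
        (mulInvariantVectorField (lieDifferential n σ Y)) a : EuclideanSpace ℝ (Fin n))
      = mlieBracket (𝓡 n) (mulInvariantVectorField (lieDifferential n σ X))
        (mulInvariantVectorField (lieDifferential n σ Y)) (1 : G) := by rintro a rfl; rfl
  have hI : ∀ v : EuclideanSpace ℝ (Fin n),
      (mfderiv (𝓡 n) (𝓡 n) σ (1 : G) :
        EuclideanSpace ℝ (Fin n) →L[ℝ] EuclideanSpace ℝ (Fin n))
        ((mfderiv (𝓡 n) (𝓡 n) σ (1 : G)).inverse v) = v := by
    intro v
    rw [hinverse]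
    exact congrArg
      (fun f : EuclideanSpace ℝ (Fin n) →L[ℝ] EuclideanSpace ℝ (Fin n) => f v) (hcomp' 1)
  have hb2 := congrArg (fun v : EuclideanSpace ℝ (Fin n) =>
    (mfderiv (𝓡 n) (𝓡 n) σ (1 : G) :
      EuclideanSpace ℝ (Fin n) →L[ℝ] EuclideanSpace ℝ (Fin n)) v) hb
  exact (hb2.symm.trans (hI _)).trans (e3 _ (map_one σ))

end LieGroups

/-! ### Compact symmetric pairs -/

/-- A compact symmetric pair `(G, K)`: a compact connected Lie group `G` whose Killing form is
negative definite, an involutive smooth automorphism `σ` of `G`, and a closed subgroup `K` of `G`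
with `(G^σ)₀ ⊆ K ⊆ G^σ`, where `G^σ` is the group of fixed points of `σ` and `(G^σ)₀` its identity
component. -/
structure CompactSymmetricPair (n : ℕ) (G : Type*) [TopologicalSpace G]
    [ChartedSpace (EuclideanSpace ℝ (Fin n)) G] [Group G] [LieGroup (𝓡 n) ∞ G]
    [T2Space G] [CompactSpace G] [ConnectedSpace G] where
  σ : G →* G
  contMDiff_σ : ContMDiff (𝓡 n) (𝓡 n) ∞ σ
  σ_σ : ∀ g, σ (σ g) = g
  K : Subgroup G
  isClosed_K : IsClosed (K : Set G)
  σ_eq_of_mem_K : ∀ k ∈ K, σ k = k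
  connectedComponent_subset_K : connectedComponentIn {g : G | σ g = g} 1 ⊆ K
  killingForm_neg : ∀ X : LieAlg n G, X ≠ 0 → killingForm ℝ (LieAlg n G) X X < 0

namespace CompactSymmetricPair

variable {n : ℕ} {G : Type*} [TopologicalSpace G]
  [ChartedSpace (EuclideanSpace ℝ (Fin n)) G] [Group G] [LieGroup (𝓡 n) ∞ G]
  [T2Space G] [CompactSpace G] [ConnectedSpace G] (P : CompactSymmetricPair n G)

/-- The Cartan involution `θ` of `𝔤`, the differential of `σ`. -/
def θ : LieAlg n G →L[ℝ] LieAlg n G := lieDifferential n P.σ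

theorem θ_lie (X Y : LieAlg n G) : P.θ ⁅X, Y⁆ = ⁅P.θ X, P.θ Y⁆ :=
  lieDifferential_lie P.contMDiff_σ P.σ_σ X Y

/-- The Lie algebra `𝔨` of `K`, i.e. the `+1`-eigenspace of `θ` (recall that `K` and `G^σ` have
the same identity component). -/
def 𝔨 : LieSubalgebra ℝ (LieAlg n G) where
  carrier := {X | P.θ X = X}
  add_mem' {X Y} hX hY := by
    simp only [Set.mem_ofPred_eq] at hX hY ⊢
    rw [map_add, hX, hY]
  zero_mem' := map_zero P.θ
  smul_mem' c X hX := by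
    simp only [Set.mem_ofPred_eq] at hX ⊢
    rw [map_smul, hX]
  lie_mem' {X Y} hX hY := by
    change P.θ X = X at hX
    change P.θ Y = Y at hY
    change P.θ ⁅X, Y⁆ = ⁅X, Y⁆
    rw [θ_lie, hX, hY]

/-- The `-1`-eigenspace `𝔭` of `θ`, so that `𝔤 = 𝔨 ⊕ 𝔭` is the Cartan decomposition; it is the
orthogonal complement of `𝔨` for the Killing form. -/
def 𝔭 : Submodule ℝ (LieAlg n G) where
  carrier := {X | P.θ X = -X}
  add_mem' {X Y} hX hY := by
    simp only [Set.mem_ofPred_eq] at hX hY ⊢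
    rw [map_add, hX, hY, neg_add]
  zero_mem' := by simp
  smul_mem' c X hX := by
    simp only [Set.mem_ofPred_eq] at hX ⊢
    rw [map_smul, hX, smul_neg]

/-- The inner product `⟨x, y⟩ = -B(x, y)` on `𝔭`, where `B` is the Killing form of `𝔤`. -/
def innerP (x y : P.𝔭) : ℝ := -killingForm ℝ (LieAlg n G) (x : LieAlg n G) (y : LieAlg n G)

theorem lie_mem_𝔭 {T x : LieAlg n G} (hT : T ∈ P.𝔨) (hx : x ∈ P.𝔭) : ⁅T, x⁆ ∈ P.𝔭 := by
  change P.θ T = T at hT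
  change P.θ x = -x at hx
  change P.θ ⁅T, x⁆ = -⁅T, x⁆
  rw [θ_lie, hT, hx, lie_neg]

/-- `ad(T)|_𝔭` for `T ∈ 𝔨`. -/
def adP (T : P.𝔨) : P.𝔭 →ₗ[ℝ] P.𝔭 :=
  (LieAlgebra.ad ℝ (LieAlg n G) (T : LieAlg n G)).restrict
    (fun _ hx => P.lie_mem_𝔭 T.2 hx)

theorem lieAd_mem_𝔭 {k : G} (hk : k ∈ P.K) {x : LieAlg n G} (hx : x ∈ P.𝔭) :
    lieAd n k x ∈ P.𝔭 := by
  have hσ : MDifferentiable (𝓡 n) (𝓡 n) P.σ := P.contMDiff_σ.mdifferentiable (by simp)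
  have h : P.σ.comp (MulAut.conj k).toMonoidHom = (MulAut.conj k).toMonoidHom.comp P.σ := by
    ext g
    simp [P.σ_eq_of_mem_K k hk]
  have h2 := congrArg (lieDifferential n) h
  rw [lieDifferential_comp hσ (mdifferentiable_conj k),
    lieDifferential_comp (mdifferentiable_conj k) hσ] at h2
  have h3 := congrArg (fun f : LieAlg n G →L[ℝ] LieAlg n G => f x) h2
  change P.θ x = -x at hx
  change P.θ (lieAd n k x) = -lieAd n k x
  refine Eq.trans h3 ?_
  change lieAd n k (P.θ x) = _
  rw [hx, map_neg]

/-- The `s`-representation `K → GL(𝔭)`, `k ↦ Ad(k)|_𝔭`. -/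
def sRep : P.K →* (P.𝔭 →L[ℝ] P.𝔭)ˣ :=
  MonoidHom.toHomUnits
    { toFun := fun k => (lieAd n (k : G)).restrict (fun _ hx => P.lieAd_mem_𝔭 k.2 hx)
      map_one' := by
        ext x
        simp [lieAd_one]
      map_mul' := fun a b => by
        ext x
        simp [lieAd_mul] }

/-- The group `Ad(K)|_𝔭`. -/
def adK : Subgroup (P.𝔭 →L[ℝ] P.𝔭)ˣ := P.sRep.range

/-- The orthogonal group `O(𝔭)`. -/
def orthogonalGroup : Subgroup (P.𝔭 →L[ℝ] P.𝔭)ˣ where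
  carrier := {A | ∀ x y, P.innerP (A.val x) (A.val y) = P.innerP x y}
  one_mem' := fun _ _ => rfl
  mul_mem' := fun {A B} hA hB x y => (hA (B.val x) (B.val y)).trans (hB x y)
  inv_mem' := fun {A} hA x y => by
    have h : ∀ z, A.val (A⁻¹.val z) = z := fun z =>
      congrArg (fun f : P.𝔭 →L[ℝ] P.𝔭 => f z) A.mul_inv
    have := hA (A⁻¹.val x) (A⁻¹.val y)
    rw [h, h] at this
    exact this.symm

/-- `(G, K)` is effective: `K` contains no nontrivial normal subgroup of `G`. -/
def IsEffective : Prop := ∀ N : Subgroup G, N.Normal → N ≤ P.K → N = ⊥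

/-- The maximality property: `(G, K)` is effective, `K` is connected, and `Ad(K)|_𝔭` is maximal
among the connected subgroups of `O(𝔭)` with the same orbits on `𝔭` as the `s`-representation. -/
structure MaximalityProperty : Prop where
  effective : P.IsEffective
  connected : IsConnected (P.K : Set G)
  maximal : Maximal (fun H : Subgroup (P.𝔭 →L[ℝ] P.𝔭)ˣ =>
    H ≤ P.orthogonalGroup ∧ IsConnected (H : Set (P.𝔭 →L[ℝ] P.𝔭)ˣ) ∧
      ∀ v : P.𝔭, MulAction.orbit H v = MulAction.orbit P.adK v) P.adK

/-- `G/K` is inner: its involution `θ` is an inner automorphism of `𝔤`, that is, an element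
of `Int(𝔤) = Ad(G)` (recall that `G` is connected). -/
def IsInner : Prop := ∃ g : G, P.θ = lieAd n g

/-! ### Complex structures preserving the orbit foliation -/

/-- A complex structure on `𝔭`: an orthogonal and skew-symmetric transformation. -/
def IsComplexStructure (J : P.𝔭 →ₗ[ℝ] P.𝔭) : Prop :=
  (∀ x y, P.innerP (J x) (J y) = P.innerP x y) ∧ ∀ x y, P.innerP (J x) y = -P.innerP x (J y)

/-- The foliation `F_{G/K}` of the unit sphere of `𝔭`: its leaves are the orbits of the
`s`-representation through unit vectors. -/
def foliation : Set (Set P.𝔭) :=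
  {L | ∃ v : P.𝔭, P.innerP v v = 1 ∧ L = MulAction.orbit P.adK v}

/-- The Hopf circle through `v` determined by `J`. -/
def hopfCircle (J : P.𝔭 →ₗ[ℝ] P.𝔭) (v : P.𝔭) : Set P.𝔭 :=
  Set.range fun t : ℝ => Real.cos t • v + Real.sin t • J v

/-- `J` preserves `F_{G/K}`: the leaves are foliated by the Hopf circles determined by `J`. -/
def PreservesFoliation (J : P.𝔭 →ₗ[ℝ] P.𝔭) : Prop :=
  ∀ L ∈ P.foliation, ∀ v ∈ L, P.hopfCircle J v ⊆ L

/-! ### Roots -/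

/-- `𝔱` is a maximal abelian subalgebra of `𝔨`. -/
def IsMaximalAbelian (𝔱 : LieSubalgebra ℝ (LieAlg n G)) : Prop :=
  Maximal (fun 𝔰 : LieSubalgebra ℝ (LieAlg n G) => 𝔰 ≤ P.𝔨 ∧ IsLieAbelian 𝔰) 𝔱

end CompactSymmetricPair

section Roots

/-- The extension of scalars `A ⊗ V`. -/
abbrev ScalarExtension (R A V : Type*) [CommRing R] [CommRing A] [Algebra R A] [AddCommGroup V]
    [Module R V] : Type _ := A ⊗[R] V

/-- The canonical map `V → A ⊗ V`, `v ↦ 1 ⊗ v`. -/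
abbrev scalarExtensionMk (R A : Type*) {V : Type*} [CommRing R] [CommRing A] [Algebra R A]
    [AddCommGroup V] [Module R V] (v : V) : ScalarExtension R A V := (1 : A) ⊗ₜ[R] v

/-- The complexification `V^ℂ = ℂ ⊗ V` of a real vector space. -/
abbrev Complexification (V : Type*) [AddCommGroup V] [Module ℝ V] : Type _ :=
  ScalarExtension ℝ ℂ V

/-- The canonical inclusion `V → V^ℂ`. -/
abbrev toComplexification {V : Type*} [AddCommGroup V] [Module ℝ V] (v : V) : Complexification V :=
  scalarExtensionMk ℝ ℂ v

variable {L : Type*} [LieRing L] [LieAlgebra ℝ L]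

/-- For `α` in the dual of `𝔱^ℂ`, the space
`𝔤_α = {X ∈ 𝔤^ℂ : [H, X] = i α(H) X for all H ∈ 𝔱}`, where `𝔤 = L`. -/
def complexRootSpace (𝔱 : LieSubalgebra ℝ L) (α : Module.Dual ℂ (Complexification 𝔱)) :
    Submodule ℂ (Complexification L) where
  carrier := {X | ∀ H : 𝔱, ⁅toComplexification (H : L), X⁆
    = (Complex.I * α (toComplexification H)) • X}
  add_mem' {X Y} hX hY H := by rw [lie_add, hX H, hY H, smul_add]
  zero_mem' H := by rw [lie_zero, smul_zero]
  smul_mem' c X hX H := by rw [lie_smul, hX H, smul_comm]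

/-- The set `Δ_𝔤` of roots of `𝔤 = L` with respect to `𝔱`. -/
def complexRoots (𝔱 : LieSubalgebra ℝ L) : Set (Module.Dual ℂ (Complexification 𝔱)) :=
  {α | α ≠ 0 ∧ complexRootSpace 𝔱 α ≠ ⊥}

/-- A set of positive roots: it contains exactly one of `α`, `-α` for each root `α`, and a root that
is a sum of two of its members belongs to it. -/
def IsPositiveSystem (𝔱 : LieSubalgebra ℝ L) (Δp : Set (Module.Dual ℂ (Complexification 𝔱))) : Prop :=
  Δp ⊆ complexRoots 𝔱 ∧ (∀ α ∈ complexRoots 𝔱, Xor (α ∈ Δp) (-α ∈ Δp)) ∧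
    ∀ α ∈ Δp, ∀ β ∈ Δp, α + β ∈ complexRoots 𝔱 → α + β ∈ Δp

end Roots

namespace CompactSymmetricPair

variable {n : ℕ} {G : Type*} [TopologicalSpace G]
  [ChartedSpace (EuclideanSpace ℝ (Fin n)) G] [Group G] [LieGroup (𝓡 n) ∞ G]
  [T2Space G] [CompactSpace G] [ConnectedSpace G] (P : CompactSymmetricPair n G)

/-- A root `α` is noncompact if `𝔤_α ⊆ 𝔭^ℂ`. -/
def IsNoncompactRoot (𝔱 : LieSubalgebra ℝ (LieAlg n G)) (α : Module.Dual ℂ (Complexification 𝔱)) : Prop :=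
  α ∈ complexRoots 𝔱 ∧ complexRootSpace 𝔱 α ≤ P.𝔭.baseChange ℂ

end CompactSymmetricPair

end

/-!
A complex structure `J` preserving the foliation generates, together with `Ad(K)|_𝔭`, a connected
group with the same orbits, because the rotations `cos t + sin t J` move each vector within its
leaf. By maximality these rotations belong to `Ad(K)|_𝔭`, and `t = π` gives `k ∈ K` with
`Ad(k) = -1` on `𝔭`. Effectiveness makes `𝔨` act faithfully on `𝔭`, so `Ad(k)` is the identity on
`𝔨` and `θ = Ad(k)`.

Conversely, if `θ` is inner then `θ = exp(ad X)` for some `X ∈ 𝔱`, and we take `X` of minimal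
length. For a noncompact root `α` the equation `exp(ad X) = -1` on `𝔤_α` gives
`α(X) ∈ π + 2πℤ`. Let `H` be the multiple of the coroot of `α` with `α(H) = 1`. The translates
`X ± 4πH` have the same exponential as `X`, since `4πH` is a full period of the subalgebra `𝔰𝔲(2)`
attached to `α`. So minimality forces `|α(X)| ≤ 2π`, hence `α(X) = ±π`, and `T = X / π` takes the
values `±1` on the noncompact roots.

Finally `ad(T)|_𝔭` is a complex structure exactly when its square is `-1`. As `𝔱` acts diagonally
on `𝔭^ℂ` with the noncompact roots as weights, this means `α(T) = ±1` for every noncompact root,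
and then the Hopf circles are orbits of `exp(t ad T) ∈ Ad(K)`.
-/

section LocalGroupLaw

open Filter Topology

section Partial

variable {𝕜 E F H : Type*} [NontriviallyNormedField 𝕜] [NormedAddCommGroup E] [NormedSpace 𝕜 E]
  [NormedAddCommGroup F] [NormedSpace 𝕜 F] [NormedAddCommGroup H] [NormedSpace 𝕜 H]

theorem hasFDerivAt_comp_prodMk_left {f : E × F → H} {x : E} {y : F}
    (hf : DifferentiableAt 𝕜 f (x, y)) :
    HasFDerivAt (fun z => f (z, y)) (fderiv 𝕜 f (x, y) ∘L .inl 𝕜 E F) x :=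
  hf.hasFDerivAt.comp (f := fun z => (z, y)) x (hasFDerivAt_prodMk_left x y)

theorem hasFDerivAt_comp_prodMk_right {f : E × F → H} {x : E} {y : F}
    (hf : DifferentiableAt 𝕜 f (x, y)) :
    HasFDerivAt (fun z => f (x, z)) (fderiv 𝕜 f (x, y) ∘L .inr 𝕜 E F) y :=
  hf.hasFDerivAt.comp (f := fun z => (x, z)) y (hasFDerivAt_prodMk_right x y)

theorem eventually_differentiableAt_of_contDiffAt {f : E → F} {x : E} (hf : ContDiffAt 𝕜 1 f x) :
    ∀ᶠ y in 𝓝 x, DifferentiableAt 𝕜 f y :=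
  (hf.eventually (by simp)).mono fun _ hy => hy.differentiableAt one_ne_zero

end Partial

variable {E : Type*} [NormedAddCommGroup E] [NormedSpace ℝ E]

/- `A x` plays the role of `Ad x` for the local group law `m`: differentiating
`∂₁m(e, x) ∘ A x = ∂₂m(x, e)` at `x = e` expresses the derivative of `A` through `∂₁∂₂m(e, e)`,
and the symmetry of the second derivative turns this into a bracket of left-invariant fields. -/
theorem fderiv_apply_eq_lieBracket_of_intertwines {m : E × E → E} {A : E → E →L[ℝ] E} {e : E}
    (hm : ContDiffAt ℝ 2 m (e, e)) (hinl : ∀ v, fderiv ℝ m (e, e) (v, 0) = v)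
    (hinr : ∀ v, fderiv ℝ m (e, e) (0, v) = v) (hA : DifferentiableAt ℝ A e) (hAe : A e = 1)
    (hrel : ∀ᶠ x in 𝓝 e, ∀ X, fderiv ℝ m (e, x) (A x X, 0) = fderiv ℝ m (x, e) (0, X)) (T X : E) :
    fderiv ℝ A e T X = lieBracket ℝ (fun x => fderiv ℝ m (x, e) (0, T))
      (fun x => fderiv ℝ m (x, e) (0, X)) e := by
  have hD : DifferentiableAt ℝ (fderiv ℝ m) (e, e) :=
    (hm.fderiv_right (m := 1) one_add_one_eq_two.le).differentiableAt one_ne_zero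
  set D := fderiv ℝ (fderiv ℝ m) (e, e)
  have hsymm : ∀ p q, D p q = D q p := fun p q => hm.isSymmSndFDerivAt (by simp) p q
  have hfield : ∀ Y, HasFDerivAt (fun x => fderiv ℝ m (x, e) (0, Y))
      ((D ∘L .inl ℝ E E).flip (0, Y)) e := fun Y => by
    simpa using (hasFDerivAt_comp_prodMk_left hD).clm_apply (hasFDerivAt_const ((0 : E), Y) e)
  have hAd : HasFDerivAt (fun x => fderiv ℝ m (e, x) (A x X, 0))
      (fderiv ℝ m (e, e) ∘L ((fderiv ℝ A e).flip X).prod 0 + (D ∘L .inr ℝ E E).flip (X, 0)) e := by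
    have hAX : HasFDerivAt (fun x => (A x X, (0 : E))) (((fderiv ℝ A e).flip X).prod 0) e :=
      .prodMk (by simpa using hA.hasFDerivAt.clm_apply (hasFDerivAt_const X e))
        (hasFDerivAt_const 0 e)
    simpa [hAe] using (hasFDerivAt_comp_prodMk_right hD).clm_apply hAX
  have hderiv : fderiv ℝ A e T X + D (0, T) (X, 0) = D (T, 0) (0, X) := by
    have h := DFunLike.congr_fun
      (hAd.unique ((hfield X).congr_of_eventuallyEq (hrel.mono fun x hx => hx X))) T
    simpa [hinl] using h
  simp only [lieBracket, (hfield X).fderiv, (hfield T).fderiv]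
  simp [hinr, ← hderiv, hsymm (X, 0)]

end LocalGroupLaw

section ChartCalculus

open Filter Topology

variable {n : ℕ} {G : Type*} [TopologicalSpace G] [ChartedSpace (EuclideanSpace ℝ (Fin n)) G]
  [Group G]

local notation "𝔼" => EuclideanSpace ℝ (Fin n)

/-- The preferred chart at the identity, in which the group law and the adjoint representation
are differentiated. -/
noncomputable abbrev chartOne (n : ℕ) (G : Type*) [TopologicalSpace G]
    [ChartedSpace (EuclideanSpace ℝ (Fin n)) G] [Group G] :
    PartialEquiv G (EuclideanSpace ℝ (Fin n)) := extChartAt (𝓡 n) (1 : G)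

/-- The multiplication of `G` read in the chart at the identity. It is a group law only near the
image of `(1, 1)`. -/
noncomputable def chartMul (n : ℕ) (G : Type*) [TopologicalSpace G]
    [ChartedSpace (EuclideanSpace ℝ (Fin n)) G] [Group G]
    (p : EuclideanSpace ℝ (Fin n) × EuclideanSpace ℝ (Fin n)) : EuclideanSpace ℝ (Fin n) :=
  chartOne n G ((chartOne n G).symm p.1 * (chartOne n G).symm p.2)

/-- The conjugation `(g, h) ↦ g h g⁻¹` of `G` read in the chart at the identity. -/
noncomputable def chartConj (n : ℕ) (G : Type*) [TopologicalSpace G]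
    [ChartedSpace (EuclideanSpace ℝ (Fin n)) G] [Group G]
    (p : EuclideanSpace ℝ (Fin n) × EuclideanSpace ℝ (Fin n)) : EuclideanSpace ℝ (Fin n) :=
  chartOne n G ((chartOne n G).symm p.1 * (chartOne n G).symm p.2 * ((chartOne n G).symm p.1)⁻¹)

/-- The adjoint action `Ad g` as an operator on the model space, which carries the norm that the
tangent space `LieAlg n G` lacks. -/
noncomputable def modelAd (n : ℕ) {G : Type*} [TopologicalSpace G]
    [ChartedSpace (EuclideanSpace ℝ (Fin n)) G] [Group G] (g : G) :
    EuclideanSpace ℝ (Fin n) →L[ℝ] EuclideanSpace ℝ (Fin n) := lieAd n g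

/-- The Lie bracket of `LieAlg n G` as an operation on the model space. -/
noncomputable def modelLie (n : ℕ) (G : Type*) [TopologicalSpace G]
    [ChartedSpace (EuclideanSpace ℝ (Fin n)) G] [Group G] (T X : EuclideanSpace ℝ (Fin n)) :
    EuclideanSpace ℝ (Fin n) :=
  Bracket.bracket (L := LieAlg n G) (M := LieAlg n G) T X

theorem chartOne_symm_apply_self : (chartOne n G).symm (chartOne n G 1) = 1 :=
  extChartAt_to_inv (I := 𝓡 n) (1 : G)

theorem chartMul_right_one {x : 𝔼} (hx : x ∈ (chartOne n G).target) :
    chartMul n G (x, chartOne n G 1) = x := by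
  rw [chartMul, chartOne_symm_apply_self, mul_one, PartialEquiv.right_inv _ hx]

theorem chartMul_left_one {x : 𝔼} (hx : x ∈ (chartOne n G).target) :
    chartMul n G (chartOne n G 1, x) = x := by
  rw [chartMul, chartOne_symm_apply_self, one_mul, PartialEquiv.right_inv _ hx]

theorem chartConj_right_one (x : 𝔼) : chartConj n G (x, chartOne n G 1) = chartOne n G 1 := by
  rw [chartConj, chartOne_symm_apply_self, mul_one, mul_inv_cancel]

theorem hasFDerivAt_chartOne_comp {f : G → G} (h1 : f 1 = 1)
    (hf : MDifferentiableAt (𝓡 n) (𝓡 n) f 1) :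
    HasFDerivAt (fun x => chartOne n G (f ((chartOne n G).symm x)))
      (mfderiv (𝓡 n) (𝓡 n) f (1 : G) : 𝔼 →L[ℝ] 𝔼) (chartOne n G 1) := by
  have h := hf.hasMFDerivAt.2
  simp only [writtenInExtChartAt, h1, modelWithCornersSelf_coe, Set.range_id] at h
  exact hasFDerivWithinAt_univ.1 h

theorem mfderiv_one_eq_fderiv_comp_symm {f : G → 𝔼}
    (hf : MDifferentiableAt (𝓡 n) 𝓘(ℝ, 𝔼) f 1) :
    (mfderiv (𝓡 n) 𝓘(ℝ, 𝔼) f (1 : G) : 𝔼 →L[ℝ] 𝔼) =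
      fderiv ℝ (fun x => f ((chartOne n G).symm x)) (chartOne n G 1) := by
  rw [← fderivWithin_univ]
  refine hf.mfderiv.trans ?_
  simp only [writtenInExtChartAt, modelWithCornersSelf_coe, Set.range_id,
    extChartAt_model_space_eq_id]
  rfl

theorem mfderiv_chartOne_one :
    (mfderiv (𝓡 n) 𝓘(ℝ, 𝔼) (chartOne n G) (1 : G) : 𝔼 →L[ℝ] 𝔼) = .id ℝ 𝔼 := by
  have hd : MDifferentiableAt (𝓡 n) 𝓘(ℝ, 𝔼) (chartOne n G) (1 : G) :=
    (contMDiffAt_extChartAt (n := 1)).mdifferentiableAt one_ne_zero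
  rw [mfderiv_one_eq_fderiv_comp_symm hd]
  refine ((hasFDerivAt_id _).congr_of_eventuallyEq ?_).fderiv
  filter_upwards [extChartAt_target_mem_nhds (I := 𝓡 n) (1 : G)] with x hx
  exact (chartOne n G).right_inv hx

theorem mfderiv_chartOne_inverse_apply (v : 𝔼) :
    ((mfderiv (𝓡 n) 𝓘(ℝ, 𝔼) (chartOne n G) (1 : G)).inverse v : 𝔼) = v := by
  have hinv : (mfderiv (𝓡 n) 𝓘(ℝ, 𝔼) (chartOne n G) (1 : G)).inverse =
      ContinuousLinearMap.inverse (.id ℝ 𝔼) :=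
    congrArg (ContinuousLinearMap.inverse (R := ℝ) (M := 𝔼) (M₂ := 𝔼)) mfderiv_chartOne_one
  rw [ContinuousLinearMap.inverse_id] at hinv
  exact DFunLike.congr_fun (F := 𝔼 →L[ℝ] 𝔼) hinv v

theorem modelLie_eq_lieBracket (T X : LieAlg n G) :
    modelLie n G T X = lieBracket ℝ
      (mpullbackWithin 𝓘(ℝ, 𝔼) (𝓡 n) (chartOne n G).symm (mulInvariantVectorField T) Set.univ)
      (mpullbackWithin 𝓘(ℝ, 𝔼) (𝓡 n) (chartOne n G).symm (mulInvariantVectorField X) Set.univ)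
      (chartOne n G 1) := by
  change (⁅T, X⁆ : LieAlg n G) = _
  rw [GroupLieAlgebra.bracket_def, mlieBracket, mlieBracketWithin_apply,
    Set.preimage_univ, Set.univ_inter]
  refine (mfderiv_chartOne_inverse_apply (n := n) (G := G) _).trans ?_
  simp only [modelWithCornersSelf_coe, Set.range_id]
  exact congrFun (lieBracketWithin_univ (𝕜 := ℝ) (E := 𝔼)) _

theorem modelAd_one : modelAd n (1 : G) = 1 := lieAd_one

theorem contDiffAt_chartOne_comp [IsManifold (𝓡 n) ∞ G] {f : 𝔼 × 𝔼 → G} {p : 𝔼 × 𝔼}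
    (hp : f p = 1) (hf : ContMDiffAt 𝓘(ℝ, 𝔼 × 𝔼) (𝓡 n) ∞ f p) :
    ContDiffAt ℝ ∞ (fun q => chartOne n G (f q)) p := by
  have hchart : ContMDiffAt (𝓡 n) 𝓘(ℝ, 𝔼) ∞ (chartOne n G) (f p) := by
    rw [hp]
    exact contMDiffAt_extChartAt
  exact (ContMDiffAt.comp p hchart hf).contDiffAt

variable [LieGroup (𝓡 n) ∞ G]

theorem contMDiffAt_chartOne_symm :
    ContMDiffAt (𝓡 n) (𝓡 n) ∞ (chartOne n G).symm (chartOne n G 1) :=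
  (contMDiffOn_extChartAt_symm (I := 𝓡 n) (n := ∞) (1 : G)).contMDiffAt
    (extChartAt_target_mem_nhds (I := 𝓡 n) (1 : G))

theorem contMDiffAt_chartOne_symm_fst :
    ContMDiffAt 𝓘(ℝ, 𝔼 × 𝔼) (𝓡 n) ∞ (fun p : 𝔼 × 𝔼 => (chartOne n G).symm p.1)
      (chartOne n G 1, chartOne n G 1) :=
  ContMDiffAt.comp (I' := 𝓡 n) _ contMDiffAt_chartOne_symm contDiff_fst.contDiffAt.contMDiffAt

theorem contMDiffAt_chartOne_symm_snd :
    ContMDiffAt 𝓘(ℝ, 𝔼 × 𝔼) (𝓡 n) ∞ (fun p : 𝔼 × 𝔼 => (chartOne n G).symm p.2)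
      (chartOne n G 1, chartOne n G 1) :=
  ContMDiffAt.comp (I' := 𝓡 n) _ contMDiffAt_chartOne_symm contDiff_snd.contDiffAt.contMDiffAt

theorem contDiffAt_chartMul :
    ContDiffAt ℝ ∞ (chartMul n G) (chartOne n G 1, chartOne n G 1) :=
  contDiffAt_chartOne_comp (by simp only [chartOne_symm_apply_self, mul_one])
    (contMDiffAt_chartOne_symm_fst.mul contMDiffAt_chartOne_symm_snd)

theorem contMDiffAt_conj_chartOne_symm :
    ContMDiffAt 𝓘(ℝ, 𝔼 × 𝔼) (𝓡 n) ∞ (fun p : 𝔼 × 𝔼 => (chartOne n G).symm p.1 *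
      (chartOne n G).symm p.2 * ((chartOne n G).symm p.1)⁻¹) (chartOne n G 1, chartOne n G 1) :=
  (contMDiffAt_chartOne_symm_fst.mul contMDiffAt_chartOne_symm_snd).mul
    contMDiffAt_chartOne_symm_fst.inv

theorem contDiffAt_chartConj :
    ContDiffAt ℝ ∞ (chartConj n G) (chartOne n G 1, chartOne n G 1) :=
  contDiffAt_chartOne_comp (by simp only [chartOne_symm_apply_self, mul_one, inv_one])
    contMDiffAt_conj_chartOne_symm

theorem eventually_differentiableAt_chartMul :
    ∀ᶠ p in 𝓝 (chartOne n G 1, chartOne n G 1), DifferentiableAt ℝ (chartMul n G) p :=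
  eventually_differentiableAt_of_contDiffAt (contDiffAt_chartMul.of_le (by simp))

theorem eventually_differentiableAt_chartConj :
    ∀ᶠ p in 𝓝 (chartOne n G 1, chartOne n G 1), DifferentiableAt ℝ (chartConj n G) p :=
  eventually_differentiableAt_of_contDiffAt (contDiffAt_chartConj.of_le (by simp))

theorem eventually_conj_chartOne_symm_mem_source :
    ∀ᶠ p : 𝔼 × 𝔼 in 𝓝 (chartOne n G 1, chartOne n G 1),
      (chartOne n G).symm p.1 * (chartOne n G).symm p.2 * ((chartOne n G).symm p.1)⁻¹ ∈
        (chartOne n G).source := by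
  refine contMDiffAt_conj_chartOne_symm.continuousAt.eventually_mem ?_
  simp only [chartOne_symm_apply_self, mul_one, inv_one]
  exact extChartAt_source_mem_nhds (I := 𝓡 n) (1 : G)

theorem fderiv_chartMul_inl_apply (v : 𝔼) :
    fderiv ℝ (chartMul n G) (chartOne n G 1, chartOne n G 1) (v, 0) = v := by
  have hid : HasFDerivAt (fun x => chartMul n G (x, chartOne n G 1)) (.id ℝ 𝔼)
      (chartOne n G 1) := by
    refine (hasFDerivAt_id _).congr_of_eventuallyEq ?_
    filter_upwards [extChartAt_target_mem_nhds (I := 𝓡 n) (1 : G)] with x hx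
    exact chartMul_right_one hx
  exact DFunLike.congr_fun
    ((hasFDerivAt_comp_prodMk_left (contDiffAt_chartMul.differentiableAt (by simp))).unique hid) v

theorem fderiv_chartMul_inr_apply (v : 𝔼) :
    fderiv ℝ (chartMul n G) (chartOne n G 1, chartOne n G 1) (0, v) = v := by
  have hid : HasFDerivAt (fun x => chartMul n G (chartOne n G 1, x)) (.id ℝ 𝔼)
      (chartOne n G 1) := by
    refine (hasFDerivAt_id _).congr_of_eventuallyEq ?_
    filter_upwards [extChartAt_target_mem_nhds (I := 𝓡 n) (1 : G)] with x hx
    exact chartMul_left_one hx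
  exact DFunLike.congr_fun
    ((hasFDerivAt_comp_prodMk_right (contDiffAt_chartMul.differentiableAt (by simp))).unique hid) v

theorem hasFDerivAt_chartConj_right (x : 𝔼) :
    HasFDerivAt (fun y => chartConj n G (x, y)) (modelAd n ((chartOne n G).symm x))
      (chartOne n G 1) :=
  hasFDerivAt_chartOne_comp (map_one (MulAut.conj ((chartOne n G).symm x)))
    (mdifferentiable_conj _ 1)

theorem eventually_modelAd_eq : ∀ᶠ x in 𝓝 (chartOne n G 1),
    modelAd n ((chartOne n G).symm x) =
      fderiv ℝ (chartConj n G) (x, chartOne n G 1) ∘L .inr ℝ 𝔼 𝔼 := by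
  have hprod : ContinuousAt (fun x : 𝔼 => (x, chartOne n G 1)) (chartOne n G 1) := by fun_prop
  filter_upwards [hprod.eventually eventually_differentiableAt_chartConj] with x hx
  exact (hasFDerivAt_chartConj_right x).unique (hasFDerivAt_comp_prodMk_right hx)

theorem contDiffAt_modelAd :
    ContDiffAt ℝ 1 (fun x => modelAd n ((chartOne n G).symm x)) (chartOne n G 1) := by
  have hfderiv : ContDiffAt ℝ 1 (fderiv ℝ (chartConj n G)) (chartOne n G 1, chartOne n G 1) :=
    contDiffAt_chartConj.fderiv_right (by rw [one_add_one_eq_two]; exact ENat.LEInfty.out)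
  have hprod : ContDiffAt ℝ 1 (fun x : 𝔼 => (x, chartOne n G 1)) (chartOne n G 1) := by fun_prop
  exact ((ContDiffAt.comp (f := fun x => (x, chartOne n G 1)) (chartOne n G 1) hfderiv
    hprod).clm_comp contDiffAt_const).congr_of_eventuallyEq eventually_modelAd_eq

-- Differentiate `(g h g⁻¹) g = g h` in `h` at `h = 1`.
theorem eventually_fderiv_chartMul_modelAd : ∀ᶠ x in 𝓝 (chartOne n G 1), ∀ X,
    fderiv ℝ (chartMul n G) (chartOne n G 1, x) (modelAd n ((chartOne n G).symm x) X, 0) =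
      fderiv ℝ (chartMul n G) (x, chartOne n G 1) (0, X) := by
  have hleft : ContinuousAt (fun x : 𝔼 => (x, chartOne n G 1)) (chartOne n G 1) := by fun_prop
  have hright : ContinuousAt (fun x : 𝔼 => (chartOne n G 1, x)) (chartOne n G 1) := by fun_prop
  filter_upwards [(eventually_conj_chartOne_symm_mem_source (G := G)).curry_nhds,
    hleft.eventually eventually_differentiableAt_chartMul,
    hright.eventually eventually_differentiableAt_chartMul] with x hsource hmul hmul' X
  have hright' := hasFDerivAt_comp_prodMk_left hmul'
  rw [← chartConj_right_one x] at hright'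
  have hcomp := (hright'.comp (f := fun y => chartConj n G (x, y)) _
    (hasFDerivAt_chartConj_right x)).unique
    ((hasFDerivAt_comp_prodMk_right hmul).congr_of_eventuallyEq ?_)
  · rw [chartConj_right_one] at hcomp
    simpa using DFunLike.congr_fun hcomp X
  · filter_upwards [hsource] with y hy
    simp only [Function.comp_apply, chartMul, chartConj]
    rw [PartialEquiv.left_inv _ hy, inv_mul_cancel_right]

theorem mfderiv_chartOne_mulInvariantVectorField {x : 𝔼} (hx : x ∈ (chartOne n G).target)
    (hmul : DifferentiableAt ℝ (chartMul n G) (x, chartOne n G 1)) (X : LieAlg n G) :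
    (mfderiv (𝓡 n) 𝓘(ℝ, 𝔼) (chartOne n G) ((chartOne n G).symm x)
      (mulInvariantVectorField X ((chartOne n G).symm x)) : 𝔼) =
      fderiv ℝ (chartMul n G) (x, chartOne n G 1) (0, X) := by
  have hL : MDifferentiable (𝓡 n) (𝓡 n) (fun y : G => (chartOne n G).symm x * y) :=
    (contMDiff_mul_left (I := 𝓡 n) (n := ∞)).mdifferentiable (by simp)
  have hchart : MDifferentiableAt (𝓡 n) 𝓘(ℝ, 𝔼) (chartOne n G) ((chartOne n G).symm x * 1) := by
    rw [mul_one]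
    refine (contMDiffAt_extChartAt' (I := 𝓡 n) (n := 1) ?_).mdifferentiableAt one_ne_zero
    rw [← extChartAt_source (𝓡 n)]
    exact (chartOne n G).map_target hx
  have hmf : ∀ a : G, a = (chartOne n G).symm x →
      (mfderiv (𝓡 n) 𝓘(ℝ, 𝔼) (chartOne n G) a : 𝔼 →L[ℝ] 𝔼) =
        mfderiv (𝓡 n) 𝓘(ℝ, 𝔼) (chartOne n G) ((chartOne n G).symm x) := by
    rintro a rfl; rfl
  have hcomp := (mfderiv_comp (1 : G) hchart (hL 1)).symm.trans
    ((mfderiv_one_eq_fderiv_comp_symm (hchart.comp (1 : G) (hL 1))).trans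
      (hasFDerivAt_comp_prodMk_right hmul).fderiv)
  exact (DFunLike.congr_fun (F := 𝔼 →L[ℝ] 𝔼) (hmf _ (mul_one _)) _).symm.trans
    (DFunLike.congr_fun (F := 𝔼 →L[ℝ] 𝔼) hcomp X)

theorem eventually_mpullback_mulInvariantVectorField (X : LieAlg n G) :
    (mpullbackWithin 𝓘(ℝ, 𝔼) (𝓡 n) (chartOne n G).symm (mulInvariantVectorField X) Set.univ :
      𝔼 → 𝔼) =ᶠ[𝓝 (chartOne n G 1)]
      fun x => fderiv ℝ (chartMul n G) (x, chartOne n G 1) (0, X) := by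
  have hleft : ContinuousAt (fun x : 𝔼 => (x, chartOne n G 1)) (chartOne n G 1) := by fun_prop
  filter_upwards [extChartAt_target_mem_nhds (I := 𝓡 n) (1 : G),
    hleft.eventually eventually_differentiableAt_chartMul] with x hx hmul
  have hmanifold : IsManifold (𝓡 n) 1 G := .of_le (n := ∞) (by simp)
  have hinv := ContinuousLinearMap.inverse_eq
    (mfderivWithin_extChartAt_symm_comp_mfderiv_extChartAt (I := 𝓡 n) hx)
    (mfderiv_extChartAt_comp_mfderivWithin_extChartAt_symm (I := 𝓡 n) hx)
  rw [modelWithCornersSelf_coe, Set.range_id] at hinv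
  exact (DFunLike.congr_fun (F := 𝔼 →L[ℝ] 𝔼) hinv _).trans
    (mfderiv_chartOne_mulInvariantVectorField hx hmul X)

theorem fderiv_modelAd_apply (T X : 𝔼) :
    fderiv ℝ (fun x => modelAd n ((chartOne n G).symm x)) (chartOne n G 1) T X =
      modelLie n G T X := by
  rw [fderiv_apply_eq_lieBracket_of_intertwines (contDiffAt_chartMul.of_le ENat.LEInfty.out)
    fderiv_chartMul_inl_apply fderiv_chartMul_inr_apply
    (contDiffAt_modelAd.differentiableAt one_ne_zero)
    (by rw [chartOne_symm_apply_self, modelAd_one]) eventually_fderiv_chartMul_modelAd]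
  exact ((eventually_mpullback_mulInvariantVectorField T).lieBracket_vectorField_eq
    (eventually_mpullback_mulInvariantVectorField X)).symm.trans
    (modelLie_eq_lieBracket (n := n) (G := G) T X).symm

/-- The Lie bracket of the Lie algebra of `G` as a continuous bilinear map on the model space,
encoded as the differential of the adjoint representation. -/
noncomputable def modelBracket (n : ℕ) (G : Type*) [TopologicalSpace G]
    [ChartedSpace (EuclideanSpace ℝ (Fin n)) G] [Group G] :
    EuclideanSpace ℝ (Fin n) →L[ℝ] EuclideanSpace ℝ (Fin n) →L[ℝ] EuclideanSpace ℝ (Fin n) :=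
  fderiv ℝ (fun x => modelAd n ((chartOne n G).symm x)) (chartOne n G 1)

theorem modelBracket_apply (T X : LieAlg n G) : modelBracket n G T X = (⁅T, X⁆ : LieAlg n G) :=
  fderiv_modelAd_apply T X

theorem hasStrictFDerivAt_modelAd :
    HasStrictFDerivAt (fun x => modelAd n ((chartOne n G).symm x)) (modelBracket n G)
      (chartOne n G 1) :=
  contDiffAt_modelAd.hasStrictFDerivAt one_ne_zero

end ChartCalculus

section OperatorExponential

open Filter Topology NormedSpace

variable {V W : Type*} [NormedAddCommGroup V] [NormedSpace ℝ V] [CompleteSpace V]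
  [NormedAddCommGroup W] [NormedSpace ℝ W] [CompleteSpace W]

theorem hasDerivAt_exp_smul_apply (D : V →L[ℝ] V) (v : V) (t : ℝ) :
    HasDerivAt (fun t : ℝ => exp (t • D) v) (D (exp (t • D) v)) t := by
  simpa using (hasDerivAt_exp_smul_const' (𝕂 := ℝ) D t).clm_apply (hasDerivAt_const t v)

theorem eq_exp_smul_apply_of_hasDerivAt {D : V →L[ℝ] V} {γ : ℝ → V}
    (h : ∀ t, HasDerivAt γ (D (γ t)) t) (s : ℝ) : γ s = exp (s • D) (γ 0) := by
  have hconst : ∀ t, HasDerivAt (fun t => exp ((s - t) • D) (γ t)) 0 t := fun t => by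
    simpa using (HasDerivAt.comp_const_sub s t
      (hasDerivAt_exp_smul_const (𝕂 := ℝ) D (s - t))).clm_apply (h t)
  simpa using is_const_of_deriv_eq_zero (fun t => (hconst t).differentiableAt)
    (fun t => (hconst t).deriv) s 0

theorem map_exp_smul_apply_of_comp_eq {D : V →L[ℝ] V} {D' : W →L[ℝ] W} {f : V →L[ℝ] W}
    (h : f ∘L D = D' ∘L f) (t : ℝ) (v : V) : f (exp (t • D) v) = exp (t • D') (f v) := by
  have hderiv : ∀ t : ℝ, HasDerivAt (fun t : ℝ => f (exp (t • D) v)) (D' (f (exp (t • D) v))) t :=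
    fun t => by
      have hfD : f (D (exp (t • D) v)) = D' (f (exp (t • D) v)) := DFunLike.congr_fun h _
      exact hfD ▸ f.hasFDerivAt.comp_hasDerivAt t (hasDerivAt_exp_smul_apply D v t)
  simpa using eq_exp_smul_apply_of_hasDerivAt hderiv t

theorem exp_smul_apply_of_rotation {D : V →L[ℝ] V} {u w : V} {r : ℝ} (hu : D u = r • w)
    (hw : D w = -(r • u)) (t : ℝ) :
    exp (t • D) u = Real.cos (t * r) • u + Real.sin (t * r) • w := by
  have hderiv : ∀ t : ℝ, HasDerivAt (fun t : ℝ => Real.cos (t * r) • u + Real.sin (t * r) • w)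
      (D (Real.cos (t * r) • u + Real.sin (t * r) • w)) t := fun t => by
    refine (((hasDerivAt_mul_const r).cos.smul_const u).add
      ((hasDerivAt_mul_const r).sin.smul_const w)).congr_deriv ?_
    rw [map_add, map_smul, map_smul, hu, hw]
    module
  simpa using (eq_exp_smul_apply_of_hasDerivAt hderiv t).symm

theorem exp_apply_of_rotation {D : V →L[ℝ] V} {u w : V} {r : ℝ} (hu : D u = r • w)
    (hw : D w = -(r • u)) : exp D u = Real.cos r • u + Real.sin r • w := by
  simpa using exp_smul_apply_of_rotation hu hw 1

theorem exp_smul_apply_of_apply_eq_zero {D : V →L[ℝ] V} {u : V} (hu : D u = 0) (t : ℝ) :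
    exp (t • D) u = u :=
  (eq_exp_smul_apply_of_hasDerivAt (γ := fun _ => u)
    (fun t => by rw [hu]; exact hasDerivAt_const t u) t).symm

theorem exp_add_of_commute_real {D E : V →L[ℝ] V} (h : Commute D E) :
    exp (D + E) = exp D * exp E := by
  let _ : NormedAlgebra ℚ (V →L[ℝ] V) := .restrictScalars ℚ ℝ _
  exact exp_add_of_commute h

theorem exp_smul_add_apply (D : V →L[ℝ] V) (s t : ℝ) (v : V) :
    exp ((s + t) • D) v = exp (s • D) (exp (t • D) v) := by
  rw [add_smul, exp_add_of_commute_real (((Commute.refl D).smul_left s).smul_right t),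
    mul_apply_eq_comp]

theorem exp_neg_apply_exp_apply (D : V →L[ℝ] V) (v : V) : exp (-D) (exp D v) = v := by
  simpa using (exp_smul_add_apply D (-1) 1 v).symm

theorem exp_apply_exp_neg_apply (D : V →L[ℝ] V) (v : V) : exp D (exp (-D) v) = v := by
  simpa using (exp_smul_add_apply D 1 (-1) v).symm

/- If `D` is so small that `‖exp (t D) - 1‖ ≤ 1/2` on `[0, 1]`, the mean value inequality for
`exp (t D) v - t D v` gives `‖D v‖ ≤ ‖D v‖ / 2`. -/
theorem eventually_apply_eq_zero_of_exp_apply_eq :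
    ∀ᶠ D : V →L[ℝ] V in 𝓝 0, ∀ v, exp D v = v → D v = 0 := by
  have hexp : ∀ᶠ D : V →L[ℝ] V in 𝓝 0, ‖exp D - 1‖ < 1 / 2 := by
    have hcont : ContinuousAt (exp : (V →L[ℝ] V) → V →L[ℝ] V) 0 :=
      (hasStrictFDerivAt_exp_zero (𝕂 := ℝ)).continuousAt
    exact (hcont.sub continuousAt_const).norm.eventually_lt continuousAt_const (by simp)
  obtain ⟨r, hr, hball⟩ := Metric.eventually_nhds_iff_ball.1 hexp
  filter_upwards [Metric.ball_mem_nhds _ hr] with D hD v hv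
  have hderiv : ∀ t ∈ Set.Icc (0 : ℝ) 1, HasDerivWithinAt
      (fun t : ℝ => exp (t • D) v - t • D v) ((exp (t • D) - 1) (D v)) (Set.Icc 0 1) t :=
    fun t _ => by
      have hcomm : exp (t • D) (D v) = D (exp (t • D) v) :=
        DFunLike.congr_fun (((Commute.refl D).smul_right t).exp_right).eq.symm v
      refine (((hasDerivAt_exp_smul_apply D v t).sub
        ((hasDerivAt_id t).smul_const (D v))).congr_deriv ?_).hasDerivWithinAt
      simp [hcomm]
  have hbound : ∀ t ∈ Set.Ico (0 : ℝ) 1, ‖(exp (t • D) - 1) (D v)‖ ≤ 1 / 2 * ‖D v‖ :=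
    fun t ht => by
      have hmem : t • D ∈ Metric.ball (0 : V →L[ℝ] V) r := by
        rw [mem_ball_zero_iff] at hD ⊢
        rw [norm_smul, Real.norm_of_nonneg ht.1]
        exact (mul_le_of_le_one_left (norm_nonneg D) ht.2.le).trans_lt hD
      exact ContinuousLinearMap.le_of_opNorm_le _ (hball _ hmem).le _
  have hmean := norm_image_sub_le_of_norm_deriv_le_segment_01' hderiv hbound
  have hle : ‖D v‖ ≤ 1 / 2 * ‖D v‖ := by simpa [hv] using hmean
  exact norm_le_zero_iff.1 (by linarith)

theorem eventually_apply_eq_zero_of_hasDerivAt :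
    ∀ᶠ D : V →L[ℝ] V in 𝓝 0, ∀ γ : ℝ → V, (∀ t, HasDerivAt γ (D (γ t)) t) → γ 1 = γ 0 →
      D (γ 0) = 0 := by
  filter_upwards [eventually_apply_eq_zero_of_exp_apply_eq] with D hD γ hγ hperiod
  refine hD _ ?_
  simpa [hperiod] using (eq_exp_smul_apply_of_hasDerivAt hγ 1).symm

/-- The infinitesimal action of an operator `s` on the bilinear maps `b`, sending `b` to
`(x, y) ↦ s (b x y) - b x (s y) - b (s x) y`; it vanishes at `b` when `s` is a derivation of `b`. -/
noncomputable def derivationDefect :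
    (V →L[ℝ] V) →L[ℝ] (V →L[ℝ] V →L[ℝ] V) →L[ℝ] V →L[ℝ] V →L[ℝ] V :=
  .compL ℝ V (V →L[ℝ] V) (V →L[ℝ] V) ∘L
      (.compL ℝ V V V - (ContinuousLinearMap.compL ℝ V V V).flip) -
    (ContinuousLinearMap.compL ℝ V V (V →L[ℝ] V)).flip

omit [CompleteSpace V] in
theorem derivationDefect_apply (s : V →L[ℝ] V) (b : V →L[ℝ] V →L[ℝ] V) (x y : V) :
    derivationDefect s b x y = s (b x y) - b x (s y) - b (s x) y := rfl

theorem hasDerivAt_exp_comp_bilinear (s : V →L[ℝ] V) (b : V →L[ℝ] V →L[ℝ] V) (t : ℝ) :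
    HasDerivAt
      (fun t : ℝ => .compL ℝ V V V (exp (t • s)) ∘L
        (ContinuousLinearMap.compL ℝ V V V).flip (exp (t • -s)) ∘L b ∘L exp (t • -s))
      (derivationDefect s (.compL ℝ V V V (exp (t • s)) ∘L
        (ContinuousLinearMap.compL ℝ V V V).flip (exp (t • -s)) ∘L b ∘L exp (t • -s))) t := by
  have hpos := (ContinuousLinearMap.compL ℝ V V V).hasFDerivAt.comp_hasDerivAt t
    (hasDerivAt_exp_smul_const' (𝕂 := ℝ) s t)
  have hneg := (ContinuousLinearMap.compL ℝ V V V).flip.hasFDerivAt.comp_hasDerivAt t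
    (hasDerivAt_exp_smul_const (𝕂 := ℝ) (-s) t)
  refine (hpos.clm_comp (hneg.clm_comp ((hasDerivAt_const t b).clm_comp
    (hasDerivAt_exp_smul_const (𝕂 := ℝ) (-s) t)))).congr_deriv ?_
  ext x y
  simp [derivationDefect_apply, sub_eq_add_neg, add_assoc]

theorem eventually_derivation_of_exp_hom :
    ∀ᶠ s : V →L[ℝ] V in 𝓝 0, ∀ b : V →L[ℝ] V →L[ℝ] V,
      (∀ x y, exp s (b x y) = b (exp s x) (exp s y)) →
        ∀ x y, s (b x y) = b (s x) y + b x (s y) := by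
  have hzero : Tendsto derivationDefect (𝓝 (0 : V →L[ℝ] V)) (𝓝 0) :=
    derivationDefect.continuous.tendsto' 0 0 derivationDefect.map_zero
  filter_upwards [hzero.eventually
    (eventually_apply_eq_zero_of_hasDerivAt (V := V →L[ℝ] V →L[ℝ] V))] with s hs b hhom x y
  have hdefect := hs _ (hasDerivAt_exp_comp_bilinear s b) <| by
    ext x y
    simp [hhom, exp_apply_exp_neg_apply]
  have hxy : s (b x y) - b x (s y) - b (s x) y = 0 := by
    simpa [derivationDefect_apply] using DFunLike.congr_fun (DFunLike.congr_fun hdefect x) y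
  exact sub_eq_iff_eq_add.1 (sub_eq_zero.1 hxy)

end OperatorExponential

/-- The bracket `ad` of a Lie algebra of compact type, together with an invariant inner product
`form`, on a normed space. Lie algebras in Mathlib carry no norm, whereas the operator exponentials
`exp (ad x)` need one; `exists_eq_ad` records that all derivations are inner. -/
structure CompactBracket (V : Type*) [NormedAddCommGroup V] [NormedSpace ℝ V] where
  ad : V →L[ℝ] V →L[ℝ] V
  form : V →L[ℝ] V →L[ℝ] ℝ
  ad_skew : ∀ x y, ad x y = -ad y x
  ad_ad : ∀ x y z, ad x (ad y z) = ad (ad x y) z + ad y (ad x z)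
  form_symm : ∀ x y, form x y = form y x
  form_pos : ∀ x, x ≠ 0 → 0 < form x x
  form_ad : ∀ x y z, form (ad x y) z = -form y (ad x z)
  exists_eq_ad : ∀ D : V →L[ℝ] V, (∀ x y, D (ad x y) = ad (D x) y + ad x (D y)) → ∃ z, D = ad z

namespace CompactBracket

open Filter Topology NormedSpace

variable {V : Type*} [NormedAddCommGroup V] [NormedSpace ℝ V] (C : CompactBracket V)

theorem ad_self (x : V) : C.ad x x = 0 := by
  have := IsAddTorsionFree.of_isTorsionFree ℝ V
  exact self_eq_neg.1 (C.ad_skew x x)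

theorem eq_zero_of_form_self {x : V} (h : C.form x x = 0) : x = 0 :=
  of_not_not fun hx => (C.form_pos x hx).ne' h

/-- Automorphisms of the bracket preserving the inner product. Invertibility is not required: it
follows in finite dimension. -/
def IsAut (A : V →L[ℝ] V) : Prop :=
  (∀ x y, A (C.ad x y) = C.ad (A x) (A y)) ∧ ∀ x y, C.form (A x) (A y) = C.form x y

theorem isAut_one : C.IsAut 1 := ⟨fun _ _ => rfl, fun _ _ => rfl⟩

theorem isClosed_setOf_isAut : IsClosed {A : V →L[ℝ] V | C.IsAut A} := by
  simp only [IsAut, Set.ofPred_and, Set.ofPred_forall]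
  exact (isClosed_iInter fun x => isClosed_iInter fun y =>
    isClosed_eq (by fun_prop) (by fun_prop)).inter
    (isClosed_iInter fun x => isClosed_iInter fun y => isClosed_eq (by fun_prop) (by fun_prop))

variable {C}

theorem IsAut.injective {A : V →L[ℝ] V} (hA : C.IsAut A) : Function.Injective A := by
  refine (injective_iff_map_eq_zero A).2 fun x hx => C.eq_zero_of_form_self ?_
  rw [← hA.2, hx, map_zero]

theorem IsAut.mul {A B : V →L[ℝ] V} (hA : C.IsAut A) (hB : C.IsAut B) : C.IsAut (A * B) :=
  ⟨fun x y => by simp only [mul_apply_eq_comp, hB.1, hA.1],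
    fun x y => by simp only [mul_apply_eq_comp, hA.2, hB.2]⟩

theorem IsAut.of_mul_eq {A B D : V →L[ℝ] V} (hA : C.IsAut A) (hD : C.IsAut D) (h : A * B = D) :
    C.IsAut B := by
  have hAB : ∀ x, A (B x) = D x := DFunLike.congr_fun h
  refine ⟨fun x y => hA.injective ?_, fun x y => ?_⟩
  · rw [hAB, hD.1, hA.1, hAB, hAB]
  · rw [← hA.2, hAB, hAB, hD.2]

theorem commute_ad {x y : V} (h : C.ad x y = 0) : Commute (C.ad x) (C.ad y) :=
  ContinuousLinearMap.ext fun z => by simpa [h] using C.ad_ad x y z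

section Exponential

variable [CompleteSpace V]

theorem isAut_exp (x : V) : C.IsAut (exp (C.ad x)) := by
  refine ⟨fun y z => ?_, fun y z => ?_⟩
  · have hbracket : ∀ t : ℝ, HasDerivAt
        (fun t : ℝ => C.ad (exp (t • C.ad x) y) (exp (t • C.ad x) z))
        (C.ad x (C.ad (exp (t • C.ad x) y) (exp (t • C.ad x) z))) t := fun t =>
      (((hasDerivAt_const t C.ad).clm_apply (hasDerivAt_exp_smul_apply (C.ad x) y t)).clm_apply
        (hasDerivAt_exp_smul_apply (C.ad x) z t)).congr_deriv (by simp [C.ad_ad x])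
    simpa using (eq_exp_smul_apply_of_hasDerivAt hbracket 1).symm
  · have hform : ∀ t : ℝ, HasDerivAt
        (fun t : ℝ => C.form (exp (t • C.ad x) y) (exp (t • C.ad x) z)) 0 t := fun t =>
      (((hasDerivAt_const t C.form).clm_apply (hasDerivAt_exp_smul_apply (C.ad x) y t)).clm_apply
        (hasDerivAt_exp_smul_apply (C.ad x) z t)).congr_deriv (by simp [C.form_ad])
    simpa using is_const_of_deriv_eq_zero (fun t => (hform t).differentiableAt)
      (fun t => (hform t).deriv) 1 0

theorem exp_ad_mul_exp_neg_ad (x : V) : exp (C.ad x) * exp (-C.ad x) = 1 :=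
  ContinuousLinearMap.ext (exp_apply_exp_neg_apply _)

theorem exp_neg_ad_mul_exp_ad (x : V) : exp (-C.ad x) * exp (C.ad x) = 1 :=
  ContinuousLinearMap.ext (exp_neg_apply_exp_apply _)

theorem IsAut.mul_exp_ad {A : V →L[ℝ] V} (hA : C.IsAut A) (x : V) :
    A * exp (C.ad x) = exp (C.ad (A x)) * A :=
  ContinuousLinearMap.ext fun v => by
    simpa using map_exp_smul_apply_of_comp_eq
      (ContinuousLinearMap.ext (hA.1 x) : A ∘L C.ad x = C.ad (A x) ∘L A) 1 v

theorem exp_ad_apply_of_commute {x y : V} (h : C.ad x y = 0) : exp (C.ad x) y = y := by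
  simpa using exp_smul_apply_of_apply_eq_zero h 1

theorem exp_ad_apply_self (x : V) : exp (C.ad x) x = x :=
  exp_ad_apply_of_commute (C.ad_self x)

theorem exp_ad_add {x y : V} (h : C.ad x y = 0) :
    exp (C.ad (x + y)) = exp (C.ad x) * exp (C.ad y) := by
  rw [map_add, exp_add_of_commute_real (commute_ad h)]

theorem ad_eq_zero_of_forall_form_exp_le {Y Z : V}
    (h : ∀ t : ℝ, C.form (exp (t • C.ad (C.ad Y Z)) Y) Z ≤ C.form Y Z) : C.ad Y Z = 0 := by
  have hderiv : HasDerivAt (fun t : ℝ => C.form (exp (t • C.ad (C.ad Y Z)) Y) Z)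
      (C.form (C.ad (C.ad Y Z) Y) Z) 0 :=
    (((hasDerivAt_const (0 : ℝ) C.form).clm_apply (hasDerivAt_exp_smul_apply _ Y 0)).clm_apply
      (hasDerivAt_const (0 : ℝ) Z)).congr_deriv (by simp)
  have hmax : IsLocalMax (fun t : ℝ => C.form (exp (t • C.ad (C.ad Y Z)) Y) Z) 0 :=
    Eventually.of_forall fun t => by simpa using h t
  refine C.eq_zero_of_form_self ?_
  simpa [C.ad_skew (C.ad Y Z) Y, C.form_ad] using hmax.hasDerivAt_eq_zero hderiv

end Exponential

section FiniteDimensional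

variable [FiniteDimensional ℝ V]

theorem IsAut.exists_inv {A : V →L[ℝ] V} (hA : C.IsAut A) :
    ∃ B, C.IsAut B ∧ A * B = 1 ∧ B * A = 1 := by
  let e := LinearEquiv.ofInjectiveEndo (A : V →ₗ[ℝ] V) hA.injective
  have hright : A * LinearMap.toContinuousLinearMap (e.symm : V →ₗ[ℝ] V) = 1 :=
    ContinuousLinearMap.ext e.apply_symm_apply
  exact ⟨_, hA.of_mul_eq C.isAut_one hright, hright, ContinuousLinearMap.ext e.symm_apply_apply⟩

theorem exists_norm_sq_le (C : CompactBracket V) : ∃ c > 0, ∀ x, c * ‖x‖ ^ 2 ≤ C.form x x := by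
  have : ProperSpace V := FiniteDimensional.proper_real V
  rcases subsingleton_or_nontrivial V with hV | hV
  · exact ⟨1, one_pos, fun x => by simp [Subsingleton.elim x 0]⟩
  have hcont : Continuous fun x : V => C.form x x := by fun_prop
  obtain ⟨u, hu, hmin⟩ := (isCompact_sphere (0 : V) 1).exists_isMinOn
    (NormedSpace.sphere_nonempty.2 zero_le_one) hcont.continuousOn
  refine ⟨C.form u u, C.form_pos u (ne_zero_of_mem_unit_sphere ⟨u, hu⟩), fun x => ?_⟩
  rcases eq_or_ne x 0 with rfl | hx
  · simp
  have hx' : ‖x‖ ≠ 0 := norm_ne_zero_iff.2 hx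
  have hle : C.form u u ≤ ‖x‖⁻¹ * (‖x‖⁻¹ * C.form x x) := by
    simpa using isMinOn_iff.1 hmin (‖x‖⁻¹ • x) (by simp [norm_smul, hx'])
  calc C.form u u * ‖x‖ ^ 2 ≤ (‖x‖⁻¹ * (‖x‖⁻¹ * C.form x x)) * ‖x‖ ^ 2 := by gcongr
    _ = C.form x x := by field_simp

theorem exists_forall_isAut_norm_le (C : CompactBracket V) :
    ∃ R, ∀ A : V →L[ℝ] V, C.IsAut A → ‖A‖ ≤ R := by
  obtain ⟨c, hc, hform⟩ := C.exists_norm_sq_le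
  refine ⟨√(‖C.form‖ / c), fun A hA => A.opNorm_le_bound (Real.sqrt_nonneg _) fun x => ?_⟩
  have hle : c * ‖A x‖ ^ 2 ≤ ‖C.form‖ * ‖x‖ * ‖x‖ := calc
    c * ‖A x‖ ^ 2 ≤ C.form (A x) (A x) := hform _
    _ = C.form x x := hA.2 x x
    _ ≤ ‖C.form‖ * ‖x‖ * ‖x‖ := (le_abs_self _).trans (C.form.le_opNorm₂ x x)
  refine le_of_sq_le_sq ?_ (by positivity)
  rw [mul_pow, Real.sq_sqrt (by positivity), div_mul_eq_mul_div, le_div_iff₀ hc]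
  linarith

theorem isCompact_setOf_isAut_and_mem {p : Set (V →L[ℝ] V)} (hp : IsClosed p) :
    IsCompact {A : V →L[ℝ] V | C.IsAut A ∧ A ∈ p} := by
  have : ProperSpace (V →L[ℝ] V) := FiniteDimensional.proper_real _
  obtain ⟨R, hR⟩ := C.exists_forall_isAut_norm_le
  exact Metric.isCompact_of_isClosed_isBounded (C.isClosed_setOf_isAut.inter hp)
    (isBounded_iff_forall_norm_le.2 ⟨R, fun A hA => hR A hA.1⟩)

/- The automorphism `k` maximizes `k ↦ form (k Y) Z` on the compact group of automorphisms that
commute with `A` and fix `S`; moving `k` along `exp (t ad [k Y, Z])` shows `[k Y, Z] = 0`. -/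
theorem IsAut.exists_commuting_ad_eq_zero {A : V →L[ℝ] V} (hA : C.IsAut A) {S : Set V} {Y Z : V}
    (hY : A Y = Y) (hZ : A Z = Z) (hSY : ∀ u ∈ S, C.ad u Y = 0) (hSZ : ∀ u ∈ S, C.ad u Z = 0) :
    ∃ k, C.IsAut k ∧ k * A = A * k ∧ (∀ u ∈ S, k u = u) ∧ C.ad (k Y) Z = 0 := by
  have hclosed : IsClosed {k : V →L[ℝ] V | k * A = A * k ∧ ∀ u ∈ S, k u = u} := by
    simp only [Set.ofPred_and, Set.ofPred_forall]
    exact (isClosed_eq (by fun_prop) (by fun_prop)).inter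
      (isClosed_iInter fun x => isClosed_iInter fun _ => isClosed_eq (by fun_prop) (by fun_prop))
  have hcont : Continuous fun k : V →L[ℝ] V => C.form (k Y) Z := by fun_prop
  obtain ⟨k, ⟨hk, hkA, hkS⟩, hmax⟩ :=
    (isCompact_setOf_isAut_and_mem (C := C) hclosed).exists_isMaxOn
      ⟨1, C.isAut_one, by simp, by simp⟩ hcont.continuousOn
  refine ⟨k, hk, hkA, hkS, ad_eq_zero_of_forall_form_exp_le fun t => ?_⟩
  set U := C.ad (k Y) Z with hU
  have hAU : A U = U := by
    have hkY : A (k Y) = k Y := by simpa [hY] using (DFunLike.congr_fun hkA Y).symm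
    rw [hU, hA.1, hkY, hZ]
  have hUS : ∀ u ∈ S, C.ad U u = 0 := fun u hu => by
    have hku : C.ad u (k Y) = 0 := by rw [← hkS u hu, ← hk.1, hSY u hu, map_zero]
    rw [C.ad_skew, hU, C.ad_ad, hku, hSZ u hu]
    simp
  have hcomm : exp (C.ad (t • U)) * k * A = A * (exp (C.ad (t • U)) * k) := by
    rw [mul_assoc, hkA, ← mul_assoc, ← mul_assoc, hA.mul_exp_ad, map_smul A, hAU]
  have hfix : ∀ u ∈ S, (exp (C.ad (t • U)) * k) u = u := fun u hu => by
    rw [mul_apply_eq_comp, hkS u hu]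
    exact exp_ad_apply_of_commute (by simp [hUS u hu])
  simpa using isMaxOn_iff.1 hmax _ ⟨(isAut_exp (t • U)).mul hk, hcomm, hfix⟩

theorem exp_ad_eq_of_commuting {A k : V →L[ℝ] V} {Y : V} (hk : C.IsAut k) (hkA : k * A = A * k)
    (hY : A = exp (C.ad Y)) : A = exp (C.ad (k Y)) := by
  obtain ⟨B, -, hB, -⟩ := hk.exists_inv
  have hmul : A * k = exp (C.ad (k Y)) * k := by rw [← hk.mul_exp_ad Y, ← hY, hkA]
  simpa [mul_assoc, hB] using congrArg (· * B) hmul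

theorem exists_exp_ad_of_mul_exp_ad {A : V →L[ℝ] V} (hA : C.IsAut A) {Z : V} (hZ : A Z = Z) :
    (∃ Y, A * exp (C.ad Z) = exp (C.ad Y)) ↔ ∃ Y, A = exp (C.ad Y) := by
  constructor
  · rintro ⟨Y, hY⟩
    have hfixZ : (A * exp (C.ad Z)) Z = Z := by rw [mul_apply_eq_comp, exp_ad_apply_self, hZ]
    have hfixY : (A * exp (C.ad Z)) Y = Y := by rw [hY, exp_ad_apply_self]
    obtain ⟨k, hk, hkA, -, hcomm⟩ := (hA.mul (isAut_exp Z)).exists_commuting_ad_eq_zero (S := ∅)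
      hfixY hfixZ (by simp) (by simp)
    refine ⟨k Y + -Z, ?_⟩
    rw [exp_ad_add (by rw [map_neg, hcomm, neg_zero]), ← exp_ad_eq_of_commuting hk hkA hY, map_neg,
      mul_assoc, exp_ad_mul_exp_neg_ad, mul_one]
  · rintro ⟨Y, hY⟩
    obtain ⟨k, hk, hkA, -, hcomm⟩ := hA.exists_commuting_ad_eq_zero (S := ∅)
      (by rw [hY, exp_ad_apply_self]) hZ (by simp) (by simp)
    exact ⟨k Y + Z, by rw [exp_ad_add hcomm, ← exp_ad_eq_of_commuting hk hkA hY]⟩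

theorem IsAut.exists_sub_add_fixed {A : V →L[ℝ] V} (hA : C.IsAut A) (v : V) :
    ∃ w z, A z = z ∧ w - A w + z = v := by
  let f : V →ₗ[ℝ] V := LinearMap.id - (A : V →ₗ[ℝ] V)
  have hker : ∀ {x}, x ∈ f.ker → A x = x := fun hx => (sub_eq_zero.1 hx).symm
  have hdisj : Disjoint f.range f.ker := by
    rw [Submodule.disjoint_def]
    rintro _ ⟨w, rfl⟩ hw
    refine C.eq_zero_of_form_self ?_
    have hinv : C.form (f w) (A w) = C.form (f w) w := by rw [← hA.2 (f w) w, hker hw]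
    change C.form (f w) (w - A w) = 0
    rw [map_sub, hinv, sub_self]
  have htop := Submodule.eq_top_of_disjoint _ _ (LinearMap.finrank_range_add_finrank_ker f).ge hdisj
  obtain ⟨_, ⟨w, rfl⟩, z, hz, rfl⟩ := Submodule.mem_sup.1 (htop ▸ Submodule.mem_top (x := v))
  exact ⟨w, z, hker hz, rfl⟩

end FiniteDimensional

end CompactBracket

section ProductsOfExponentials

open NormedSpace

variable {V X : Type*} [NormedAddCommGroup V] [NormedSpace ℝ V] [CompleteSpace V]
  [NormedAddCommGroup X] [NormedSpace ℝ X]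

theorem hasStrictFDerivAt_mul_exp {f : X → V →L[ℝ] V} {f' : X →L[ℝ] V →L[ℝ] V} {x : X}
    (hf : HasStrictFDerivAt f f' x) {L : X →L[ℝ] V →L[ℝ] V} (hL : L x = 0) :
    HasStrictFDerivAt (fun x => f x * exp (L x))
      (f' + ContinuousLinearMap.compL ℝ V V V (f x) ∘L L) x := by
  have hexp : HasStrictFDerivAt (fun x => exp (L x)) L x := by
    have hexp₀ : HasStrictFDerivAt (exp : (V →L[ℝ] V) → V →L[ℝ] V)
        (1 : (V →L[ℝ] V) →L[ℝ] V →L[ℝ] V) (L x) := hL ▸ hasStrictFDerivAt_exp_zero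
    exact hexp₀.comp x L.hasStrictFDerivAt
  refine (hf.clm_comp hexp).congr_fderiv ?_
  ext y v
  simp [hL, add_comm]

theorem hasStrictFDerivAt_mul_exp_mul_exp_mul_exp_mul_exp (A : V →L[ℝ] V)
    (L₁ L₂ L₃ L₄ : X →L[ℝ] V →L[ℝ] V) :
    HasStrictFDerivAt (fun x => A * exp (L₁ x) * exp (L₂ x) * exp (L₃ x) * exp (L₄ x))
      (ContinuousLinearMap.compL ℝ V V V A ∘L (L₁ + L₂ + L₃ + L₄)) 0 := by
  refine (hasStrictFDerivAt_mul_exp (hasStrictFDerivAt_mul_exp (hasStrictFDerivAt_mul_exp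
    (hasStrictFDerivAt_mul_exp (hasStrictFDerivAt_const A 0) L₁.map_zero) L₂.map_zero)
    L₃.map_zero) L₄.map_zero).congr_fderiv ?_
  ext x v
  simp

end ProductsOfExponentials

namespace CompactBracket

open Filter Topology NormedSpace

variable {V : Type*} [NormedAddCommGroup V] [NormedSpace ℝ V] [FiniteDimensional ℝ V]
  {C : CompactBracket V}

theorem eventually_eq_zero_of_isAut_exp {S : Submodule ℝ (V →L[ℝ] V)}
    (hS : Disjoint (C.ad : V →ₗ[ℝ] V →L[ℝ] V).range S) :
    ∀ᶠ s : V →L[ℝ] V in 𝓝 0, s ∈ S → C.IsAut (exp s) → s = 0 := by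
  filter_upwards [eventually_derivation_of_exp_hom] with s hs hsS hAut
  obtain ⟨y, hy⟩ := C.exists_eq_ad s (hs C.ad hAut.1)
  exact Submodule.disjoint_def.1 hS s ⟨y, hy.symm⟩ hsS

theorem IsAut.exists_eq_mul_ad_add {A : V →L[ℝ] V} (hA : C.IsAut A)
    {S : Submodule ℝ (V →L[ℝ] V)} (hS : Codisjoint (C.ad : V →ₗ[ℝ] V →L[ℝ] V).range S)
    (M : V →L[ℝ] V) : ∃ w z, ∃ s ∈ S, A z = z ∧ A * (C.ad (w - A w + z) + s) = M := by
  obtain ⟨B, -, hAB, -⟩ := hA.exists_inv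
  obtain ⟨_, ⟨v, rfl⟩, s, hs, hsum⟩ :=
    Submodule.mem_sup.1 (hS.eq_top ▸ Submodule.mem_top (x := B * M))
  obtain ⟨w, z, hz, rfl⟩ := hA.exists_sub_add_fixed v
  refine ⟨w, z, s, hs, hz, ?_⟩
  rw [← one_mul M, ← hAB, mul_assoc, ← hsum]
  rfl

/- Apply the open mapping theorem to `(w, z, s) ↦ A exp(ad w) exp(ad z) exp(-ad (A w)) exp(s)`,
with derivative `A (ad (w - A w + z) + s)` at the origin. -/
theorem IsAut.eventually_exists_eq_mul_exp {A : V →L[ℝ] V} (hA : C.IsAut A)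
    {S : Submodule ℝ (V →L[ℝ] V)} (hS : Codisjoint (C.ad : V →ₗ[ℝ] V →L[ℝ] V).range S)
    {p : (V →L[ℝ] V) → Prop} (hp : ∀ᶠ s in 𝓝 0, p s) :
    ∀ᶠ A' in 𝓝 A, ∃ w z, ∃ s ∈ S, A z = z ∧ p s ∧
      A * exp (C.ad w) * exp (C.ad z) * exp (C.ad (-A w)) * exp s = A' := by
  let c : Submodule ℝ V := ((A : V →ₗ[ℝ] V) - LinearMap.id).ker
  have hc : ∀ {z : V}, z ∈ c ↔ A z = z := sub_eq_zero
  let toW : V × c × S →L[ℝ] V := .fst ℝ V (c × S)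
  let toZ : V × c × S →L[ℝ] V := c.subtypeL ∘L .fst ℝ c S ∘L .snd ℝ V (c × S)
  let toS : V × c × S →L[ℝ] V →L[ℝ] V := S.subtypeL ∘L .snd ℝ c S ∘L .snd ℝ V (c × S)
  have hderiv := hasStrictFDerivAt_mul_exp_mul_exp_mul_exp_mul_exp (X := V × c × S) A
    (C.ad ∘L toW) (C.ad ∘L toZ) (C.ad ∘L (-(A ∘L toW))) toS
  have hmap := hderiv.map_nhds_eq_of_surj <| LinearMap.range_eq_top.2 fun M => by
    obtain ⟨w, z, s, hs, hz, hM⟩ := hA.exists_eq_mul_ad_add hS M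
    refine ⟨(w, ⟨z, hc.2 hz⟩, ⟨s, hs⟩), ?_⟩
    change A * (C.ad w + C.ad z + C.ad (-A w) + s) = M
    rw [← hM, ← map_add, ← map_add]
    congr 3
    abel
  rw [show A * exp ((C.ad ∘L toW) 0) * exp ((C.ad ∘L toZ) 0) * exp ((C.ad ∘L (-(A ∘L toW))) 0) *
    exp (toS 0) = A by simp] at hmap
  have hsmall : ∀ᶠ x : V × c × S in 𝓝 0, p (toS x) :=
    (toS.continuous.tendsto' 0 0 toS.map_zero).eventually hp
  rw [← hmap, eventually_map]
  filter_upwards [hsmall] with x hx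
  exact ⟨x.1, x.2.1, x.2.2, x.2.2.2, hc.1 x.2.1.2, hx, rfl⟩

theorem IsAut.eventually_exists_conj {A : V →L[ℝ] V} (hA : C.IsAut A) :
    ∀ᶠ A' in 𝓝 A, C.IsAut A' → ∃ W Z, A Z = Z ∧
      A' = exp (C.ad W) * (A * exp (C.ad Z)) * exp (-C.ad W) := by
  obtain ⟨S, hS⟩ := (C.ad : V →ₗ[ℝ] V →L[ℝ] V).range.exists_isCompl
  filter_upwards [hA.eventually_exists_eq_mul_exp hS.codisjoint
    (eventually_eq_zero_of_isAut_exp hS.disjoint)] with A' ⟨w, z, s, hs, hz, hs0, hA'⟩ hAut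
  have hAut_s : C.IsAut (exp s) :=
    (((hA.mul (isAut_exp w)).mul (isAut_exp z)).mul (isAut_exp (-A w))).of_mul_eq hAut hA'
  refine ⟨A w, z, hz, ?_⟩
  rw [← hA', hs0 hs hAut_s, exp_zero, mul_one, hA.mul_exp_ad, map_neg, mul_assoc (exp (C.ad (A w)))]

theorem exists_exp_ad_conj_iff {A : V →L[ℝ] V} {W : V} :
    (∃ Y, exp (C.ad W) * A * exp (-C.ad W) = exp (C.ad Y)) ↔ ∃ Y, A = exp (C.ad Y) := by
  constructor
  · rintro ⟨Y, hY⟩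
    refine ⟨exp (C.ad (-W)) Y, ?_⟩
    have hconj := congrArg (· * exp (C.ad W)) ((C.isAut_exp (-W)).mul_exp_ad Y)
    simp only [← hY, map_neg, mul_assoc, exp_neg_ad_mul_exp_ad, mul_one] at hconj ⊢
    rw [← hconj, ← mul_assoc, exp_neg_ad_mul_exp_ad, one_mul]
  · rintro ⟨Y, rfl⟩
    refine ⟨exp (C.ad W) Y, ?_⟩
    rw [(C.isAut_exp W).mul_exp_ad, mul_assoc, exp_ad_mul_exp_neg_ad, mul_one]

theorem exists_eq_exp_ad_of_preconnectedSpace {T : Type*} [TopologicalSpace T]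
    [PreconnectedSpace T] {f : T → V →L[ℝ] V} (hf : Continuous f) (hAut : ∀ t, C.IsAut (f t))
    {t₀ : T} (h₀ : f t₀ = 1) (t : T) : ∃ Y, f t = exp (C.ad Y) := by
  have hloc : ∀ t, ∀ᶠ t' in 𝓝 t, (∃ Y, f t' = exp (C.ad Y)) ↔ ∃ Y, f t = exp (C.ad Y) := fun t => by
    filter_upwards [hf.continuousAt.eventually (hAut t).eventually_exists_conj] with t' ht'
    obtain ⟨W, Z, hZ, h⟩ := ht' (hAut t')
    rw [h, exists_exp_ad_conj_iff, exists_exp_ad_of_mul_exp_ad (hAut t) hZ]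
  have hconst : IsLocallyConstant fun t => ∃ Y, f t = exp (C.ad Y) :=
    (IsLocallyConstant.iff_eventually_eq _).2 fun t => (hloc t).mono fun _ => propext
  exact (hconst.apply_eq_of_preconnectedSpace t t₀).mpr ⟨0, by rw [h₀, map_zero, exp_zero]⟩

theorem exists_log_commuting_finset {A : V →L[ℝ] V} (hA : ∃ Y, A = exp (C.ad Y)) (s : Finset V)
    (hfix : ∀ H ∈ s, A H = H) (hcomm : ∀ H ∈ s, ∀ H' ∈ s, C.ad H H' = 0) :
    ∃ Y, A = exp (C.ad Y) ∧ ∀ H ∈ s, C.ad H Y = 0 := by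
  classical
  induction s using Finset.induction_on with
  | empty => simpa using hA
  | insert Z s _ ih =>
    simp only [Finset.forall_mem_insert] at hfix hcomm ⊢
    obtain ⟨Y, rfl, hsY⟩ := ih hfix.2 fun H hH => (hcomm.2 H hH).2
    obtain ⟨k, hk, hkA, hks, hZ⟩ := (isAut_exp Y).exists_commuting_ad_eq_zero (S := s)
      (exp_ad_apply_self Y) hfix.1 hsY fun u hu => (hcomm.2 u hu).1
    refine ⟨k Y, exp_ad_eq_of_commuting hk hkA rfl, ?_, fun H hH => ?_⟩
    · rw [C.ad_skew, hZ, neg_zero]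
    · rw [← hks H hH, ← hk.1, hsY H hH, map_zero]

theorem exists_log_commuting {A : V →L[ℝ] V} (hA : ∃ Y, A = exp (C.ad Y)) {𝔱 : Submodule ℝ V}
    (hfix : ∀ H ∈ 𝔱, A H = H) (hcomm : ∀ H ∈ 𝔱, ∀ H' ∈ 𝔱, C.ad H H' = 0) :
    ∃ Y, A = exp (C.ad Y) ∧ ∀ H ∈ 𝔱, C.ad H Y = 0 := by
  obtain ⟨s, rfl⟩ := (IsNoetherian.noetherian 𝔱 : 𝔱.FG)
  obtain ⟨Y, hY, hsY⟩ := exists_log_commuting_finset hA s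
    (fun H hH => hfix H (Submodule.subset_span hH))
    fun H hH H' hH' => hcomm H (Submodule.subset_span hH) H' (Submodule.subset_span hH')
  have hspan : Submodule.span ℝ (s : Set V) ≤ ((C.ad.flip Y : V →L[ℝ] V) : V →ₗ[ℝ] V).ker :=
    Submodule.span_le.2 hsY
  exact ⟨Y, hY, hspan⟩

end CompactBracket

namespace CompactBracket

open Filter Topology NormedSpace

variable {V : Type*} [NormedAddCommGroup V] [NormedSpace ℝ V] {C : CompactBracket V}

theorem two_mul_abs_form_le {X Y : V} (hadd : C.form X X ≤ C.form (X + Y) (X + Y))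
    (hsub : C.form X X ≤ C.form (X - Y) (X - Y)) : 2 * |C.form X Y| ≤ C.form Y Y := by
  simp only [map_add, map_sub, add_apply, sub_apply, C.form_symm Y X] at hadd hsub
  rw [← le_div_iff₀' two_pos, abs_le]
  constructor <;> linarith

/- With `P = exp(2π e₃)` and `Q = exp(π e₁)`: `P` fixes `e₁`, so it commutes with `Q`, while `Q`
maps `e₃` to `-e₃`, so it conjugates `P` to `P⁻¹`. Hence `P² = 1`. -/
theorem exp_ad_four_pi_eq_one [CompleteSpace V] {e₁ e₂ e₃ : V} (h₁₂ : C.ad e₁ e₂ = e₃)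
    (h₂₃ : C.ad e₂ e₃ = e₁) (h₃₁ : C.ad e₃ e₁ = e₂) : exp (C.ad ((4 * Real.pi) • e₃)) = 1 := by
  set P := exp (C.ad ((2 * Real.pi) • e₃)) with hP
  set Q := exp (C.ad (Real.pi • e₁)) with hQ
  have hPe : P e₁ = e₁ := by
    rw [hP, map_smul, exp_smul_apply_of_rotation (r := 1) (w := e₂) (by rw [h₃₁, one_smul])
      (by rw [C.ad_skew, h₂₃, one_smul])]
    simp
  have hQe : Q e₃ = -e₃ := by
    rw [hQ, map_smul, exp_smul_apply_of_rotation (r := 1) (w := -e₂)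
      (by rw [C.ad_skew, h₃₁, one_smul]) (by rw [map_neg, h₁₂, one_smul])]
    simp
  have hcomm : P * Q = Q * P := by rw [hQ, (isAut_exp _).mul_exp_ad, map_smul, hPe]
  have hconj : Q * P = exp (-C.ad ((2 * Real.pi) • e₃)) * Q := by
    rw [hP, (isAut_exp _).mul_exp_ad, map_smul, hQe, smul_neg, map_neg]
  have hPPQ : P * (P * Q) = Q := by
    rw [hcomm, hconj, ← mul_assoc, hP, exp_ad_mul_exp_neg_ad, one_mul]
  have hPP : P * P = 1 := by
    simpa only [mul_assoc, hQ, exp_ad_mul_exp_neg_ad, mul_one] using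
      congrArg (· * exp (-C.ad (Real.pi • e₁))) hPPQ
  have hsplit : (4 * Real.pi) • e₃ = (2 * Real.pi) • e₃ + (2 * Real.pi) • e₃ := by module
  rw [hsplit, exp_ad_add (by simp [C.ad_self]), ← hP, hPP]

/-- The subspace `𝔱` is its own centralizer; in a Lie algebra of compact type this says that it is
a maximal abelian subalgebra. -/
def IsSelfCentralizing (C : CompactBracket V) (𝔱 : Submodule ℝ V) : Prop :=
  ∀ x, x ∈ 𝔱 ↔ ∀ H ∈ 𝔱, C.ad H x = 0

/-- `X` has minimal length among the elements of `𝔱` with the same exponential. -/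
def IsShortestLog (C : CompactBracket V) (𝔱 : Submodule ℝ V) (X : V) : Prop :=
  X ∈ 𝔱 ∧ ∀ X' ∈ 𝔱, exp (C.ad X') = exp (C.ad X) → C.form X X ≤ C.form X' X'

theorem exists_isShortestLog [FiniteDimensional ℝ V] (C : CompactBracket V) {𝔱 : Submodule ℝ V}
    {X₀ : V} (hX₀ : X₀ ∈ 𝔱) : ∃ X, C.IsShortestLog 𝔱 X ∧ exp (C.ad X) = exp (C.ad X₀) := by
  have : ProperSpace V := FiniteDimensional.proper_real V
  let K : Set V := {X | X ∈ 𝔱 ∧ exp (C.ad X) = exp (C.ad X₀) ∧ C.form X X ≤ C.form X₀ X₀}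
  have hform : Continuous fun x : V => C.form x x := by fun_prop
  have hexp : Continuous fun x : V => exp (C.ad x) :=
    (continuous_iff_continuousAt.2 fun D : V →L[ℝ] V =>
      (exp_analytic (𝕂 := ℝ) D).continuousAt).comp C.ad.continuous
  have hclosed : IsClosed K := (Submodule.closed_of_finiteDimensional 𝔱).inter
    ((isClosed_eq hexp continuous_const).inter (isClosed_le hform continuous_const))
  have hbounded : Bornology.IsBounded K := by
    obtain ⟨c, hc, hnorm⟩ := C.exists_norm_sq_le
    refine isBounded_iff_forall_norm_le.2 ⟨√(C.form X₀ X₀ / c), fun X hX => ?_⟩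
    refine Real.le_sqrt_of_sq_le ?_
    rw [le_div_iff₀ hc, mul_comm]
    exact (hnorm X).trans hX.2.2
  obtain ⟨X, ⟨hX𝔱, hXexp, hXle⟩, hmin⟩ := (Metric.isCompact_of_isClosed_isBounded hclosed
    hbounded).exists_isMinOn ⟨X₀, hX₀, rfl, le_rfl⟩ hform.continuousOn
  refine ⟨X, ⟨hX𝔱, fun X' hX' hexp' => ?_⟩, hXexp⟩
  rcases le_total (C.form X' X') (C.form X₀ X₀) with hle | hle
  · exact hmin ⟨hX', hexp'.trans hXexp, hle⟩
  · exact hXle.trans hle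

/-- `a + i b` is a root vector, for the root `α` with respect to the commuting subspace `𝔱`: real
and imaginary part of `[H, a + i b] = i α(H) (a + i b)`. -/
structure IsRootPair (C : CompactBracket V) (𝔱 : Submodule ℝ V) (α : V → ℝ) (a b : V) : Prop where
  ad_fst : ∀ H ∈ 𝔱, C.ad H a = -(α H • b)
  ad_snd : ∀ H ∈ 𝔱, C.ad H b = α H • a

/-- For a root vector `a + i b` of the root `α`, the multiple of `[a, b]` with `α(coroot) = -1`. It
is half the usual coroot, up to sign. -/
noncomputable def coroot (C : CompactBracket V) (α : V → ℝ) (a b : V) : V :=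
  (-α (C.ad a b))⁻¹ • C.ad a b

namespace IsRootPair

variable {𝔱 : Submodule ℝ V} {α : V → ℝ} {a b : V}

theorem form_snd_snd (h : IsRootPair C 𝔱 α a b) {H : V} (hH : H ∈ 𝔱) (hα : α H ≠ 0) :
    C.form b b = C.form a a := by
  have hskew := C.form_ad H a b
  simp only [h.ad_fst H hH, h.ad_snd H hH, map_neg, map_smul, neg_apply, smul_apply, smul_eq_mul,
    neg_inj] at hskew
  exact mul_left_cancel₀ hα hskew

theorem form_fst_snd (h : IsRootPair C 𝔱 α a b) {H : V} (hH : H ∈ 𝔱) (hα : α H ≠ 0) :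
    C.form a b = 0 := by
  have hskew := C.form_ad H a a
  simp only [h.ad_fst H hH, map_neg, map_smul, neg_apply, smul_apply, smul_eq_mul, neg_neg,
    C.form_symm b a] at hskew
  exact (mul_eq_zero.1 (by linarith : α H * C.form a b = 0)).resolve_left hα

theorem ad_ad_eq_zero (h : IsRootPair C 𝔱 α a b) {H : V} (hH : H ∈ 𝔱) :
    C.ad H (C.ad a b) = 0 := by
  rw [C.ad_ad, h.ad_fst H hH, h.ad_snd H hH]
  simp [C.ad_self]

theorem form_ad_apply (h : IsRootPair C 𝔱 α a b) {H : V} (hH : H ∈ 𝔱) :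
    C.form (C.ad a b) H = -(α H * C.form b b) := by
  rw [C.form_ad, C.ad_skew a H, h.ad_fst H hH]
  simp

section Coroot

variable (h : IsRootPair C 𝔱 α a b) (h𝔱 : C.IsSelfCentralizing 𝔱) (ha : a ≠ 0) {H : V}
  (hH : H ∈ 𝔱) (hα : α H ≠ 0)

include h h𝔱

theorem ad_mem : C.ad a b ∈ 𝔱 := (h𝔱 _).2 fun _ => h.ad_ad_eq_zero

theorem coroot_mem : C.coroot α a b ∈ 𝔱 := 𝔱.smul_mem _ (h.ad_mem h𝔱)

include ha hH hα

omit h𝔱 in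
theorem form_snd_snd_pos : 0 < C.form b b := h.form_snd_snd hH hα ▸ C.form_pos a ha

theorem neg_apply_ad_pos : 0 < -α (C.ad a b) := by
  have hne : C.ad a b ≠ 0 := fun h0 => by
    have hform : -(α H * C.form b b) = 0 := by rw [← h.form_ad_apply hH, h0, map_zero, zero_apply]
    exact mul_ne_zero hα (h.form_snd_snd_pos ha hH hα).ne' (neg_eq_zero.1 hform)
  have hpos := C.form_pos _ hne
  rw [h.form_ad_apply (h.ad_mem h𝔱), ← neg_mul] at hpos
  exact pos_of_mul_pos_left hpos (h.form_snd_snd_pos ha hH hα).le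

theorem form_coroot_coroot :
    C.form (C.coroot α a b) (C.coroot α a b) = (-α (C.ad a b))⁻¹ * C.form b b := by
  have := (h.neg_apply_ad_pos h𝔱 ha hH hα).ne'
  simp only [coroot, map_smul, smul_apply, smul_eq_mul, h.form_ad_apply (h.ad_mem h𝔱)]
  field_simp

theorem exp_ad_four_pi_coroot [CompleteSpace V] :
    exp (C.ad ((4 * Real.pi) • C.coroot α a b)) = 1 := by
  set r := -α (C.ad a b) with hr
  have hrpos : 0 < r := h.neg_apply_ad_pos h𝔱 ha hH hα
  have hca : C.ad (C.ad a b) a = r • b := by rw [h.ad_fst _ (h.ad_mem h𝔱), hr, neg_smul]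
  have hcb : C.ad (C.ad a b) b = -(r • a) := by
    rw [h.ad_snd _ (h.ad_mem h𝔱), hr, neg_smul, neg_neg]
  have hsqrt : (√r)⁻¹ * (√r)⁻¹ = r⁻¹ := by rw [← mul_inv, Real.mul_self_sqrt hrpos.le]
  refine exp_ad_four_pi_eq_one (e₁ := (√r)⁻¹ • a) (e₂ := (√r)⁻¹ • b) ?_ ?_ ?_
  · simp only [coroot, map_smul, smul_apply, smul_smul, hsqrt, ← hr]
  · rw [C.ad_skew]
    simp [coroot, hcb, ← hr, smul_smul, hrpos.ne']
  · simp [coroot, hca, ← hr, smul_smul, hrpos.ne']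

/- Translating `X` by `±4π` times the coroot does not change its exponential. -/
theorem abs_apply_le_two_pi [CompleteSpace V] {X : V} (hX : C.IsShortestLog 𝔱 X) :
    |α X| ≤ 2 * Real.pi := by
  set Y := (4 * Real.pi) • C.coroot α a b with hY
  have hY𝔱 : Y ∈ 𝔱 := 𝔱.smul_mem _ (h.coroot_mem h𝔱)
  have hYexp : exp (C.ad Y) = 1 := h.exp_ad_four_pi_coroot h𝔱 ha hH hα
  have hXY : C.ad X Y = 0 := (h𝔱 Y).1 hY𝔱 X hX.1
  have hadd := hX.2 (X + Y) (𝔱.add_mem hX.1 hY𝔱) (by rw [exp_ad_add hXY, hYexp, mul_one])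
  have hsub := hX.2 (X - Y) (𝔱.sub_mem hX.1 hY𝔱) <| by
    rw [← mul_one (exp (C.ad (X - Y))), ← hYexp,
      ← exp_ad_add (by rw [map_sub, sub_apply, hXY, C.ad_self, sub_zero]), sub_add_cancel]
  set q := (-α (C.ad a b))⁻¹ * C.form b b with hq
  have hqpos : 0 < q := mul_pos (inv_pos.2 (h.neg_apply_ad_pos h𝔱 ha hH hα))
    (h.form_snd_snd_pos ha hH hα)
  have hformXY : C.form X Y = -(4 * Real.pi * q * α X) := by
    rw [hY, C.form_symm, coroot]
    simp only [map_smul, smul_apply, smul_eq_mul, h.form_ad_apply hX.1, hq]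
    ring
  have hformYY : C.form Y Y = (4 * Real.pi) ^ 2 * q := by
    rw [hY, hq, ← h.form_coroot_coroot h𝔱 ha hH hα]
    simp only [map_smul, smul_apply, smul_eq_mul]
    ring
  have hbound := two_mul_abs_form_le hadd hsub
  rw [hformXY, hformYY, abs_neg, abs_mul, abs_of_pos (by positivity)] at hbound
  refine le_of_mul_le_mul_left (a := 8 * Real.pi * q) ?_ (by positivity)
  linarith

omit h𝔱 in
theorem cos_apply_eq_neg_one [CompleteSpace V] {X : V} (hX : X ∈ 𝔱)
    (hXa : exp (C.ad X) a = -a) : Real.cos (α X) = -1 := by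
  have hrot := exp_apply_of_rotation (w := -b) (by rw [h.ad_fst X hX, smul_neg])
    (by rw [map_neg, h.ad_snd X hX])
  have hform := congrArg (C.form a) (hXa.symm.trans hrot)
  simp only [map_neg, map_add, map_smul, smul_eq_mul, h.form_fst_snd hH hα, neg_zero, mul_zero,
    add_zero] at hform
  refine mul_right_cancel₀ (C.form_pos a ha).ne' ?_
  rw [neg_one_mul, hform]

theorem apply_eq_pi_or_eq_neg_pi [CompleteSpace V] {X : V} (hX : C.IsShortestLog 𝔱 X)
    (hXa : exp (C.ad X) a = -a) : α X = Real.pi ∨ α X = -Real.pi := by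
  obtain ⟨k, hk⟩ := Real.cos_eq_neg_one_iff.1 (h.cos_apply_eq_neg_one ha hH hα hX.1 hXa)
  have habs := abs_le.1 (h.abs_apply_le_two_pi h𝔱 ha hH hα hX)
  rw [← hk] at habs ⊢
  have hpi := Real.pi_pos
  have hk_lt : k < 1 := by
    have : (k : ℝ) < 1 := by nlinarith
    exact_mod_cast this
  have hlt_k : -2 < k := by
    have : (-2 : ℝ) < k := by nlinarith
    exact_mod_cast this
  obtain rfl | rfl : k = 0 ∨ k = -1 := by omega
  · left; simp
  · right; push_cast; ring

end Coroot

end IsRootPair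

end CompactBracket

section LocalSections

open Filter Topology NormedSpace

variable {V X W : Type*} [NormedAddCommGroup V] [NormedSpace ℝ V] [FiniteDimensional ℝ V]
  [NormedAddCommGroup X] [NormedSpace ℝ X] [FiniteDimensional ℝ X]
  [NormedAddCommGroup W] [NormedSpace ℝ W] [FiniteDimensional ℝ W]

theorem exists_localInverse_mul_exp {f : X → V →L[ℝ] V} {f' : X →L[ℝ] V →L[ℝ] V} {e : X}
    (hf : HasStrictFDerivAt f f' e) (he : f e = 1) {N : W →L[ℝ] V →L[ℝ] V}
    (hbij : Function.Bijective (f'.coprod N)) :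
    ∃ φ : (V →L[ℝ] V) → X × W, φ 1 = (e, 0) ∧ (∀ᶠ A in 𝓝 1, ContinuousAt φ A) ∧
      ∀ᶠ A in 𝓝 1, f (φ A).1 * exp (N (φ A).2) = A := by
  have : CompleteSpace V := FiniteDimensional.complete ℝ V
  have : CompleteSpace (X × W) := FiniteDimensional.complete ℝ (X × W)
  have hfst : HasStrictFDerivAt (fun p : X × W => f p.1) (f' ∘L .fst ℝ X W) (e, 0) :=
    HasStrictFDerivAt.comp (f := Prod.fst) (e, (0 : W)) hf hasStrictFDerivAt_fst
  have hΦ : HasStrictFDerivAt (fun p : X × W => f p.1 * exp (N p.2))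
      ((LinearEquiv.ofBijective (f'.coprod N : X × W →ₗ[ℝ] V →L[ℝ] V)
        hbij).toContinuousLinearEquiv : X × W →L[ℝ] V →L[ℝ] V) (e, 0) := by
    refine (hasStrictFDerivAt_mul_exp hfst (L := N ∘L .snd ℝ X W) N.map_zero).congr_fderiv ?_
    refine ContinuousLinearMap.ext fun p => ContinuousLinearMap.ext fun v => ?_
    simp [he]
  let Ψ := hΦ.toOpenPartialHomeomorph _
  have hmem : (e, 0) ∈ Ψ.source := hΦ.mem_toOpenPartialHomeomorph_source
  have hΨ_base : Ψ (e, 0) = 1 := by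
    change f e * exp (N 0) = 1
    rw [he, one_mul, map_zero, exp_zero]
  have htarget : Ψ.target ∈ 𝓝 1 := Ψ.open_target.mem_nhds (hΨ_base ▸ Ψ.map_source hmem)
  refine ⟨Ψ.symm, by rw [← hΨ_base, Ψ.left_inv hmem], ?_, ?_⟩
  · filter_upwards [htarget] with A hA using Ψ.continuousAt_symm hA
  · filter_upwards [htarget] with A hA using Ψ.right_inv hA

omit [FiniteDimensional ℝ X] in
theorem exists_bijective_coprod {f' : X →L[ℝ] W} (hinj : Function.Injective f') :
    ∃ (m : ℕ) (N : EuclideanSpace ℝ (Fin m) →L[ℝ] W),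
      Disjoint (f' : X →ₗ[ℝ] W).range (N : EuclideanSpace ℝ (Fin m) →ₗ[ℝ] W).range ∧
        Function.Bijective (f'.coprod N) := by
  obtain ⟨S, hS⟩ := (f' : X →ₗ[ℝ] W).range.exists_isCompl
  let e : EuclideanSpace ℝ (Fin (Module.finrank ℝ S)) ≃ₗ[ℝ] S := .ofFinrankEq _ _ (by simp)
  refine ⟨_, LinearMap.toContinuousLinearMap (S.subtype ∘ₗ e.toLinearMap),
    hS.disjoint.mono_right ?_, ?_⟩
  · rintro _ ⟨w, rfl⟩
    exact (e w).2
  · exact (((LinearEquiv.ofInjective (f' : X →ₗ[ℝ] W) hinj).prodCongr e).trans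
      (Submodule.prodEquivOfIsCompl _ _ hS)).bijective

/- The automorphisms near `1` form a submanifold with tangent space `range C.ad`: multiplying `f` by
exponentials from a complement of this range gives a chart of `V →L[ℝ] V` near `1`, in which the
complementary coordinate of an automorphism vanishes. -/
theorem CompactBracket.exists_localSection {C : CompactBracket V} (hinj : Function.Injective C.ad)
    {f : V → V →L[ℝ] V} {e : V} (hf : HasStrictFDerivAt f C.ad e) (hAut : ∀ x, C.IsAut (f x))
    (he : f e = 1) :
    ∃ σ : (V →L[ℝ] V) → V, σ 1 = e ∧ (∀ᶠ A in 𝓝 1, ContinuousAt σ A) ∧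
      ∀ᶠ A in 𝓝 1, C.IsAut A → f (σ A) = A := by
  obtain ⟨m, N, hN, hbij⟩ := exists_bijective_coprod hinj
  obtain ⟨φ, hφ_one, hcont, hφ⟩ := exists_localInverse_mul_exp hf he hbij
  refine ⟨fun A => (φ A).1, congrArg Prod.fst hφ_one, hcont.mono fun A hA => hA.fst, ?_⟩
  have hsnd : Tendsto (fun A => N (φ A).2) (𝓝 1) (𝓝 0) := by
    have := (N.continuous.continuousAt.comp hcont.self_of_nhds.snd).tendsto
    rwa [Function.comp_apply, hφ_one, map_zero] at this
  filter_upwards [hφ, hsnd.eventually (eventually_eq_zero_of_isAut_exp hN)]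
    with A hA hzero hAutA
  rwa [hzero ⟨_, rfl⟩ ((hAut _).of_mul_eq hAutA hA), exp_zero, mul_one] at hA

end LocalSections

section AdjointRepresentation

open Filter Topology NormedSpace

variable {n : ℕ} {G : Type*} [TopologicalSpace G] [ChartedSpace (EuclideanSpace ℝ (Fin n)) G]
  [Group G]

local notation "𝔼" => EuclideanSpace ℝ (Fin n)

/-- The differential at the identity of a group homomorphism, as an operator on the model space. -/
noncomputable def modelDifferential (n : ℕ) {G : Type*} [TopologicalSpace G]
    [ChartedSpace (EuclideanSpace ℝ (Fin n)) G] [Group G] (σ : G →* G) :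
    EuclideanSpace ℝ (Fin n) →L[ℝ] EuclideanSpace ℝ (Fin n) := lieDifferential n σ

variable [LieGroup (𝓡 n) ∞ G]

theorem modelAd_mul (g h : G) : modelAd n (g * h) = modelAd n g * modelAd n h := lieAd_mul g h

theorem modelAd_mul_modelAd_inv (g : G) : modelAd n g * modelAd n g⁻¹ = 1 := by
  rw [← modelAd_mul, mul_inv_cancel, modelAd_one]

theorem modelAd_inv_mul_modelAd (g : G) : modelAd n g⁻¹ * modelAd n g = 1 := by
  rw [← modelAd_mul, inv_mul_cancel, modelAd_one]

theorem modelAd_pow (g : G) (m : ℕ) : modelAd n (g ^ m) = modelAd n g ^ m :=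
  map_pow (⟨⟨modelAd n, modelAd_one⟩, modelAd_mul⟩ : G →* 𝔼 →L[ℝ] 𝔼) g m

theorem modelAd_mul_modelDifferential {σ : G →* G} (hσ : MDifferentiable (𝓡 n) (𝓡 n) σ) (g : G) :
    modelAd n (σ g) * modelDifferential n σ = modelDifferential n σ * modelAd n g := by
  have h : (MulAut.conj (σ g)).toMonoidHom.comp σ = σ.comp (MulAut.conj g).toMonoidHom := by
    ext x
    simp
  exact (lieDifferential_comp (mdifferentiable_conj (σ g)) hσ).symm.trans
    ((congrArg (lieDifferential n) h).trans (lieDifferential_comp hσ (mdifferentiable_conj g)))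

theorem modelDifferential_modelBracket {σ : G →* G} (hσ : MDifferentiable (𝓡 n) (𝓡 n) σ)
    (T X : 𝔼) : modelDifferential n σ (modelBracket n G T X) =
      modelBracket n G (modelDifferential n σ T) (modelDifferential n σ X) := by
  have hAd : HasFDerivAt (fun x => modelAd n ((chartOne n G).symm x)) (modelBracket n G)
      (chartOne n G (σ ((chartOne n G).symm (chartOne n G 1)))) := by
    rw [chartOne_symm_apply_self, map_one]
    exact hasStrictFDerivAt_modelAd.hasFDerivAt
  have hσ_one : HasFDerivAt (fun x => chartOne n G (σ ((chartOne n G).symm x)))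
      (modelDifferential n σ) (chartOne n G 1) := hasFDerivAt_chartOne_comp (map_one σ) (hσ 1)
  have hleft := (hAd.comp (f := fun x => chartOne n G (σ ((chartOne n G).symm x))) _
    hσ_one).clm_apply (hasFDerivAt_const (modelDifferential n σ X) _)
  have hright := (hasFDerivAt_const (modelDifferential n σ) _).clm_apply
    ((hasStrictFDerivAt_modelAd (G := G)).hasFDerivAt.clm_apply (hasFDerivAt_const X _))
  have hcont : ContinuousAt (fun x => σ ((chartOne n G).symm x)) (chartOne n G 1) :=
    hσ.continuous.continuousAt.comp contMDiffAt_chartOne_symm.continuousAt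
  have hsource := hcont.eventually_mem (s := (chartOne n G).source) (by
    rw [chartOne_symm_apply_self, map_one]
    exact extChartAt_source_mem_nhds (I := 𝓡 n) (1 : G))
  have heq := hleft.unique (hright.congr_of_eventuallyEq ?_)
  · simpa using (DFunLike.congr_fun heq T).symm
  · filter_upwards [hsource] with x hx
    have h := DFunLike.congr_fun (modelAd_mul_modelDifferential hσ ((chartOne n G).symm x)) X
    rwa [← (chartOne n G).left_inv hx] at h

theorem modelAd_modelBracket (g : G) (T X : 𝔼) :
    modelAd n g (modelBracket n G T X) = modelBracket n G (modelAd n g T) (modelAd n g X) :=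
  modelDifferential_modelBracket (mdifferentiable_conj g) T X

theorem continuous_modelAd : Continuous (modelAd n : G → 𝔼 →L[ℝ] 𝔼) := by
  have hG : IsTopologicalGroup G := topologicalGroup_of_lieGroup (𝓡 n) ∞
  have hone : ContinuousAt (modelAd n : G → 𝔼 →L[ℝ] 𝔼) 1 := by
    refine (ContinuousAt.comp (f := chartOne n G) hasStrictFDerivAt_modelAd.continuousAt
      (continuousAt_extChartAt (I := 𝓡 n) (1 : G))).congr ?_
    filter_upwards [extChartAt_source_mem_nhds (I := 𝓡 n) (1 : G)] with g hg
    rw [Function.comp_apply, (chartOne n G).left_inv hg]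
  exact continuous_of_continuousAt_one
    (⟨⟨modelAd n, modelAd_one⟩, modelAd_mul⟩ : G →* 𝔼 →L[ℝ] 𝔼) hone

end AdjointRepresentation

section CompactType

open Filter Topology NormedSpace

variable {n : ℕ} {G : Type*} [TopologicalSpace G] [ChartedSpace (EuclideanSpace ℝ (Fin n)) G]
  [Group G] [LieGroup (𝓡 n) ∞ G]

local notation "𝔼" => EuclideanSpace ℝ (Fin n)

instance finiteDimensional_lieAlg : FiniteDimensional ℝ (LieAlg n G) :=
  inferInstanceAs (FiniteDimensional ℝ 𝔼)

/-- The negative of the Killing form, as a continuous bilinear form on the model space. -/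
noncomputable def modelForm (n : ℕ) (G : Type*) [TopologicalSpace G]
    [ChartedSpace (EuclideanSpace ℝ (Fin n)) G] [Group G] [LieGroup (𝓡 n) ∞ G] :
    EuclideanSpace ℝ (Fin n) →L[ℝ] EuclideanSpace ℝ (Fin n) →L[ℝ] ℝ :=
  LinearMap.toContinuousBilinearMap (E := EuclideanSpace ℝ (Fin n))
    (F := EuclideanSpace ℝ (Fin n)) (-killingForm ℝ (LieAlg n G))

theorem modelBracket_skew (x y : LieAlg n G) :
    modelBracket n G x y = -modelBracket n G y x :=
  (modelBracket_apply x y).trans ((lie_skew x y).symm.trans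
    (congrArg (fun v : LieAlg n G => -v) (modelBracket_apply y x).symm))

theorem modelBracket_jacobi (x y z : LieAlg n G) :
    modelBracket n G x (modelBracket n G y z) =
      modelBracket n G (modelBracket n G x y) z + modelBracket n G y (modelBracket n G x z) := by
  have hx : modelBracket n G x (modelBracket n G y z) = (⁅x, ⁅y, z⁆⁆ : LieAlg n G) :=
    (congrArg (modelBracket n G x) (modelBracket_apply y z)).trans (modelBracket_apply x ⁅y, z⁆)
  have hxy : modelBracket n G (modelBracket n G x y) z = (⁅⁅x, y⁆, z⁆ : LieAlg n G) :=
    (congrArg (fun v => modelBracket n G v z) (modelBracket_apply x y)).trans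
      (modelBracket_apply ⁅x, y⁆ z)
  have hy : modelBracket n G y (modelBracket n G x z) = (⁅y, ⁅x, z⁆⁆ : LieAlg n G) :=
    (congrArg (modelBracket n G y) (modelBracket_apply x z)).trans (modelBracket_apply y ⁅x, z⁆)
  rw [hx, hxy, hy]
  exact leibniz_lie x y z

theorem modelForm_modelBracket (x y z : LieAlg n G) :
    modelForm n G (modelBracket n G x y) z = -modelForm n G y (modelBracket n G x z) := by
  have hxy : modelForm n G (modelBracket n G x y) z = -killingForm ℝ (LieAlg n G) ⁅x, y⁆ z :=
    congrArg (fun v => modelForm n G v z) (modelBracket_apply x y)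
  have hxz : modelForm n G y (modelBracket n G x z) = -killingForm ℝ (LieAlg n G) y ⁅x, z⁆ :=
    congrArg (modelForm n G y) (modelBracket_apply x z)
  rw [hxy, hxz, LieModule.traceForm_apply_lie_apply']

section Killing

variable (hneg : ∀ X : LieAlg n G, X ≠ 0 → killingForm ℝ (LieAlg n G) X X < 0)
include hneg

theorem isKilling_of_killingForm_neg : LieAlgebra.IsKilling ℝ (LieAlg n G) := by
  refine ⟨eq_bot_iff.2 fun x hx => of_not_not fun h0 => (hneg x h0).ne ?_⟩
  exact (LieIdeal.mem_killingCompl ℝ (LieAlg n G) ⊤).1 hx x trivial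

theorem exists_eq_lie_of_derivation (D : LieAlg n G →ₗ[ℝ] LieAlg n G)
    (hD : ∀ x y : LieAlg n G, D ⁅x, y⁆ = ⁅D x, y⁆ + ⁅x, D y⁆) :
    ∃ z : LieAlg n G, ∀ x : LieAlg n G, D x = ⁅z, x⁆ := by
  have := isKilling_of_killingForm_neg hneg
  let D' : LieDerivation ℝ (LieAlg n G) (LieAlg n G) :=
    { D with
      leibniz' := fun a b => by
        change D ⁅a, b⁆ = ⁅a, D b⁆ - ⁅b, D a⁆
        rw [hD, ← lie_skew b (D a), sub_neg_eq_add, add_comm] }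
  obtain ⟨z, hz⟩ := LieDerivation.IsKilling.exists_eq_ad D'
  exact ⟨z, fun x => (DFunLike.congr_fun hz x).symm.trans
    (DFunLike.congr_fun (LieDerivation.coe_ad_apply_eq_ad_apply z) x)⟩

end Killing

/-- The bracket and the negative of the Killing form of a Lie group whose Killing form is negative
definite. -/
noncomputable def compactBracket
    (hneg : ∀ X : LieAlg n G, X ≠ 0 → killingForm ℝ (LieAlg n G) X X < 0) :
    CompactBracket (EuclideanSpace ℝ (Fin n)) where
  ad := modelBracket n G
  form := modelForm n G
  ad_skew := modelBracket_skew (n := n) (G := G)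
  ad_ad := modelBracket_jacobi (n := n) (G := G)
  form_symm x y := congrArg (fun r : ℝ => -r)
    (LieModule.traceForm_comm ℝ (LieAlg n G) (LieAlg n G) x y)
  form_pos x hx := neg_pos.2 (hneg x hx)
  form_ad := modelForm_modelBracket (n := n) (G := G)
  exists_eq_ad D hD := by
    obtain ⟨z, hz⟩ := exists_eq_lie_of_derivation hneg (D : 𝔼 →ₗ[ℝ] 𝔼) fun x y =>
      (congrArg D (modelBracket_apply x y).symm).trans ((hD x y).trans
        (congrArg₂ (fun a b : LieAlg n G => a + b) (modelBracket_apply (D x) y)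
          (modelBracket_apply x (D y))))
    exact ⟨z, ContinuousLinearMap.ext fun x => (hz x).trans (modelBracket_apply z x).symm⟩

section Killing

variable (hneg : ∀ X : LieAlg n G, X ≠ 0 → killingForm ℝ (LieAlg n G) X X < 0)

include hneg in
theorem modelBracket_injective : Function.Injective (modelBracket n G) := by
  refine (injective_iff_map_eq_zero _).2 fun Z hZ => of_not_not fun h0 => (hneg Z h0).ne ?_
  have had : LieAlgebra.ad ℝ (LieAlg n G) Z = 0 := LinearMap.ext fun x =>
    (modelBracket_apply (n := n) (G := G) Z x).symm.trans (DFunLike.congr_fun hZ x)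
  exact (killingForm_apply_apply ℝ (LieAlg n G) Z Z).trans (by
    rw [had, LinearMap.zero_comp, map_zero])

theorem isAut_of_mul_eq_one {A B : 𝔼 →L[ℝ] 𝔼}
    (hA : ∀ x y, A (modelBracket n G x y) = modelBracket n G (A x) (A y))
    (hAB : A * B = 1) (hBA : B * A = 1) : (compactBracket hneg).IsAut A := by
  let e : LieAlg n G ≃ₗ⁅ℝ⁆ LieAlg n G :=
    { toFun := A
      invFun := B
      map_add' := A.map_add
      map_smul' := A.map_smul
      map_lie' := fun {x y} => (congrArg A (modelBracket_apply x y).symm).trans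
        ((hA x y).trans (modelBracket_apply (A x) (A y)))
      left_inv := DFunLike.congr_fun hBA
      right_inv := DFunLike.congr_fun hAB }
  exact ⟨hA, fun x y =>
    congrArg (fun r : ℝ => -r) (LieAlgebra.killingForm_of_equiv_apply e x y)⟩

theorem isAut_modelAd (g : G) : (compactBracket hneg).IsAut (modelAd n g) :=
  isAut_of_mul_eq_one hneg (modelAd_modelBracket g) (modelAd_mul_modelAd_inv g)
    (modelAd_inv_mul_modelAd g)

include hneg in
theorem exists_modelAd_eq_exp [ConnectedSpace G] (g : G) :
    ∃ Y, modelAd n g = exp (modelBracket n G Y) :=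
  CompactBracket.exists_eq_exp_ad_of_preconnectedSpace (C := compactBracket hneg)
    continuous_modelAd (isAut_modelAd hneg) modelAd_one g

include hneg in
theorem eventually_eq_one_of_modelAd_eq_one : ∀ᶠ g : G in 𝓝 1, modelAd n g = 1 → g = 1 := by
  have hchart : ∀ᶠ x in 𝓝 (chartOne n G 1), x ≠ chartOne n G 1 →
      modelAd n ((chartOne n G).symm x) ≠ 1 := by
    obtain ⟨K, -, hK⟩ := (modelBracket n G : 𝔼 →ₗ[ℝ] 𝔼 →L[ℝ] 𝔼).exists_antilipschitzWith
      (LinearMap.ker_eq_bot.2 (modelBracket_injective hneg))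
    have hderiv := (hasStrictFDerivAt_modelAd (n := n) (G := G)).hasFDerivAt
    exact eventually_nhdsWithin_iff.1 (hderiv.eventually_ne ⟨K, hK⟩)
  filter_upwards [(continuousAt_extChartAt (I := 𝓡 n) (1 : G)).eventually hchart,
    extChartAt_source_mem_nhds (I := 𝓡 n) (1 : G)] with g hg hsource h
  by_contra hne
  rw [(chartOne n G).left_inv hsource] at hg
  exact hg (fun heq => hne ((chartOne n G).injOn hsource (mem_extChartAt_source _) heq)) h

theorem exists_localSection_modelAd :
    ∃ s : (𝔼 →L[ℝ] 𝔼) → G, s 1 = 1 ∧ (∀ᶠ A in 𝓝 1, ContinuousAt s A) ∧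
      ∀ᶠ A in 𝓝 1, (compactBracket hneg).IsAut A → modelAd n (s A) = A := by
  obtain ⟨σ, hσ_one, hcont, hσ⟩ := CompactBracket.exists_localSection (C := compactBracket hneg)
    (modelBracket_injective hneg) (hasStrictFDerivAt_modelAd (G := G))
    (fun x => isAut_modelAd hneg _) (by rw [chartOne_symm_apply_self, modelAd_one])
  have htarget : ∀ᶠ A in 𝓝 1, σ A ∈ (chartOne n G).target :=
    hcont.self_of_nhds.eventually_mem (hσ_one ▸ extChartAt_target_mem_nhds (I := 𝓡 n) (1 : G))
  refine ⟨fun A => (chartOne n G).symm (σ A), ?_, ?_, hσ⟩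
  · change (chartOne n G).symm (σ 1) = 1
    rw [hσ_one, chartOne_symm_apply_self]
  · filter_upwards [hcont, htarget] with A hA hmem
    exact (continuousAt_extChartAt_symm'' (I := 𝓡 n) hmem).comp hA

end Killing

end CompactType

section OperatorExponentialPowers

open NormedSpace

variable {V : Type*} [NormedAddCommGroup V] [NormedSpace ℝ V] [CompleteSpace V]

theorem exp_natCast_smul (D : V →L[ℝ] V) (N : ℕ) : exp ((N : ℝ) • D) = exp D ^ N := by
  induction N with
  | zero => simp
  | succ N ih =>
    rw [Nat.cast_succ, add_smul, one_smul,
      exp_add_of_commute_real ((Commute.refl D).smul_left (N : ℝ)), ih, pow_succ]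

theorem eq_zero_of_exp_smul_eq_one {D : V →L[ℝ] V} {ε : ℝ} (hε : 0 < ε)
    (h : ∀ t ∈ Set.Ioo (-ε) ε, exp (t • D) = 1) : D = 0 := by
  ext v
  have hderiv : HasDerivAt (fun t : ℝ => exp (t • D) v) 0 0 := by
    refine (hasDerivAt_const (0 : ℝ) v).congr_of_eventuallyEq ?_
    filter_upwards [Ioo_mem_nhds (neg_lt_zero.2 hε) hε] with t ht
    rw [h t ht, one_apply_eq_self]
  simpa using (hasDerivAt_exp_smul_apply D v 0).unique hderiv

theorem exp_apply_mem {D : V →L[ℝ] V} {S : Submodule ℝ V} [FiniteDimensional ℝ S]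
    (h : ∀ x ∈ S, D x ∈ S) {x : V} (hx : x ∈ S) : exp D x ∈ S := by
  have : CompleteSpace S := FiniteDimensional.complete ℝ S
  have hexp := map_exp_smul_apply_of_comp_eq (D := D.restrict h) (D' := D) (f := S.subtypeL)
    (by ext v; rfl) 1 ⟨x, hx⟩
  rw [one_smul, one_smul] at hexp
  exact hexp ▸ Subtype.property _

end OperatorExponentialPowers

section ExponentialLifts

open Filter Topology NormedSpace

variable {n : ℕ} {G : Type*} [TopologicalSpace G] [ChartedSpace (EuclideanSpace ℝ (Fin n)) G]
  [Group G] [LieGroup (𝓡 n) ∞ G]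

/-- `γ` lifts the one-parameter group `exp (t ad Z)` of automorphisms to `G` for `|t| < ε`. It
replaces the exponential map of `G`, which is not needed otherwise; `γ` is not assumed to be a
homomorphism. -/
structure IsExpLift (γ : ℝ → G) (Z : EuclideanSpace ℝ (Fin n)) (ε : ℝ) : Prop where
  pos : 0 < ε
  map_zero : γ 0 = 1
  continuousOn : ContinuousOn γ (Set.Ioo (-ε) ε)
  modelAd_eq : ∀ t ∈ Set.Ioo (-ε) ε, modelAd n (γ t) = exp (t • modelBracket n G Z)

variable (hneg : ∀ X : LieAlg n G, X ≠ 0 → killingForm ℝ (LieAlg n G) X X < 0)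
include hneg

theorem exists_isExpLift (Z : EuclideanSpace ℝ (Fin n)) :
    ∃ (γ : ℝ → G) (ε : ℝ), IsExpLift γ Z ε := by
  obtain ⟨s, hs_one, hcont, hs⟩ := exists_localSection_modelAd hneg
  let c : ℝ → EuclideanSpace ℝ (Fin n) →L[ℝ] EuclideanSpace ℝ (Fin n) :=
    fun t => exp (t • modelBracket n G Z)
  have hc : Continuous c := continuous_iff_continuousAt.2 fun t =>
    (hasDerivAt_exp_smul_const (modelBracket n G Z) t).continuousAt
  have hc_zero : c 0 = 1 :=
    (congrArg exp (zero_smul ℝ (modelBracket n G Z))).trans exp_zero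
  have htendsto : Tendsto c (𝓝 0) (𝓝 1) := hc_zero ▸ hc.tendsto 0
  obtain ⟨ε, hε, hball⟩ := Metric.eventually_nhds_iff.1 (htendsto.eventually (hcont.and hs))
  have hmem : ∀ t ∈ Set.Ioo (-ε) ε, ContinuousAt s (c t) ∧
      ((compactBracket hneg).IsAut (c t) → modelAd n (s (c t)) = c t) := fun t ht =>
    hball (by rw [dist_zero_right, Real.norm_eq_abs]; exact abs_lt.2 ht)
  have haut : ∀ t, (compactBracket hneg).IsAut (c t) := fun t => by
    have := (compactBracket hneg).isAut_exp (t • Z)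
    rwa [map_smul] at this
  exact ⟨fun t => s (c t), ε, hε, by rw [hc_zero, hs_one],
    fun t ht => ((hmem t ht).1.comp hc.continuousAt).continuousWithinAt,
    fun t ht => (hmem t ht).2 (haut t)⟩

theorem IsExpLift.conj {γ : ℝ → G} {Z : EuclideanSpace ℝ (Fin n)} {ε : ℝ}
    (hγ : IsExpLift γ Z ε) (g : G) :
    IsExpLift (fun t => g * γ t * g⁻¹) (modelAd n g Z) ε := by
  have : IsTopologicalGroup G := topologicalGroup_of_lieGroup (𝓡 n) ∞
  refine ⟨hγ.pos, by rw [hγ.map_zero, mul_one, mul_inv_cancel],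
    (continuousOn_const.mul hγ.continuousOn).mul continuousOn_const, fun t ht => ?_⟩
  have hexp : modelAd n g * exp (t • modelBracket n G Z) =
      exp (t • modelBracket n G (modelAd n g Z)) * modelAd n g := by
    have := (isAut_modelAd hneg g).mul_exp_ad (t • Z)
    rwa [map_smul, map_smul, map_smul] at this
  rw [modelAd_mul, modelAd_mul, hγ.modelAd_eq t ht, hexp, mul_assoc, modelAd_mul_modelAd_inv,
    mul_one]

end ExponentialLifts

namespace CompactSymmetricPair

open Filter Topology NormedSpace

variable {n : ℕ} {G : Type*} [TopologicalSpace G]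
  [ChartedSpace (EuclideanSpace ℝ (Fin n)) G] [Group G] [LieGroup (𝓡 n) ∞ G]
  [T2Space G] [CompactSpace G] [ConnectedSpace G] (P : CompactSymmetricPair n G)

local notation "𝔼" => EuclideanSpace ℝ (Fin n)

theorem mdifferentiable_σ : MDifferentiable (𝓡 n) (𝓡 n) P.σ :=
  P.contMDiff_σ.mdifferentiable (by simp)

/-- The Cartan involution `θ` on the model space of `𝔤`. -/
noncomputable def modelθ : 𝔼 →L[ℝ] 𝔼 := modelDifferential n P.σ

/-- The bracket of `𝔤` and the negative of its Killing form. -/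
noncomputable abbrev bracket : CompactBracket 𝔼 :=
  compactBracket P.killingForm_neg

theorem modelθ_mul_modelθ : P.modelθ * P.modelθ = 1 := by
  have hcomp : P.σ.comp P.σ = MonoidHom.id G := MonoidHom.ext P.σ_σ
  exact (lieDifferential_comp P.mdifferentiable_σ P.mdifferentiable_σ).symm.trans
    ((congrArg (lieDifferential n) hcomp).trans lieDifferential_id)

theorem modelθ_modelθ (X : 𝔼) : P.modelθ (P.modelθ X) = X :=
  DFunLike.congr_fun P.modelθ_mul_modelθ X

theorem modelθ_modelBracket (X Y : 𝔼) :
    P.modelθ (modelBracket n G X Y) = modelBracket n G (P.modelθ X) (P.modelθ Y) :=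
  modelDifferential_modelBracket P.mdifferentiable_σ X Y

theorem isAut_modelθ : P.bracket.IsAut P.modelθ :=
  isAut_of_mul_eq_one P.killingForm_neg P.modelθ_modelBracket P.modelθ_mul_modelθ
    P.modelθ_mul_modelθ

theorem modelAd_σ_mul_modelθ (g : G) :
    modelAd n (P.σ g) * P.modelθ = P.modelθ * modelAd n g :=
  modelAd_mul_modelDifferential P.mdifferentiable_σ g

theorem modelAd_mul_modelθ_of_mem {k : G} (hk : k ∈ P.K) :
    modelAd n k * P.modelθ = P.modelθ * modelAd n k := by
  simpa only [P.σ_eq_of_mem_K k hk] using P.modelAd_σ_mul_modelθ k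

theorem exp_smul_mul_modelθ {Z : 𝔼} (hZ : P.modelθ Z = Z) (t : ℝ) :
    exp (t • modelBracket n G Z) * P.modelθ = P.modelθ * exp (t • modelBracket n G Z) := by
  have h := P.isAut_modelθ.mul_exp_ad (t • Z)
  rw [P.modelθ.map_smul, hZ, map_smul] at h
  exact h.symm

theorem modelAd_inv_mul_σ {c : G} (hc : modelAd n c * P.modelθ = P.modelθ * modelAd n c) :
    modelAd n (c⁻¹ * P.σ c) = 1 := by
  have hσ : modelAd n (P.σ c) = modelAd n c := by
    simpa only [mul_assoc, P.modelθ_mul_modelθ, mul_one] using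
      congrArg (· * P.modelθ) ((P.modelAd_σ_mul_modelθ c).trans hc.symm)
  rw [modelAd_mul, hσ, modelAd_inv_mul_modelAd]

/- On `C` the map `c ↦ c⁻¹ σ(c)` takes values in the kernel of `Ad`, which is discrete, so it is
constant. -/
theorem subset_K_of_commute {C : Set G} (hC : IsPreconnected C) (h1 : (1 : G) ∈ C)
    (hcomm : ∀ c ∈ C, modelAd n c * P.modelθ = P.modelθ * modelAd n c) : C ⊆ P.K := by
  have : IsTopologicalGroup G := topologicalGroup_of_lieGroup (𝓡 n) ∞
  have : PreconnectedSpace C := isPreconnected_iff_preconnectedSpace.1 hC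
  let f : C → G := fun c => (c : G)⁻¹ * P.σ c
  have hf : Continuous f :=
    continuous_subtype_val.inv.mul (P.contMDiff_σ.continuous.comp continuous_subtype_val)
  have hclopen : IsClopen {c : C | f c = 1} := by
    refine ⟨isClosed_eq hf continuous_const, isOpen_iff_mem_nhds.2 fun c hc => ?_⟩
    have hker := eventually_eq_one_of_modelAd_eq_one P.killingForm_neg
    rw [← show f c = 1 from hc] at hker
    filter_upwards [hf.continuousAt.eventually hker] with d hd
    exact (hd (P.modelAd_inv_mul_σ (hcomm d d.2))).trans hc
  have huniv : ∀ c, f c = 1 :=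
    Set.eq_univ_iff_forall.1 (hclopen.eq_univ ⟨⟨1, h1⟩, by simp [f]⟩)
  exact (hC.subset_connectedComponentIn h1 fun c hc =>
    (inv_mul_eq_one.1 (huniv ⟨c, hc⟩)).symm).trans P.connectedComponent_subset_K

variable {P} in
theorem _root_.IsExpLift.mem_K {γ : ℝ → G} {Z : 𝔼} {ε : ℝ} (hγ : IsExpLift γ Z ε)
    (hZ : P.modelθ Z = Z) {t : ℝ} (ht : t ∈ Set.Ioo (-ε) ε) : γ t ∈ P.K := by
  refine P.subset_K_of_commute (isPreconnected_Ioo.image _ hγ.continuousOn)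
    ⟨0, ⟨neg_lt_zero.2 hγ.pos, hγ.pos⟩, hγ.map_zero⟩ ?_ ⟨t, ht, rfl⟩
  rintro _ ⟨s, hs, rfl⟩
  rw [hγ.modelAd_eq s hs]
  exact P.exp_smul_mul_modelθ hZ s

theorem exists_mem_K_modelAd_eq_exp {Z : 𝔼} (hZ : P.modelθ Z = Z) (t : ℝ) :
    ∃ k ∈ P.K, modelAd n k = exp (t • modelBracket n G Z) := by
  obtain ⟨γ, ε, hγ⟩ := exists_isExpLift P.killingForm_neg Z
  obtain ⟨N, hN⟩ := exists_nat_gt (|t| / ε)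
  have hN_pos : 0 < (N : ℝ) := (div_nonneg (abs_nonneg t) hγ.pos.le).trans_lt hN
  have hmem : t / N ∈ Set.Ioo (-ε) ε := by
    rw [Set.mem_Ioo, ← abs_lt, abs_div, abs_of_pos hN_pos, div_lt_comm₀ hN_pos hγ.pos]
    exact hN
  refine ⟨γ (t / N) ^ N, pow_mem (hγ.mem_K hZ hmem) N, ?_⟩
  rw [modelAd_pow, hγ.modelAd_eq _ hmem, ← exp_natCast_smul, smul_smul,
    mul_div_cancel₀ _ hN_pos.ne']

theorem exists_add_eq (Y : 𝔼) : ∃ U x, P.modelθ U = U ∧ P.modelθ x = -x ∧ U + x = Y := by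
  refine ⟨(2⁻¹ : ℝ) • (Y + P.modelθ Y), (2⁻¹ : ℝ) • (Y - P.modelθ Y), ?_, ?_, ?_⟩
  · rw [map_smul, map_add, modelθ_modelθ, add_comm]
  · rw [map_smul, map_sub, modelθ_modelθ, ← smul_neg, neg_sub]
  · module

/-- The kernel of the action of `𝔨` on `𝔭`. -/
noncomputable def isotropyKernel : Submodule ℝ 𝔼 where
  carrier := {Z | P.modelθ Z = Z ∧ ∀ x, P.modelθ x = -x → modelBracket n G Z x = 0}
  add_mem' {X Y} hX hY := ⟨by rw [map_add, hX.1, hY.1], fun x hx => by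
    rw [map_add, add_apply, hX.2 x hx, hY.2 x hx, add_zero]⟩
  zero_mem' := ⟨map_zero _, fun x _ => by rw [map_zero, zero_apply]⟩
  smul_mem' c X hX := ⟨by rw [map_smul, hX.1], fun x hx => by
    rw [map_smul, smul_apply, hX.2 x hx, smul_zero]⟩

variable {P} in
theorem modelBracket_mem_isotropyKernel (Y : 𝔼) {Z : 𝔼} (hZ : Z ∈ P.isotropyKernel) :
    modelBracket n G Y Z ∈ P.isotropyKernel := by
  obtain ⟨U, x, hU, hx, rfl⟩ := P.exists_add_eq Y
  have hxZ : modelBracket n G x Z = 0 := by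
    rw [modelBracket_skew (n := n) (G := G) x Z, hZ.2 x hx, neg_zero]
  rw [map_add, add_apply, hxZ, add_zero]
  refine ⟨by rw [modelθ_modelBracket, hU, hZ.1], fun y hy => ?_⟩
  have hZUy : modelBracket n G Z (modelBracket n G U y) = 0 :=
    hZ.2 _ (by rw [modelθ_modelBracket, hU, hy, map_neg])
  simpa only [hZ.2 y hy, hZUy, map_zero, add_zero, eq_comm] using
    modelBracket_jacobi (n := n) (G := G) U Z y

variable {P} in
theorem modelAd_mem_isotropyKernel (g : G) {Z : 𝔼} (hZ : Z ∈ P.isotropyKernel) :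
    modelAd n g Z ∈ P.isotropyKernel := by
  obtain ⟨Y, hY⟩ := exists_modelAd_eq_exp P.killingForm_neg g
  rw [hY]
  exact exp_apply_mem (fun _ => modelBracket_mem_isotropyKernel Y) hZ

/- A one-parameter group generated by an element of the kernel would generate a normal subgroup of
`G` inside `K`. -/
theorem isotropyKernel_eq_bot (hP : P.IsEffective) : P.isotropyKernel = ⊥ := by
  refine eq_bot_iff.2 fun Z hZ => ?_
  obtain ⟨γ, ε, hγ⟩ := exists_isExpLift P.killingForm_neg Z
  have hbot : (Subgroup.normalClosure (γ '' Set.Ioo (-ε) ε) : Subgroup G) = ⊥ := by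
    refine hP _ Subgroup.normalClosure_normal ((Subgroup.closure_le _).2 fun h hh => ?_)
    obtain ⟨_, ⟨t, ht, rfl⟩, hconj⟩ := Group.mem_conjugatesOfSet_iff.1 hh
    obtain ⟨g, rfl⟩ := isConj_iff.1 hconj
    exact (hγ.conj P.killingForm_neg g).mem_K (modelAd_mem_isotropyKernel g hZ).1 ht
  have hγ_one : ∀ t ∈ Set.Ioo (-ε) ε, γ t = 1 := fun t ht => by
    rw [← Subgroup.mem_bot, ← hbot]
    exact Subgroup.subset_normalClosure ⟨t, ht, rfl⟩
  have had : modelBracket n G Z = 0 := eq_zero_of_exp_smul_eq_one hγ.pos fun t ht => by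
    rw [← hγ.modelAd_eq t ht, hγ_one t ht, modelAd_one]
  exact (injective_iff_map_eq_zero _).1 (modelBracket_injective P.killingForm_neg) Z had

theorem modelθ_eq_modelAd (hP : P.IsEffective) {k : G} (hk : k ∈ P.K)
    (hneg : ∀ x, P.modelθ x = -x → modelAd n k x = -x) : P.modelθ = modelAd n k := by
  ext1 Y
  obtain ⟨U, x, hU, hx, rfl⟩ := P.exists_add_eq Y
  have hcomm : modelAd n k (P.modelθ U) = P.modelθ (modelAd n k U) :=
    DFunLike.congr_fun (P.modelAd_mul_modelθ_of_mem hk) U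
  have hfix : modelAd n k U - U ∈ P.isotropyKernel := by
    refine ⟨by rw [map_sub, ← hcomm, hU], fun y hy => ?_⟩
    have hUy := modelAd_modelBracket k U y
    rw [hneg y hy, hneg _ (by rw [modelθ_modelBracket, hU, hy, map_neg]), map_neg, neg_inj] at hUy
    rw [map_sub, sub_apply, ← hUy, sub_self]
  rw [P.isotropyKernel_eq_bot hP, Submodule.mem_bot, sub_eq_zero] at hfix
  rw [map_add, map_add, hU, hx, hneg x hx, hfix]

end CompactSymmetricPair

section GeneratedSubgroups

theorem isConnected_subgroupClosure {M : Type*} [Group M] [TopologicalSpace M]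
    [IsTopologicalGroup M] {S : Set M} (hS : IsPreconnected S) (h1 : (1 : M) ∈ S) :
    IsConnected (Subgroup.closure S : Set M) := by
  let H := Subgroup.closure S
  have himage : ((↑) : H → M) '' ((↑) ⁻¹' S) = S := Set.image_preimage_eq_of_subset fun x hx =>
    ⟨⟨x, Subgroup.subset_closure hx⟩, rfl⟩
  have hpre : IsPreconnected ((↑) ⁻¹' S : Set H) :=
    Topology.IsInducing.subtypeVal.isPreconnected_image.1 (himage.symm ▸ hS)
  have htop : Subgroup.connectedComponentOfOne H = ⊤ := by
    rw [eq_top_iff, ← Subgroup.closure_closure_coe_preimage, Subgroup.closure_le]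
    exact hpre.subset_connectedComponent h1
  have hconn : connectedComponent (1 : H) = Set.univ :=
    congrArg (fun N : Subgroup H => (N : Set H)) htop
  have hrange : ((↑) : H → M) '' connectedComponent 1 = H := by
    rw [hconn, Set.image_univ]
    exact Subtype.range_coe
  exact hrange ▸ isConnected_connectedComponent.image _ continuous_subtype_val.continuousOn

theorem smul_mem_orbit_of_mem_closure {M X : Type*} [Group M] [MulAction M X] {H : Subgroup M}
    {S : Set M} (hS : ∀ s ∈ S, ∀ x : X, s • x ∈ MulAction.orbit H x) {g : M}
    (hg : g ∈ Subgroup.closure S) (x : X) : g • x ∈ MulAction.orbit H x := by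
  induction hg using Subgroup.closure_induction generalizing x with
  | mem s hs => exact hS s hs x
  | one => exact (one_smul M x).symm ▸ MulAction.mem_orbit_self x
  | mul s t _ _ hs ht => exact mul_smul s t x ▸ MulAction.orbit_eq_iff.2 (ht x) ▸ hs (t • x)
  | inv s _ hs =>
    have := hs (s⁻¹ • x)
    rw [smul_inv_smul] at this
    exact MulAction.mem_orbit_symm.1 this

end GeneratedSubgroups

/- Instance search fails to find this directly when `V` is a submodule, as `𝔭` is. -/
theorem continuousMul_clm (V : Type*) [SeminormedAddCommGroup V] [NormedSpace ℝ V] :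
    ContinuousMul (V →L[ℝ] V) :=
  inferInstance

namespace CompactSymmetricPair

open Topology NormedSpace

variable {n : ℕ} {G : Type*} [TopologicalSpace G]
  [ChartedSpace (EuclideanSpace ℝ (Fin n)) G] [Group G] [LieGroup (𝓡 n) ∞ G]
  [T2Space G] [CompactSpace G] [ConnectedSpace G] (P : CompactSymmetricPair n G)

instance t2Space_lieAlg : T2Space (LieAlg n G) :=
  inferInstanceAs (T2Space (EuclideanSpace ℝ (Fin n)))

instance continuousMul_clm_𝔭 : ContinuousMul (P.𝔭 →L[ℝ] P.𝔭) :=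
  let S : Submodule ℝ (EuclideanSpace ℝ (Fin n)) := P.𝔭
  continuousMul_clm S

theorem innerP_add_left (x y z : P.𝔭) : P.innerP (x + y) z = P.innerP x z + P.innerP y z := by
  simp only [innerP, Submodule.coe_add, map_add, LinearMap.add_apply, neg_add]

theorem innerP_smul_left (c : ℝ) (x y : P.𝔭) : P.innerP (c • x) y = c * P.innerP x y := by
  simp only [innerP, Submodule.coe_smul, map_smul, LinearMap.smul_apply, smul_eq_mul, mul_neg]

theorem innerP_comm (x y : P.𝔭) : P.innerP x y = P.innerP y x :=
  congrArg (fun r : ℝ => -r) (LieModule.traceForm_comm ℝ (LieAlg n G) (LieAlg n G) x y)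

theorem innerP_add_right (x y z : P.𝔭) : P.innerP x (y + z) = P.innerP x y + P.innerP x z := by
  rw [innerP_comm, innerP_add_left, innerP_comm, P.innerP_comm z]

theorem innerP_smul_right (c : ℝ) (x y : P.𝔭) : P.innerP x (c • y) = c * P.innerP x y := by
  rw [innerP_comm, innerP_smul_left, innerP_comm]

theorem innerP_self_pos {x : P.𝔭} (hx : x ≠ 0) : 0 < P.innerP x x :=
  neg_pos.2 (P.killingForm_neg x fun h => hx (Subtype.ext h))

variable {P}

namespace IsComplexStructure

variable {J : P.𝔭 →ₗ[ℝ] P.𝔭} (hJ : P.IsComplexStructure J)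
include hJ

theorem apply_apply (x : P.𝔭) : J (J x) = -x := by
  refine eq_neg_of_add_eq_zero_left (of_not_not fun hne => (P.innerP_self_pos hne).ne' ?_)
  rw [innerP_add_left, hJ.2, hJ.1, neg_add_cancel]

theorem cos_smul_add_sin_smul_apply_cos_smul_sub (t : ℝ) (x : P.𝔭) :
    Real.cos t • (Real.cos t • x + (-Real.sin t) • J x) +
      Real.sin t • J (Real.cos t • x + (-Real.sin t) • J x) = x := by
  have hx : (Real.cos t ^ 2 + Real.sin t ^ 2) • x = x := by rw [Real.cos_sq_add_sin_sq, one_smul]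
  conv_rhs => rw [← hx]
  rw [map_add, map_smul, map_smul, hJ.apply_apply]
  module

/-- The rotation `cos t + sin t J`, whose orbits are the Hopf circles of `J`. -/
noncomputable def rotation (t : ℝ) : (P.𝔭 →L[ℝ] P.𝔭)ˣ where
  val := Real.cos t • 1 + Real.sin t • LinearMap.toContinuousLinearMap J
  inv := Real.cos t • 1 + (-Real.sin t) • LinearMap.toContinuousLinearMap J
  val_inv := ContinuousLinearMap.ext (hJ.cos_smul_add_sin_smul_apply_cos_smul_sub t)
  inv_val := ContinuousLinearMap.ext fun x => by
    have := hJ.cos_smul_add_sin_smul_apply_cos_smul_sub (-t) x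
    rwa [Real.cos_neg, Real.sin_neg, neg_neg] at this

theorem rotation_smul (t : ℝ) (x : P.𝔭) :
    hJ.rotation t • x = Real.cos t • x + Real.sin t • J x := rfl

theorem rotation_zero : hJ.rotation 0 = 1 :=
  Units.ext (ContinuousLinearMap.ext fun x => (hJ.rotation_smul 0 x).trans (by simp))

theorem rotation_pi_smul (x : P.𝔭) : hJ.rotation Real.pi • x = -x := by
  rw [hJ.rotation_smul, Real.cos_pi, Real.sin_pi, zero_smul, add_zero, neg_one_smul]

theorem continuous_rotation : Continuous hJ.rotation := by
  refine Units.continuous_iff.2 ⟨?_, ?_⟩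
  · change Continuous fun t : ℝ => Real.cos t • (1 : P.𝔭 →L[ℝ] P.𝔭) +
      Real.sin t • LinearMap.toContinuousLinearMap J
    fun_prop
  · change Continuous fun t : ℝ => Real.cos t • (1 : P.𝔭 →L[ℝ] P.𝔭) +
      (-Real.sin t) • LinearMap.toContinuousLinearMap J
    fun_prop

theorem rotation_mem_orthogonalGroup (t : ℝ) : hJ.rotation t ∈ P.orthogonalGroup := by
  intro x y
  change P.innerP (Real.cos t • x + Real.sin t • J x) (Real.cos t • y + Real.sin t • J y) = _
  simp only [innerP_add_left, innerP_add_right, innerP_smul_left, innerP_smul_right, hJ.1, hJ.2]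
  linear_combination (P.innerP x y) * Real.cos_sq_add_sin_sq t

theorem rotation_smul_mem_orbit (hpres : P.PreservesFoliation J) (t : ℝ) (v : P.𝔭) :
    hJ.rotation t • v ∈ MulAction.orbit P.adK v := by
  rcases eq_or_ne v 0 with rfl | hv
  · rw [smul_zero]
    exact MulAction.mem_orbit_self _
  have hpos := P.innerP_self_pos hv
  set r := Real.sqrt (P.innerP v v) with hr
  have hr_ne : r ≠ 0 := (Real.sqrt_pos.2 hpos).ne'
  have hunit : P.innerP (r⁻¹ • v) (r⁻¹ • v) = 1 := by
    rw [innerP_smul_left, innerP_smul_right, ← Real.mul_self_sqrt hpos.le, ← hr]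
    field_simp
  obtain ⟨k, hk⟩ := hpres _ ⟨r⁻¹ • v, hunit, rfl⟩ _ (MulAction.mem_orbit_self _) ⟨t, rfl⟩
  have hscaled : r⁻¹ • (k • v) = r⁻¹ • (hJ.rotation t • v) :=
    ((k.1.val.map_smul r⁻¹ v).symm.trans hk).trans ((hJ.rotation t).val.map_smul r⁻¹ v)
  exact ⟨k, smul_right_injective _ (inv_ne_zero hr_ne) hscaled⟩

/- `Ad(K)|_𝔭` and the rotations generate a connected subgroup of `O(𝔭)` with the same orbits. -/
theorem rotation_mem_adK (hP : P.MaximalityProperty) (hpres : P.PreservesFoliation J) (t : ℝ) :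
    hJ.rotation t ∈ P.adK := by
  obtain ⟨⟨horth, hconn, -⟩, hmax⟩ := hP.maximal
  let S : Set (P.𝔭 →L[ℝ] P.𝔭)ˣ := P.adK ∪ Set.range hJ.rotation
  have hS : IsPreconnected S := IsPreconnected.union 1 (one_mem P.adK) ⟨0, hJ.rotation_zero⟩
    hconn.isPreconnected (isPreconnected_range hJ.continuous_rotation)
  have hle : P.adK ≤ Subgroup.closure S := fun k hk => Subgroup.subset_closure (Or.inl hk)
  have horbit : ∀ s ∈ S, ∀ v : P.𝔭, s • v ∈ MulAction.orbit P.adK v := by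
    rintro s (hs | ⟨t, rfl⟩) v
    · exact ⟨⟨s, hs⟩, rfl⟩
    · exact hJ.rotation_smul_mem_orbit hpres t v
  have horth_closure : Subgroup.closure S ≤ P.orthogonalGroup := (Subgroup.closure_le _).2
    (Set.union_subset horth (Set.range_subset_iff.2 hJ.rotation_mem_orthogonalGroup))
  refine hmax ⟨horth_closure, isConnected_subgroupClosure hS (Or.inl (one_mem P.adK)),
    fun v => Set.Subset.antisymm ?_ ?_⟩ hle (Subgroup.subset_closure (Or.inr ⟨t, rfl⟩))
  · rintro _ ⟨g, rfl⟩
    exact smul_mem_orbit_of_mem_closure horbit g.2 v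
  · rintro _ ⟨k, rfl⟩
    exact ⟨⟨k, hle k.2⟩, rfl⟩

/- Since `-1`, the rotation by `π`, lies in `Ad(K)|_𝔭`, the involution `θ` is `Ad(k)` for some
`k ∈ K`. -/
theorem isInner (hP : P.MaximalityProperty) (hpres : P.PreservesFoliation J) : P.IsInner := by
  obtain ⟨k, hk⟩ := hJ.rotation_mem_adK hP hpres Real.pi
  refine ⟨k, P.modelθ_eq_modelAd hP.effective k.2 fun x hx => ?_⟩
  exact (congrArg (fun A : (P.𝔭 →L[ℝ] P.𝔭)ˣ => ((A • (⟨x, hx⟩ : P.𝔭) : P.𝔭) : LieAlg n G)) hk).trans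
    (congrArg Subtype.val (hJ.rotation_pi_smul ⟨x, hx⟩))

end IsComplexStructure

theorem IsComplexStructure.preservesFoliation_adP {T : P.𝔨}
    (hT : P.IsComplexStructure (P.adP T)) : P.PreservesFoliation (P.adP T) := by
  rintro _ ⟨u, -, rfl⟩ v hv _ ⟨t, rfl⟩
  obtain ⟨k, hk, hkt⟩ := P.exists_mem_K_modelAd_eq_exp (Z := (T : LieAlg n G)) T.2 t
  rw [← MulAction.orbit_eq_iff.2 hv]
  refine ⟨⟨P.sRep ⟨k, hk⟩, ⟨k, hk⟩, rfl⟩, Subtype.ext ?_⟩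
  have hTv : modelBracket n G (T : LieAlg n G) (v : LieAlg n G) =
      (1 : ℝ) • ((P.adP T v : P.𝔭) : LieAlg n G) :=
    (modelBracket_apply (n := n) (G := G) T v).trans (one_smul ℝ _).symm
  have hTTv : modelBracket n G (T : LieAlg n G) (P.adP T v).1 = -((1 : ℝ) • (v : LieAlg n G)) :=
    (modelBracket_apply (n := n) (G := G) T (P.adP T v)).trans
      ((congrArg Subtype.val (hT.apply_apply v)).trans
        (congrArg (fun x : LieAlg n G => -x) (one_smul ℝ (v : LieAlg n G)).symm))
  have hexp := exp_smul_apply_of_rotation hTv hTTv t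
  rw [mul_one] at hexp
  exact (DFunLike.congr_fun hkt v.1).trans hexp

end CompactSymmetricPair

section Complexifications

variable {V : Type*} [AddCommGroup V] [Module ℝ V]

/-- The element `a + i b` of `V^ℂ`. It turns statements on vectors of a complexified space into
statements on pairs of real vectors. -/
noncomputable def complexMk (a b : V) : Complexification V := (1 : ℂ) ⊗ₜ[ℝ] a + Complex.I ⊗ₜ[ℝ] b

theorem tmul_eq_complexMk (c : ℂ) (v : V) : c ⊗ₜ[ℝ] v = complexMk (c.re • v) (c.im • v) := by
  rw [complexMk, ← TensorProduct.smul_tmul, ← TensorProduct.smul_tmul, ← TensorProduct.add_tmul]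
  congr 1
  apply Complex.ext <;> simp

theorem complexMk_add (a b a' b' : V) :
    complexMk a b + complexMk a' b' = complexMk (a + a') (b + b') := by
  simp only [complexMk, TensorProduct.tmul_add]
  abel

theorem smul_complexMk (c : ℂ) (a b : V) :
    c • complexMk a b = complexMk (c.re • a - c.im • b) (c.im • a + c.re • b) := by
  rw [complexMk, smul_add, TensorProduct.smul_tmul', TensorProduct.smul_tmul', tmul_eq_complexMk,
    tmul_eq_complexMk, complexMk_add]
  simp [sub_eq_add_neg]

theorem exists_eq_complexMk (z : Complexification V) : ∃ a b, z = complexMk a b := by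
  induction z using TensorProduct.induction_on with
  | zero => exact ⟨0, 0, by simp [complexMk]⟩
  | tmul c v => exact ⟨_, _, tmul_eq_complexMk c v⟩
  | add x y hx hy =>
    obtain ⟨a, b, rfl⟩ := hx
    obtain ⟨a', b', rfl⟩ := hy
    exact ⟨_, _, complexMk_add a b a' b'⟩

theorem complexMk_inj {a b a' b' : V} : complexMk a b = complexMk a' b' ↔ a = a' ∧ b = b' := by
  refine ⟨fun h => ⟨?_, ?_⟩, fun h => by rw [h.1, h.2]⟩
  · simpa [complexMk] using
      congrArg (fun z => TensorProduct.lid ℝ V (LinearMap.rTensor V Complex.reLm z)) h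
  · simpa [complexMk] using
      congrArg (fun z => TensorProduct.lid ℝ V (LinearMap.rTensor V Complex.imLm z)) h

theorem complexMk_eq_zero {a b : V} : complexMk a b = 0 ↔ a = 0 ∧ b = 0 := by
  rw [← complexMk_inj]
  simp [complexMk]

theorem complexMk_mem_baseChange {S : Submodule ℝ V} {a b : V} :
    complexMk a b ∈ S.baseChange ℂ ↔ a ∈ S ∧ b ∈ S := by
  refine ⟨fun h => ?_, fun h => add_mem (Submodule.tmul_mem_baseChange_of_mem _ h.1)
    (Submodule.tmul_mem_baseChange_of_mem _ h.2)⟩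
  have hle : S.baseChange ℂ ≤ LinearMap.ker (S.mkQ.baseChange ℂ) := by
    rw [Submodule.baseChange_eq_span, Submodule.span_le]
    rintro _ ⟨v, hv, rfl⟩
    simpa using hv
  have hquot : complexMk (S.mkQ a) (S.mkQ b) = 0 := by
    simpa only [complexMk, map_add, LinearMap.baseChange_tmul] using LinearMap.mem_ker.1 (hle h)
  simpa only [complexMk_eq_zero, Submodule.mkQ_apply, Submodule.Quotient.mk_eq_zero] using hquot

theorem toComplexification_smul (r : ℝ) (v : V) :
    toComplexification (r • v) = (r : ℂ) • toComplexification v := by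
  rw [TensorProduct.smul_tmul', smul_eq_mul, mul_one, tmul_eq_complexMk]
  simp [complexMk]

theorem dual_complexification_ext {α β : Module.Dual ℂ (Complexification V)}
    (h : ∀ v, α (toComplexification v) = β (toComplexification v)) : α = β := by
  refine TensorProduct.AlgebraTensorModule.ext fun c v => ?_
  have hcv : c ⊗ₜ[ℝ] v = c • toComplexification v := by simp [TensorProduct.smul_tmul']
  rw [hcv, map_smul, map_smul, h]

end Complexifications

section RootSpaces

variable {L : Type*} [LieRing L] [LieAlgebra ℝ L] {𝔱 : LieSubalgebra ℝ L}

theorem toComplexification_lie_complexMk {M : Type*} [AddCommGroup M] [Module ℝ M]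
    [LieRingModule L M] [LieModule ℝ L M] (H : L) (a b : M) :
    ⁅toComplexification H, complexMk a b⁆ = complexMk ⁅H, a⁆ ⁅H, b⁆ := by
  simp [complexMk, lie_add]

theorem complexMk_mem_complexRootSpace_iff {α : Module.Dual ℂ (Complexification 𝔱)} {a b : L} :
    complexMk a b ∈ complexRootSpace 𝔱 α ↔ ∀ H : 𝔱,
      ⁅(H : L), a⁆ = -((α (toComplexification H)).im • a) - (α (toComplexification H)).re • b ∧
      ⁅(H : L), b⁆ = (α (toComplexification H)).re • a - (α (toComplexification H)).im • b := by
  refine forall_congr' fun H => ?_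
  rw [toComplexification_lie_complexMk, smul_complexMk, complexMk_inj]
  simp [sub_eq_add_neg]

theorem exists_complexMk_mem_complexRootSpace_of_mem_complexRoots
    {α : Module.Dual ℂ (Complexification 𝔱)} (hα : α ∈ complexRoots 𝔱) :
    ∃ a b : L, (a ≠ 0 ∨ b ≠ 0) ∧ complexMk a b ∈ complexRootSpace 𝔱 α := by
  obtain ⟨z, hz, hz0⟩ := Submodule.exists_mem_ne_zero_of_ne_bot hα.2
  obtain ⟨a, b, rfl⟩ := exists_eq_complexMk z
  exact ⟨a, b, not_and_or.1 (mt complexMk_eq_zero.2 hz0), hz⟩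

/- Lie's theorem for the complexification of `R` as a module over that of `𝔱`. -/
theorem exists_complexMk_mem_complexRootSpace_of_lie_mem [FiniteDimensional ℝ L] [IsLieAbelian 𝔱]
    {R : Submodule ℝ L} (hR : R ≠ ⊥) (hinv : ∀ H ∈ 𝔱, ∀ x ∈ R, ⁅H, x⁆ ∈ R) :
    ∃ α : Module.Dual ℂ (Complexification 𝔱), ∃ a ∈ R, ∃ b ∈ R, (a ≠ 0 ∨ b ≠ 0) ∧
      complexMk a b ∈ complexRootSpace 𝔱 α := by
  let N : LieSubmodule ℝ 𝔱 L := { R with lie_mem := fun {H x} hx => hinv H H.2 x hx }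
  have hN : FiniteDimensional ℝ N := inferInstanceAs (FiniteDimensional ℝ R)
  have hNC : Nontrivial (ℂ ⊗[ℝ] N) := by
    obtain ⟨x, hx, hx0⟩ := Submodule.exists_mem_ne_zero_of_ne_bot hR
    exact ⟨complexMk (⟨x, hx⟩ : N) 0, 0, fun h =>
      hx0 (congrArg Subtype.val (complexMk_eq_zero.1 h).1)⟩
  obtain ⟨χ, hχ⟩ := LieModule.exists_nontrivial_weightSpace_of_isSolvable ℂ (ℂ ⊗[ℝ] 𝔱) (ℂ ⊗[ℝ] N)
  obtain ⟨⟨z, hz⟩, hz0⟩ := exists_ne (0 : LieModule.weightSpace (ℂ ⊗[ℝ] N) χ)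
  obtain ⟨a, b, rfl⟩ := exists_eq_complexMk z
  refine ⟨-Complex.I • χ, a, a.2, b, b.2, ?_, complexMk_mem_complexRootSpace_iff.2 fun H => ?_⟩
  · by_contra! h
    exact hz0 (Subtype.ext (complexMk_eq_zero.2 ⟨Subtype.ext h.1, Subtype.ext h.2⟩))
  · have hH : complexMk ⁅H, a⁆ ⁅H, b⁆ = χ (toComplexification H) • complexMk a b :=
      (toComplexification_lie_complexMk H a b).symm.trans
        ((LieModule.mem_weightSpace _ _).1 hz (toComplexification H))
    rw [smul_complexMk, complexMk_inj] at hH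
    refine ⟨(congrArg Subtype.val hH.1).trans ?_, (congrArg Subtype.val hH.2).trans ?_⟩
    · simp [sub_eq_add_neg]
    · simp [sub_eq_add_neg, add_comm]

end RootSpaces

section AbelianSubalgebras

variable {L : Type*} [LieRing L] [LieAlgebra ℝ L] {𝔱 : LieSubalgebra ℝ L}

theorem exists_isLieAbelian_toSubmodule_eq_sup_span [IsLieAbelian 𝔱] {U : L}
    (hU : ∀ H ∈ 𝔱, ⁅H, U⁆ = 0) :
    ∃ 𝔰 : LieSubalgebra ℝ L, 𝔰.toSubmodule = 𝔱.toSubmodule ⊔ ℝ ∙ U ∧ IsLieAbelian 𝔰 := by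
  have h𝔱 : ∀ H ∈ 𝔱, ∀ H' ∈ 𝔱, ⁅H, H'⁆ = 0 := fun H hH H' hH' =>
    congrArg Subtype.val (trivial_lie_zero 𝔱 𝔱 ⟨H, hH⟩ ⟨H', hH'⟩)
  have hU' : ∀ H ∈ 𝔱, ⁅U, H⁆ = 0 := fun H hH => by rw [← lie_skew, hU H hH, neg_zero]
  have hlie : ∀ x ∈ 𝔱.toSubmodule ⊔ ℝ ∙ U, ∀ y ∈ 𝔱.toSubmodule ⊔ ℝ ∙ U, ⁅x, y⁆ = 0 := by
    intro x hx y hy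
    obtain ⟨H, hH, _, hc, rfl⟩ := Submodule.mem_sup.1 hx
    obtain ⟨H', hH', _, hc', rfl⟩ := Submodule.mem_sup.1 hy
    obtain ⟨c, rfl⟩ := Submodule.mem_span_singleton.1 hc
    obtain ⟨c', rfl⟩ := Submodule.mem_span_singleton.1 hc'
    simp [h𝔱 H hH H' hH', hU H hH, hU' H' hH']
  exact ⟨{ 𝔱.toSubmodule ⊔ ℝ ∙ U with
    lie_mem' := fun {x y} hx hy => (hlie x hx y hy).symm ▸ Submodule.zero_mem _ }, rfl,
    ⟨fun x y => Subtype.ext (hlie x x.2 y y.2)⟩⟩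

theorem killingForm_lie_lie_apply (T x y : L) :
    killingForm ℝ L ⁅T, ⁅T, x⁆⁆ y = killingForm ℝ L x ⁅T, ⁅T, y⁆⁆ := by
  rw [LieModule.traceForm_apply_lie_apply', LieModule.traceForm_apply_lie_apply', neg_neg]

/- The operator `D = ad(T)² + 1` is symmetric, hence injective on its image `D(S)`. If `D(S)` were
nonzero, it would contain a common eigenvector of `𝔱`, and this would be killed by `D`. -/
theorem lie_lie_eq_neg_of_forall_mem_complexRootSpace [FiniteDimensional ℝ L] [IsLieAbelian 𝔱]
    (hneg : ∀ X : L, X ≠ 0 → killingForm ℝ L X X < 0) {S : Submodule ℝ L}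
    (hS : ∀ H ∈ 𝔱, ∀ x ∈ S, ⁅H, x⁆ ∈ S) {T : L} (hT : T ∈ 𝔱)
    (hroot : ∀ (α : Module.Dual ℂ (Complexification 𝔱)), ∀ a ∈ S, ∀ b ∈ S, (a ≠ 0 ∨ b ≠ 0) →
      complexMk a b ∈ complexRootSpace 𝔱 α → ⁅T, ⁅T, a⁆⁆ = -a ∧ ⁅T, ⁅T, b⁆⁆ = -b)
    {x : L} (hx : x ∈ S) : ⁅T, ⁅T, x⁆⁆ = -x := by
  let D : L →ₗ[ℝ] L := LieAlgebra.ad ℝ L T ∘ₗ LieAlgebra.ad ℝ L T + LinearMap.id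
  have hD : ∀ y, D y = ⁅T, ⁅T, y⁆⁆ + y := fun _ => rfl
  have hDS : S.map D ≤ S := by
    rintro _ ⟨y, hy, rfl⟩
    exact S.add_mem (hS T hT _ (hS T hT y hy)) hy
  have hsymm : ∀ y z, killingForm ℝ L (D y) z = killingForm ℝ L y (D z) := fun y z => by
    rw [hD, hD, map_add, map_add, LinearMap.add_apply, killingForm_lie_lie_apply]
  have hinj : ∀ y ∈ S.map D, ⁅T, ⁅T, y⁆⁆ = -y → y = 0 := by
    rintro _ ⟨y, -, rfl⟩ h
    refine of_not_not fun h0 => (hneg _ h0).ne ?_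
    rw [hsymm, hD (D y), h, neg_add_cancel, map_zero]
  have hinv : ∀ H ∈ 𝔱, ∀ y ∈ S.map D, ⁅H, y⁆ ∈ S.map D := by
    rintro H hH _ ⟨y, hy, rfl⟩
    have hTH : ⁅T, H⁆ = 0 := congrArg Subtype.val (trivial_lie_zero 𝔱 𝔱 ⟨T, hT⟩ ⟨H, hH⟩)
    have hcomm : ∀ z : L, ⁅T, ⁅H, z⁆⁆ = ⁅H, ⁅T, z⁆⁆ := fun z => by
      rw [leibniz_lie, hTH, zero_lie, zero_add]
    exact ⟨⁅H, y⁆, hS H hH y hy, by rw [hD, hD, lie_add, hcomm, hcomm]⟩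
  by_cases hbot : S.map D = ⊥
  · have hDx : D x ∈ S.map D := ⟨x, hx, rfl⟩
    rw [hbot, Submodule.mem_bot, hD] at hDx
    exact eq_neg_of_add_eq_zero_left hDx
  · obtain ⟨α, a, ha, b, hb, hab, h⟩ := exists_complexMk_mem_complexRootSpace_of_lie_mem hbot hinv
    obtain ⟨hTa, hTb⟩ := hroot α a (hDS ha) b (hDS hb) hab h
    exact absurd (hab.imp (· (hinj a ha hTa)) (· (hinj b hb hTb))) (by simp)

end AbelianSubalgebras

namespace CompactBracket

open NormedSpace

variable {V : Type*} [NormedAddCommGroup V] [NormedSpace ℝ V] {C : CompactBracket V}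

theorem form_self_nonneg (C : CompactBracket V) (x : V) : 0 ≤ C.form x x := by
  rcases eq_or_ne x 0 with rfl | hx
  · rw [map_zero]
  · exact (C.form_pos x hx).le

/- The operator `ad H` is skew-symmetric, so its eigenvalue `i r - s` is purely imaginary. -/
theorem eq_zero_of_ad_eq {H a b : V} {r s : ℝ} (ha : C.ad H a = -(s • a) - r • b)
    (hb : C.ad H b = r • a - s • b) (hab : a ≠ 0 ∨ b ≠ 0) : s = 0 := by
  have hskew_a := C.form_ad H a a
  have hskew_b := C.form_ad H b b
  simp only [ha, hb, map_neg, map_sub, map_smul, neg_apply, smul_apply, sub_apply, smul_eq_mul,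
    C.form_symm b a] at hskew_a hskew_b
  have hmul : s * (C.form a a + C.form b b) = 0 := by linarith
  refine (mul_eq_zero.1 hmul).resolve_right (ne_of_gt ?_)
  rcases hab with ha0 | hb0
  · exact add_pos_of_pos_of_nonneg (C.form_pos a ha0) (C.form_self_nonneg b)
  · exact add_pos_of_nonneg_of_pos (C.form_self_nonneg a) (C.form_pos b hb0)

namespace IsRootPair

variable {𝔱 : Submodule ℝ V} {α : V → ℝ} {a b : V}

/- Multiplication of the root vector by `-i`. -/
theorem rotate (h : IsRootPair C 𝔱 α a b) : IsRootPair C 𝔱 α b (-a) where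
  ad_fst H hH := by rw [h.ad_snd H hH, smul_neg, neg_neg]
  ad_snd H hH := by rw [map_neg, h.ad_fst H hH, neg_neg]

theorem fst_ne_zero (h : IsRootPair C 𝔱 α a b) (hab : a ≠ 0 ∨ b ≠ 0) {H : V} (hH : H ∈ 𝔱)
    (hα : α H ≠ 0) : a ≠ 0 := by
  rintro rfl
  have hb := h.ad_fst H hH
  rw [map_zero, zero_eq_neg, smul_eq_zero_iff_right hα] at hb
  exact hab.elim (· rfl) (· hb)

theorem ad_ad_fst (h : IsRootPair C 𝔱 α a b) {T : V} (hT : T ∈ 𝔱) :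
    C.ad T (C.ad T a) = -(α T ^ 2 • a) := by
  rw [h.ad_fst T hT, map_neg, map_smul, h.ad_snd T hT, smul_smul, sq]

theorem exp_ad_apply_fst [CompleteSpace V] (h : IsRootPair C 𝔱 α a b) {X : V} (hX : X ∈ 𝔱)
    (hcos : Real.cos (α X) = -1) : exp (C.ad X) a = -a := by
  have hsin : Real.sin (α X) = 0 := Real.sin_eq_zero_iff_cos_eq.2 (Or.inr hcos)
  rw [exp_apply_of_rotation (r := α X) (w := -b) (by rw [h.ad_fst X hX, smul_neg])
    (by rw [map_neg, h.ad_snd X hX]), hcos, hsin, zero_smul, add_zero, neg_one_smul]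

end IsRootPair

end CompactBracket

section RealRoots

open NormedSpace

variable {n : ℕ} {G : Type*} [TopologicalSpace G] [ChartedSpace (EuclideanSpace ℝ (Fin n)) G]
  [Group G] [LieGroup (𝓡 n) ∞ G] {𝔱 : LieSubalgebra ℝ (LieAlg n G)}

local notation "𝔼" => EuclideanSpace ℝ (Fin n)

/-- A subalgebra of `𝔤`, as a subspace of the model space. -/
def modelSubspace (𝔱 : LieSubalgebra ℝ (LieAlg n G)) : Submodule ℝ 𝔼 := 𝔱.toSubmodule

theorem modelBracket_modelBracket_apply (T X : LieAlg n G) :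
    modelBracket n G T (modelBracket n G T X) = ⁅T, ⁅T, X⁆⁆ :=
  (congrArg (modelBracket n G T) (modelBracket_apply T X)).trans (modelBracket_apply T ⁅T, X⁆)

open Classical in
/-- The real part of a linear form on `𝔱^ℂ`, as a function on the model space with junk value `0`
outside `𝔱`. Roots of a compact Lie algebra are real on `𝔱` and hence determined by it. -/
noncomputable def rootValue (𝔱 : LieSubalgebra ℝ (LieAlg n G))
    (α : Module.Dual ℂ (Complexification 𝔱)) (H : 𝔼) : ℝ :=
  if h : H ∈ modelSubspace 𝔱 then (α (toComplexification ⟨H, h⟩)).re else 0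

theorem rootValue_of_mem {α : Module.Dual ℂ (Complexification 𝔱)} {H : LieAlg n G} (hH : H ∈ 𝔱) :
    rootValue 𝔱 α H = (α (toComplexification ⟨H, hH⟩)).re := dif_pos hH

variable (hneg : ∀ X : LieAlg n G, X ≠ 0 → killingForm ℝ (LieAlg n G) X X < 0)
  {α : Module.Dual ℂ (Complexification 𝔱)} (hα : α ∈ complexRoots 𝔱)
include hneg hα

theorem im_apply_eq_zero_of_mem_complexRoots (H : 𝔱) : (α (toComplexification H)).im = 0 := by
  obtain ⟨a, b, hab, h⟩ := exists_complexMk_mem_complexRootSpace_of_mem_complexRoots hα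
  obtain ⟨ha, hb⟩ := complexMk_mem_complexRootSpace_iff.1 h H
  exact CompactBracket.eq_zero_of_ad_eq (C := compactBracket hneg)
    ((modelBracket_apply (H : LieAlg n G) a).trans ha)
    ((modelBracket_apply (H : LieAlg n G) b).trans hb) hab

theorem coe_rootValue {H : LieAlg n G} (hH : H ∈ 𝔱) :
    (rootValue 𝔱 α H : ℂ) = α (toComplexification ⟨H, hH⟩) := by
  rw [rootValue_of_mem hH]
  exact Complex.ext rfl (im_apply_eq_zero_of_mem_complexRoots hneg hα ⟨H, hH⟩).symm

theorem exists_rootValue_ne_zero : ∃ H ∈ modelSubspace 𝔱, rootValue 𝔱 α H ≠ 0 := by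
  by_contra! h
  refine hα.1 (dual_complexification_ext fun H => ?_)
  rw [← coe_rootValue hneg hα H.2, h H.1 H.2, Complex.ofReal_zero, LinearMap.zero_apply]

theorem apply_eq_one_or_eq_neg_one_iff_sq_rootValue_eq_one {T : LieAlg n G} (hT : T ∈ 𝔱) :
    (α (toComplexification ⟨T, hT⟩) = 1 ∨ α (toComplexification ⟨T, hT⟩) = -1) ↔
      rootValue 𝔱 α T ^ 2 = 1 := by
  rw [← sq_eq_one_iff, ← coe_rootValue hneg hα hT]
  norm_cast

theorem isRootPair_of_complexMk_mem {a b : LieAlg n G} (h : complexMk a b ∈ complexRootSpace 𝔱 α) :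
    (compactBracket hneg).IsRootPair (modelSubspace 𝔱) (rootValue 𝔱 α) a b := by
  have hre : ∀ {H : LieAlg n G} (hH : H ∈ 𝔱) (x : LieAlg n G),
      (α (toComplexification ⟨H, hH⟩)).re • x = rootValue 𝔱 α H • x := fun hH x => by
    rw [rootValue_of_mem hH]
  have him := im_apply_eq_zero_of_mem_complexRoots hneg hα
  constructor <;> intro H hH <;>
    obtain ⟨ha, hb⟩ := complexMk_mem_complexRootSpace_iff.1 h ⟨H, hH⟩ <;>
    rw [him, zero_smul, hre hH] at ha hb
  · rw [neg_zero, zero_sub] at ha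
    exact (modelBracket_apply (n := n) (G := G) H a).trans ha
  · rw [sub_zero] at hb
    exact (modelBracket_apply (n := n) (G := G) H b).trans hb

end RealRoots

namespace CompactSymmetricPair

open NormedSpace

variable {n : ℕ} {G : Type*} [TopologicalSpace G]
  [ChartedSpace (EuclideanSpace ℝ (Fin n)) G] [Group G] [LieGroup (𝓡 n) ∞ G]
  [T2Space G] [CompactSpace G] [ConnectedSpace G] {P : CompactSymmetricPair n G}
  {𝔱 : LieSubalgebra ℝ (LieAlg n G)} {α : Module.Dual ℂ (Complexification 𝔱)}

local notation "𝔼" => EuclideanSpace ℝ (Fin n)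

namespace IsMaximalAbelian

theorem mem_of_lie_eq_zero (h𝔱 : P.IsMaximalAbelian 𝔱) {U : LieAlg n G}
    (hU : U ∈ P.𝔨) (h : ∀ H ∈ 𝔱, ⁅H, U⁆ = 0) : U ∈ 𝔱 := by
  have := h𝔱.prop.2
  obtain ⟨𝔰, hsup, h𝔰⟩ := exists_isLieAbelian_toSubmodule_eq_sup_span h
  have h𝔰𝔨 : 𝔰.toSubmodule ≤ P.𝔨.toSubmodule :=
    hsup ▸ sup_le h𝔱.prop.1 ((Submodule.span_singleton_le_iff_mem _ _).2 hU)
  have h𝔱𝔰 : 𝔱.toSubmodule ≤ 𝔰.toSubmodule := hsup ▸ le_sup_left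
  have hU𝔰 : U ∈ 𝔰.toSubmodule :=
    hsup ▸ Submodule.mem_sup_right (Submodule.mem_span_singleton_self U)
  exact h𝔱.2 (y := 𝔰) ⟨h𝔰𝔨, h𝔰⟩ h𝔱𝔰 hU𝔰

theorem modelBracket_eq_zero (h𝔱 : P.IsMaximalAbelian 𝔱) :
    ∀ H ∈ modelSubspace 𝔱, ∀ H' ∈ modelSubspace 𝔱, modelBracket n G H H' = 0 :=
  fun H hH H' hH' => (modelBracket_apply (n := n) (G := G) H H').trans
    (congrArg Subtype.val (h𝔱.prop.2.trivial ⟨H, hH⟩ ⟨H', hH'⟩))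

theorem mem_of_modelBracket_eq_zero (h𝔱 : P.IsMaximalAbelian 𝔱) {U : 𝔼} (hU : P.modelθ U = U)
    (h : ∀ H ∈ modelSubspace 𝔱, modelBracket n G H U = 0) : U ∈ modelSubspace 𝔱 :=
  h𝔱.mem_of_lie_eq_zero (U := U) hU fun H hH =>
    (modelBracket_apply (n := n) (G := G) H U).symm.trans (h H hH)

theorem modelθ_apply (h𝔱 : P.IsMaximalAbelian 𝔱) {H : 𝔼} (hH : H ∈ modelSubspace 𝔱) :
    P.modelθ H = H :=
  h𝔱.prop.1 hH

theorem exists_isShortestLog (h𝔱 : P.IsMaximalAbelian 𝔱) (hinner : P.IsInner) :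
    ∃ X, P.bracket.IsShortestLog (modelSubspace 𝔱) X ∧ exp (modelBracket n G X) = P.modelθ := by
  obtain ⟨g, hg⟩ := hinner
  obtain ⟨Y₀, hY₀⟩ := exists_modelAd_eq_exp P.killingForm_neg g
  obtain ⟨Y, hY, hcomm⟩ := CompactBracket.exists_log_commuting (C := P.bracket)
    ⟨Y₀, (show P.modelθ = modelAd n g from hg).trans hY₀⟩ (fun H hH => h𝔱.modelθ_apply hH)
    h𝔱.modelBracket_eq_zero
  have hYθ : P.modelθ Y = Y := by rw [hY, CompactBracket.exp_ad_apply_self]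
  obtain ⟨X, hX, hXY⟩ := P.bracket.exists_isShortestLog (h𝔱.mem_of_modelBracket_eq_zero hYθ hcomm)
  exact ⟨X, hX, hXY.trans hY.symm⟩

theorem isSelfCentralizing (h𝔱 : P.IsMaximalAbelian 𝔱) (hinner : P.IsInner) :
    P.bracket.IsSelfCentralizing (modelSubspace 𝔱) := by
  obtain ⟨X, hX, hexp⟩ := h𝔱.exists_isShortestLog hinner
  refine fun x => ⟨fun hx H hH => h𝔱.modelBracket_eq_zero H hH x hx, fun hx =>
    h𝔱.mem_of_modelBracket_eq_zero ?_ hx⟩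
  rw [← hexp]
  exact CompactBracket.exp_ad_apply_of_commute (C := P.bracket) (hx X hX.1)

theorem eq_zero_of_mem_𝔭 (h𝔱 : P.IsMaximalAbelian 𝔱) (hinner : P.IsInner) {x : LieAlg n G}
    (hx : x ∈ P.𝔭) (hcomm : ∀ H ∈ 𝔱, ⁅H, x⁆ = 0) : x = 0 := by
  have := IsAddTorsionFree.of_isTorsionFree ℝ (LieAlg n G)
  have hx𝔱 : x ∈ modelSubspace 𝔱 := (h𝔱.isSelfCentralizing hinner x).2 fun H hH =>
    (modelBracket_apply (n := n) (G := G) H x).trans (hcomm H hH)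
  exact self_eq_neg.1 ((h𝔱.modelθ_apply hx𝔱).symm.trans hx)

theorem mem_complexRoots (h𝔱 : P.IsMaximalAbelian 𝔱) (hinner : P.IsInner) {a b : LieAlg n G}
    (ha : a ∈ P.𝔭) (hb : b ∈ P.𝔭) (hab : a ≠ 0 ∨ b ≠ 0)
    (h : complexMk a b ∈ complexRootSpace 𝔱 α) : α ∈ complexRoots 𝔱 := by
  refine ⟨?_, (Submodule.ne_bot_iff _).2 ⟨_, h, mt complexMk_eq_zero.1 (not_and_or.2 hab)⟩⟩
  rintro rfl
  have h0 := complexMk_mem_complexRootSpace_iff.1 h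
  simp only [LinearMap.zero_apply, Complex.zero_re, Complex.zero_im, zero_smul, neg_zero,
    sub_zero] at h0
  exact hab.elim (· (h𝔱.eq_zero_of_mem_𝔭 hinner ha fun H hH => (h0 ⟨H, hH⟩).1))
    (· (h𝔱.eq_zero_of_mem_𝔭 hinner hb fun H hH => (h0 ⟨H, hH⟩).2))

/- The involution `θ = exp(ad X)` acts on all root vectors of `α` as the rotation by `α(X)`, so it
acts on all of them as `-1` if it does so on one. -/
theorem isNoncompactRoot (h𝔱 : P.IsMaximalAbelian 𝔱) (hinner : P.IsInner) {a b : LieAlg n G}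
    (ha : a ∈ P.𝔭) (hb : b ∈ P.𝔭) (hab : a ≠ 0 ∨ b ≠ 0)
    (h : complexMk a b ∈ complexRootSpace 𝔱 α) : P.IsNoncompactRoot 𝔱 α := by
  have hα := h𝔱.mem_complexRoots hinner ha hb hab h
  refine ⟨hα, fun z hz => ?_⟩
  obtain ⟨a', b', rfl⟩ := exists_eq_complexMk z
  obtain ⟨X, hX, hexp⟩ := h𝔱.exists_isShortestLog hinner
  obtain ⟨H, hH, hαH⟩ := exists_rootValue_ne_zero P.killingForm_neg hα
  have hpair := isRootPair_of_complexMk_mem P.killingForm_neg hα h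
  have hpair' := isRootPair_of_complexMk_mem P.killingForm_neg hα hz
  have hcos := hpair.cos_apply_eq_neg_one (hpair.fst_ne_zero hab hH hαH) hH hαH hX.1
    ((DFunLike.congr_fun hexp a).trans ha)
  exact complexMk_mem_baseChange.2
    ⟨(DFunLike.congr_fun hexp a').symm.trans (hpair'.exp_ad_apply_fst hX.1 hcos),
      (DFunLike.congr_fun hexp b').symm.trans (hpair'.rotate.exp_ad_apply_fst hX.1 hcos)⟩

end IsMaximalAbelian

namespace IsNoncompactRoot

theorem exists_isRootPair (hα : P.IsNoncompactRoot 𝔱 α) :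
    ∃ a ∈ P.𝔭, a ≠ 0 ∧ ∃ b, P.bracket.IsRootPair (modelSubspace 𝔱) (rootValue 𝔱 α) a b := by
  obtain ⟨a, b, hab, h⟩ := exists_complexMk_mem_complexRootSpace_of_mem_complexRoots hα.1
  obtain ⟨H, hH, hαH⟩ := exists_rootValue_ne_zero P.killingForm_neg hα.1
  have hpair := isRootPair_of_complexMk_mem P.killingForm_neg hα.1 h
  exact ⟨a, (complexMk_mem_baseChange.1 (hα.2 h)).1, hpair.fst_ne_zero hab hH hαH, b, hpair⟩

theorem apply_eq_one_or_eq_neg_one (hα : P.IsNoncompactRoot 𝔱 α) {T : LieAlg n G} (hT : T ∈ 𝔱)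
    (hJ : ∀ x ∈ P.𝔭, ⁅T, ⁅T, x⁆⁆ = -x) :
    α (toComplexification ⟨T, hT⟩) = 1 ∨ α (toComplexification ⟨T, hT⟩) = -1 := by
  rw [apply_eq_one_or_eq_neg_one_iff_sq_rootValue_eq_one P.killingForm_neg hα.1]
  obtain ⟨a, ha, ha0, b, hpair⟩ := hα.exists_isRootPair
  have hTTa : rootValue 𝔱 α T ^ 2 • a = (1 : ℝ) • a := by
    have hneg := (hpair.ad_ad_fst hT).symm.trans
      ((modelBracket_modelBracket_apply (n := n) (G := G) T a).trans (hJ a ha))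
    exact (neg_injective hneg).trans (one_smul ℝ a).symm
  exact smul_left_injective ℝ ha0 hTTa

theorem rootValue_eq_pi_or_eq_neg_pi (hα : P.IsNoncompactRoot 𝔱 α) (h𝔱 : P.IsMaximalAbelian 𝔱)
    (hinner : P.IsInner) {X : 𝔼} (hX : P.bracket.IsShortestLog (modelSubspace 𝔱) X)
    (hexp : exp (modelBracket n G X) = P.modelθ) :
    rootValue 𝔱 α X = Real.pi ∨ rootValue 𝔱 α X = -Real.pi := by
  obtain ⟨a, ha, ha0, b, hpair⟩ := hα.exists_isRootPair
  obtain ⟨H, hH, hαH⟩ := exists_rootValue_ne_zero P.killingForm_neg hα.1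
  exact hpair.apply_eq_pi_or_eq_neg_pi (h𝔱.isSelfCentralizing hinner) ha0 hH hαH hX
    ((DFunLike.congr_fun hexp a).trans ha)

/- Complex conjugation maps the root space of `-α` to that of `α`. -/
theorem neg (hα : P.IsNoncompactRoot 𝔱 α) (hneg : -α ∈ complexRoots 𝔱) :
    P.IsNoncompactRoot 𝔱 (-α) := by
  refine ⟨hneg, fun z hz => ?_⟩
  obtain ⟨a, b, rfl⟩ := exists_eq_complexMk z
  have hconj : complexMk a (-b) ∈ complexRootSpace 𝔱 α := by
    refine complexMk_mem_complexRootSpace_iff.2 fun H => ?_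
    obtain ⟨ha, hb⟩ := complexMk_mem_complexRootSpace_iff.1 hz H
    have him := im_apply_eq_zero_of_mem_complexRoots P.killingForm_neg hα.1 H
    simp only [LinearMap.neg_apply, Complex.neg_im, Complex.neg_re, him] at ha hb
    rw [lie_neg, ha, hb, him]
    simp
  obtain ⟨ha, hb⟩ := complexMk_mem_baseChange.1 (hα.2 hconj)
  exact complexMk_mem_baseChange.2 ⟨ha, P.𝔭.neg_mem_iff.1 hb⟩

end IsNoncompactRoot

theorem forall_noncompactRoot_iff_of_isPositiveSystem {T : 𝔱}
    {Δp : Set (Module.Dual ℂ (Complexification 𝔱))} (hΔ : IsPositiveSystem 𝔱 Δp) :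
    (∀ α : Module.Dual ℂ (Complexification 𝔱), P.IsNoncompactRoot 𝔱 α →
      α (toComplexification T) = 1 ∨ α (toComplexification T) = -1) ↔
    ∀ α ∈ Δp, P.IsNoncompactRoot 𝔱 α →
      α (toComplexification T) = 1 ∨ α (toComplexification T) = -1 := by
  refine ⟨fun h α _ hα => h α hα, fun h α hα => ?_⟩
  rcases hΔ.2.1 α hα.1 with ⟨hmem, -⟩ | ⟨hmem, -⟩
  · exact h α hmem hα
  · have hneg := h (-α) hmem (hα.neg (hΔ.1 hmem))
    rwa [LinearMap.neg_apply, neg_inj, neg_eq_iff_eq_neg, or_comm] at hneg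

theorem innerP_adP_apply (T : P.𝔨) (x y : P.𝔭) :
    P.innerP (P.adP T x) y = -P.innerP x (P.adP T y) :=
  congrArg (fun r : ℝ => -r)
    (LieModule.traceForm_apply_lie_apply' ℝ (LieAlg n G) (LieAlg n G) T.1 x.1 y.1)

theorem isComplexStructure_adP_iff {T : P.𝔨} : P.IsComplexStructure (P.adP T) ↔
    ∀ x ∈ P.𝔭, ⁅(T : LieAlg n G), ⁅(T : LieAlg n G), x⁆⁆ = -x := by
  refine ⟨fun h x hx => congrArg Subtype.val (h.apply_apply ⟨x, hx⟩), fun h =>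
    ⟨fun x y => ?_, innerP_adP_apply T⟩⟩
  have hTTy : P.adP T (P.adP T y) = -y := Subtype.ext (h y y.2)
  rw [innerP_adP_apply, hTTy, ← neg_one_smul ℝ y, innerP_smul_right]
  ring

namespace IsMaximalAbelian

theorem lie_lie_eq_neg (h𝔱 : P.IsMaximalAbelian 𝔱) (hinner : P.IsInner) {T : LieAlg n G}
    (hT : T ∈ 𝔱)
    (hroots : ∀ α : Module.Dual ℂ (Complexification 𝔱), P.IsNoncompactRoot 𝔱 α →
      α (toComplexification ⟨T, hT⟩) = 1 ∨ α (toComplexification ⟨T, hT⟩) = -1)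
    {x : LieAlg n G} (hx : x ∈ P.𝔭) : ⁅T, ⁅T, x⁆⁆ = -x := by
  have := h𝔱.prop.2
  refine lie_lie_eq_neg_of_forall_mem_complexRootSpace P.killingForm_neg
    (fun H hH y hy => P.lie_mem_𝔭 (h𝔱.prop.1 hH) hy) hT (fun α a ha b hb hab h => ?_) hx
  have hα := h𝔱.isNoncompactRoot hinner ha hb hab h
  have hsq := (apply_eq_one_or_eq_neg_one_iff_sq_rootValue_eq_one P.killingForm_neg hα.1 hT).1
    (hroots α hα)
  have hpair := isRootPair_of_complexMk_mem P.killingForm_neg hα.1 h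
  have hTT : ∀ y : LieAlg n G, modelBracket n G T (modelBracket n G T y) =
      -(rootValue 𝔱 α T ^ 2 • y) → ⁅T, ⁅T, y⁆⁆ = -y := fun y hy => by
    rw [hsq, one_smul] at hy
    exact (modelBracket_modelBracket_apply T y).symm.trans hy
  exact ⟨hTT a (hpair.ad_ad_fst hT), hTT b (hpair.rotate.ad_ad_fst hT)⟩

theorem isComplexStructure_adP_and_preservesFoliation_iff (h𝔱 : P.IsMaximalAbelian 𝔱)
    (hinner : P.IsInner) {T : LieAlg n G} (hT : T ∈ 𝔱) :
    (P.IsComplexStructure (P.adP ⟨T, h𝔱.prop.1 hT⟩) ∧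
        P.PreservesFoliation (P.adP ⟨T, h𝔱.prop.1 hT⟩)) ↔
      ∀ α : Module.Dual ℂ (Complexification 𝔱), P.IsNoncompactRoot 𝔱 α →
        α (toComplexification ⟨T, hT⟩) = 1 ∨ α (toComplexification ⟨T, hT⟩) = -1 := by
  rw [and_iff_left_of_imp IsComplexStructure.preservesFoliation_adP, isComplexStructure_adP_iff]
  exact ⟨fun h α hα => hα.apply_eq_one_or_eq_neg_one hT h,
    fun h x hx => h𝔱.lie_lie_eq_neg hinner hT h hx⟩

/- If `θ = exp(ad X)` with `X ∈ 𝔱` of minimal length, then `T = X / π`. -/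
theorem exists_forall_noncompactRoot_apply_eq (h𝔱 : P.IsMaximalAbelian 𝔱) (hinner : P.IsInner) :
    ∃ (T : LieAlg n G) (hT : T ∈ 𝔱),
      ∀ α : Module.Dual ℂ (Complexification 𝔱), P.IsNoncompactRoot 𝔱 α →
        α (toComplexification ⟨T, hT⟩) = 1 ∨ α (toComplexification ⟨T, hT⟩) = -1 := by
  obtain ⟨X, hX, hexp⟩ := h𝔱.exists_isShortestLog hinner
  refine ⟨Real.pi⁻¹ • X, 𝔱.smul_mem _ hX.1, fun α hα => ?_⟩
  have hsmul : α (toComplexification ⟨Real.pi⁻¹ • X, 𝔱.smul_mem _ hX.1⟩) =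
      ((Real.pi⁻¹ : ℝ) : ℂ) • α (toComplexification ⟨X, hX.1⟩) :=
    (congrArg α (toComplexification_smul Real.pi⁻¹ (⟨X, hX.1⟩ : 𝔱))).trans (map_smul α _ _)
  rw [hsmul, ← coe_rootValue P.killingForm_neg hα.1 hX.1]
  refine (hα.rootValue_eq_pi_or_eq_neg_pi h𝔱 hinner hX hexp).imp (fun hpi => ?_) fun hpi => ?_
  · simp [hpi, Real.pi_ne_zero]
  · simp [hpi, Real.pi_ne_zero]

end IsMaximalAbelian

end CompactSymmetricPair

theorem mainTheorem9 {n : ℕ} {G : Type*} [TopologicalSpace G]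
    [ChartedSpace (EuclideanSpace ℝ (Fin n)) G] [Group G] [LieGroup (𝓡 n) ∞ G]
    [T2Space G] [CompactSpace G] [ConnectedSpace G]
    (P : CompactSymmetricPair n G) (hP : P.MaximalityProperty)
    (𝔱 : LieSubalgebra ℝ (LieAlg n G)) (h𝔱 : P.IsMaximalAbelian 𝔱) :
    ((∃ J : P.𝔭 →ₗ[ℝ] P.𝔭, P.IsComplexStructure J ∧ P.PreservesFoliation J) ↔ P.IsInner) ∧
    (P.IsInner → ∀ (T : LieAlg n G) (hT : T ∈ 𝔱),
      ((P.IsComplexStructure (P.adP ⟨T, h𝔱.prop.1 hT⟩) ∧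
          P.PreservesFoliation (P.adP ⟨T, h𝔱.prop.1 hT⟩)) ↔
        ∀ α : Module.Dual ℂ (Complexification 𝔱), P.IsNoncompactRoot 𝔱 α →
          α (toComplexification ⟨T, hT⟩) = 1 ∨ α (toComplexification ⟨T, hT⟩) = -1) ∧
      ∀ Δp : Set (Module.Dual ℂ (Complexification 𝔱)), IsPositiveSystem 𝔱 Δp →
        ((P.IsComplexStructure (P.adP ⟨T, h𝔱.prop.1 hT⟩) ∧
            P.PreservesFoliation (P.adP ⟨T, h𝔱.prop.1 hT⟩)) ↔
          ∀ α ∈ Δp, P.IsNoncompactRoot 𝔱 α →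
            α (toComplexification ⟨T, hT⟩) = 1 ∨ α (toComplexification ⟨T, hT⟩) = -1)) := by
  refine ⟨⟨fun ⟨_, hJ, hpres⟩ => hJ.isInner hP hpres, fun hinner => ?_⟩, fun hinner T hT => ?_⟩
  · obtain ⟨T, hT, hroots⟩ := h𝔱.exists_forall_noncompactRoot_apply_eq hinner
    exact ⟨_, (h𝔱.isComplexStructure_adP_and_preservesFoliation_iff hinner hT).2 hroots⟩
  · have hiff := h𝔱.isComplexStructure_adP_and_preservesFoliation_iff hinner hT
    exact ⟨hiff, fun Δp hΔ => hiff.trans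
      (CompactSymmetricPair.forall_noncompactRoot_iff_of_isPositiveSystem hΔ)⟩
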